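/- Let $n\ge 2$ be even and $N=n^2$. Consider the quantum walk on the $n\times n$ grid with periodic boundary conditions (positions $(x,y)\in(\mathbb Z/n)^2$), with state space spanned by the orthonormal basis $|v,x,y\rangle$, $v\in\{0,1\}$, and one step $$U=\Sigma_y(C_y\otimes 1)\Sigma_x(C_x\otimes 1),\qquad C_x=\tfrac1{\sqrt2}\begin{pmatrix}1&i\\ i&1\end{pmatrix},\quad C_y=\tfrac1{\sqrt2}\begin{pmatrix}1&-i\\-i&1\end{pmatrix},$$ $$\Sigma_x|v,x,y\rangle=|v,x-(-1)^v,y\rangle,\qquad \Sigma_y|v,x,y\rangle=|v,x,y-(-1)^v\rangle .$$ Let $|d\rangle=(|0\rangle+|1\rangle)/\sqrt2$. For a set $M$ of marked vertices put $R_M=1-2\sum_{m\in M}|d,m\rangle\langle d,m|$, $U'_M=UR_M$, let $\psi(0)$ be the equal superposition of all $2N$ basis states, and let $p_M(t)=\sum_{m\in M}|\langle d,m|(U'_M)^t|\psi(0)\rangle|^2$ be the success probability after $t\in\mathbb N$ steps. Let $M=\{m_0,m_1\}$, where $m_0$ lies on the even sublattice ($x+y$ even, $0\le x,y<n$) and $m_1$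 on the odd sublattice ($x+y$ odd); let $\mathcal H_e$ and $\mathcal H_o=\mathcal H_e^\perp$ be the spans of the basis states on the two sublattices. Then the following hold. 1. (Decoupling, for every even $n$.) $U'_M$ leaves $\mathcal H_e$ and $\mathcal H_o$ invariant; it coincides with $U'_{\{m_0\}}$ on $\mathcal H_e$ and with $U'_{\{m_1\}}$ on $\mathcal H_o$. For every $t$ and $j=0,1$, $\langle d,m_j|(U'_M)^t|\psi(0)\rangle=\langle d,m_j|(U'_{\{m_j\}})^t|\psi(0)\rangle$, so $p_M(t)=p_{\{m_0\}}(t)+p_{\{m_1\}}(t)$; moreover $p_{\{m_0\}}(t)=p_{\{m_1\}}(t)$. 2. As $N\to\infty$ along even $n$, uniformly in the choice of $m_0,m_1$ as above: (a) Let $\lambda_+$ be the least $\theta>0$, and $\lambda_-$ the greatest $\theta<0$, such that $e^{i\theta}$ is an eigenvalue of $U'_M$. They exist, $\lambda_-=-\lambda_+$, and $\lambda_\pm\sim\pm2\sqrt{\dfrac{\pi}{N\ln N}}$. (b) $p_M(t)=\dfrac{\pi}{2\ln N}\bigl(\sin^2(\lambda_+t)+o(1)\bigr)$, uniformly in $t\in\mathbb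 N$. (c) If $t_{opt}$ maximizes $p_M$ over the integers of the first period $0\le t\le\pi/\lambda_+$ of $\sin^2(\lambda_+t)$, then $t_{opt}\sim\dfrac{\sqrt{\pi N\ln N}}4$ and $p_M(t_{opt})\sim\dfrac{\pi}{2\ln N}$; in particular the success probability is $\Theta(1/\ln N)$. No earlier time is asymptotically as good: for every $\varepsilon>0$ there is $\eta>0$ such that, for all large $N$, every $T\in\mathbb N$ with $p_M(T)\ge(1-\eta)\,p_M(t)$ for all $t\in\mathbb N$ satisfies $T\ge(1-\varepsilon)\dfrac{\sqrt{\pi N\ln N}}4$. (d) $p_M\bigl(\lfloor\sqrt{\pi N\ln N}/4\rfloor\bigr)\sim\dfrac{\pi}{2\ln N}$. -/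

import Mathlib

noncomputable section

namespace QWSearch

/-- Vertices `(x, y)` of the `n × n` grid with periodic boundary conditions. -/
abbrev Vertex (n : ℕ) : Type := ZMod n × ZMod n

/-- The state space of the walker: coin space `ℂ²` tensored with position space `ℂ^(n × n)`,
with coordinates indexed by the basis states `|v, x, y⟩`. -/
abbrev Walker (n : ℕ) : Type := EuclideanSpace ℂ (Fin 2 × Vertex n)

/-- The number `N = n²` of vertices. -/
def gridSize (n : ℕ) : ℝ := (n : ℝ) ^ 2

/-- `C_x = (1/√2) [[1, i], [i, 1]]`. -/
def coinX : Matrix (Fin 2) (Fin 2) ℂ :=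
  ((1 / Real.sqrt 2 : ℝ) : ℂ) • !![1, Complex.I; Complex.I, 1]

/-- `C_y = (1/√2) [[1, -i], [-i, 1]]`. -/
def coinY : Matrix (Fin 2) (Fin 2) ℂ :=
  ((1 / Real.sqrt 2 : ℝ) : ℂ) • !![1, -Complex.I; -Complex.I, 1]

/-- A vertex `(x, y)`, `0 ≤ x, y < n`, is on the even sublattice when `x + y` is even, and on the
odd sublattice otherwise. -/
def EvenVertex {n : ℕ} (m : Vertex n) : Prop := Even (m.1.val + m.2.val)

variable {n : ℕ}

/-- The basis state `|v, m⟩`. -/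
def ket (v : Fin 2) (m : Vertex n) : Walker n := EuclideanSpace.single (v, m) 1

/-- The operator `C ⊗ 1`. -/
def coinOp (C : Matrix (Fin 2) (Fin 2) ℂ) : Walker n →ₗ[ℂ] Walker n where
  toFun ψ := WithLp.toLp 2 fun p => ∑ w, C p.1 w * ψ (w, p.2)
  map_add' ψ φ := by
    ext p
    simp [mul_add, Finset.sum_add_distrib]
  map_smul' c ψ := by
    ext p
    simp only [PiLp.smul_apply, smul_eq_mul, RingHom.id_apply, Finset.mul_sum]
    exact Finset.sum_congr rfl fun w _ => by ring

/-- The shift `Σ_x`, `|v, x, y⟩ ↦ |v, x - (-1)^v, y⟩` (see `shiftX_ket`). -/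
def shiftX : Walker n →ₗ[ℂ] Walker n where
  toFun ψ := WithLp.toLp 2 fun p => ψ (p.1, (p.2.1 + (-1) ^ (p.1 : ℕ), p.2.2))
  map_add' ψ φ := by
    ext p
    simp
  map_smul' c ψ := by
    ext p
    simp

/-- The shift `Σ_y`, `|v, x, y⟩ ↦ |v, x, y - (-1)^v⟩` (see `shiftY_ket`). -/
def shiftY : Walker n →ₗ[ℂ] Walker n where
  toFun ψ := WithLp.toLp 2 fun p => ψ (p.1, (p.2.1, p.2.2 + (-1) ^ (p.1 : ℕ)))
  map_add' ψ φ := by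
    ext p
    simp
  map_smul' c ψ := by
    ext p
    simp

theorem coinOp_ket (C : Matrix (Fin 2) (Fin 2) ℂ) (v : Fin 2) (m : Vertex n) :
    coinOp C (ket v m) = ∑ w, C w v • ket w m := by
  ext ⟨w, q⟩
  fin_cases v <;> fin_cases w <;> by_cases h : q = m <;>
    simp [coinOp, ket, h]

theorem shiftX_ket (v : Fin 2) (x y : ZMod n) :
    shiftX (ket v (x, y)) = ket v (x - (-1) ^ (v : ℕ), y) := by
  ext ⟨w, x', y'⟩
  by_cases hw : w = v
  · subst hw
    simp [shiftX, ket, eq_sub_iff_add_eq]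
  · simp [shiftX, ket, hw]

theorem shiftY_ket (v : Fin 2) (x y : ZMod n) :
    shiftY (ket v (x, y)) = ket v (x, y - (-1) ^ (v : ℕ)) := by
  ext ⟨w, x', y'⟩
  by_cases hw : w = v
  · subst hw
    simp [shiftY, ket, eq_sub_iff_add_eq]
  · simp [shiftY, ket, hw]

variable [NeZero n]

/-- One step of the walk, `U = Σ_y (C_y ⊗ 1) Σ_x (C_x ⊗ 1)`. -/
def walkStep : Module.End ℂ (Walker n) :=
  shiftY ∘ₗ coinOp coinY ∘ₗ shiftX ∘ₗ coinOp coinX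

/-- `|d, m⟩`, where `|d⟩ = (|0⟩ + |1⟩)/√2` is the diagonal coin state. -/
def diagKet (m : Vertex n) : Walker n :=
  ((1 / Real.sqrt 2 : ℝ) : ℂ) • (ket 0 m + ket 1 m)

/-- The oracle `R = 1 - 2 ∑_{m ∈ M} |d, m⟩⟨d, m|`. -/
def oracle (M : Finset (Vertex n)) : Module.End ℂ (Walker n) :=
  LinearMap.id - (2 : ℂ) • ∑ m ∈ M,
    (innerSL ℂ (diagKet m)).toLinearMap.smulRight (diagKet m)

theorem oracle_apply (M : Finset (Vertex n)) (ψ : Walker n) :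
    oracle M ψ = ψ - (2 : ℂ) • ∑ m ∈ M, inner ℂ (diagKet m) ψ • diagKet m := by
  simp [oracle, LinearMap.sum_apply]

/-- The search operator `U' = U R` for the set `M` of marked vertices. -/
def searchStep (M : Finset (Vertex n)) : Module.End ℂ (Walker n) := walkStep * oracle M

/-- The equal superposition `ψ(0)` of all `2N` basis states. -/
def initState : Walker n :=
  WithLp.toLp 2 fun _ => ((1 / Real.sqrt (2 * gridSize n) : ℝ) : ℂ)

/-- The state `U'^t ψ(0)` after `t` steps of the search. -/
def stateAt (M : Finset (Vertex n)) (t : ℕ) : Walker n := (searchStep M ^ t) initState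

/-- The success probability `p(t) = ∑_{m ∈ M} |⟨d, m| U'^t |ψ(0)⟩|²`. -/
def successProb (M : Finset (Vertex n)) (t : ℕ) : ℝ :=
  ∑ m ∈ M, ‖inner ℂ (diagKet m) (stateAt M t)‖ ^ 2

/-- The real `θ` such that `e^{iθ}` is an eigenvalue of `U'`. -/
def eigenphases (M : Finset (Vertex n)) : Set ℝ :=
  {θ : ℝ | Module.End.HasEigenvalue (searchStep M) (Complex.exp (θ * Complex.I))}

variable (n) in
/-- The states supported on the even sublattice. -/
def evenSpace : Submodule ℂ (Walker n) :=
  Submodule.span ℂ {ψ | ∃ (v : Fin 2) (m : Vertex n), EvenVertex m ∧ ψ = ket v m}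

variable (n) in
/-- The states supported on the odd sublattice. -/
def oddSpace : Submodule ℂ (Walker n) :=
  Submodule.span ℂ {ψ | ∃ (v : Fin 2) (m : Vertex n), ¬ EvenVertex m ∧ ψ = ket v m}

end QWSearch

end

open QWSearch

/-! A step of `U` changes both coordinates by ±1, so for even n it preserves the parity of x + y.
`U` therefore acts separately on the two sublattices, and each of the two reflections lives on one
of them. Translation invariance makes the two single-target problems equivalent, which leaves one
marked vertex m; write D for |d,m⟩.

In `U + U⁻¹` the coin cancels (`walkStep_add_walkBack_apply`): on each coin component it is half the
sum over the diagonal neighbours, with eigenvalues 2 cos k cos l. The resolvent of `U` is thus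
explicit. With u = (z + 1/z)/2 one finds 2⟨D, (1 - U/z)⁻¹D⟩ - 1 = (z - u) L(u), where L(u) = N⁻¹ ∑
1/(u - cos k cos l) is `levelTransform`. The oracle is a rank-one reflection, and it inverts this
transform (`exists_resolvent_searchStep`). So the spectral measure κ of `U'` at D, carried to the
cosines τ of the eigenphases, satisfies (u² - 1) L(u) ∑ κ/(u - τ) = 1 (`exists_amplitude_formula`).
Off the levels cos k cos l, eigenphases with nonzero sine correspond to zeros of L, and their masses
are residues (`dual_mass_root`).

The level 1 occurs exactly twice, at momenta (0,0) and (π,π), and all others lie at least 8/N lower.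
For large n, L has a single zero 1 - x in this gap, with x ≈ 2/S, where S is the sum of 1/(1 - cos k
cos l) over the other momenta. Summing over l in closed form and then over k gives S = (N/π) ln N +
O(N) (`abs_deflatedSum_sub_le`). Hence λ = arccos(1 - x) ~ √(2x) ~ 2√(π/(N ln N)).

Since `U` fixes ψ(0), the amplitude at D is 1/n times the integral against κ of the Dirichlet kernel
sin((t + 1/2)α)/sin(α/2). The atom at 1 - x yields a sine of amplitude ~ ½√(π/ln N). Other atoms
within 1/n of 1 have total mass O(1/ln N), by the lower bound on L(1 + 1/n), and kernel at most n/2;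
the rest have kernel O(√n). The error O(1/ln N) is uniform in t and of smaller order
(`amplitude_estimate`). Squaring and doubling gives the profile (π/(2 ln N)) sin²(λt). The
statements on optimal times follow because sin² is quadratic at its maximum and λ√(πN ln N)/4 tends
to π/2. -/

namespace QWSearch
-- The walk in coordinates, its inverse and unitarity.
section WalkBasics

variable {n : ℕ}

theorem walker_ext {φ ψ : Walker n} (h0 : ∀ q, φ (0, q) = ψ (0, q))
    (h1 : ∀ q, φ (1, q) = ψ (1, q)) : φ = ψ := by
  ext ⟨v, q⟩
  fin_cases v
  · exact h0 q
  · exact h1 q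

theorem coe_inv_sqrt_two_mul_self :
    ((1 / Real.sqrt 2 : ℝ) : ℂ) * ((1 / Real.sqrt 2 : ℝ) : ℂ) = 1 / 2 := by
  rw [← Complex.ofReal_mul, div_mul_div_comm, Real.mul_self_sqrt (by norm_num)]
  norm_num

theorem walkStep_apply_zero (ψ : Walker n) (x y : ZMod n) :
    walkStep ψ (0, (x, y)) = (1 / 2) * (ψ (0, (x + 1, y + 1)) + ψ (0, (x - 1, y + 1))) +
      (Complex.I / 2) * (ψ (1, (x + 1, y + 1)) - ψ (1, (x - 1, y + 1))) := by
  have h := coe_inv_sqrt_two_mul_self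
  simp only [walkStep, LinearMap.comp_apply, shiftX, shiftY, coinOp, coinX, coinY,
    LinearMap.coe_mk, AddHom.coe_mk, Fin.sum_univ_two, Matrix.smul_apply, Matrix.of_apply,
    Matrix.cons_val', Matrix.cons_val_zero, Matrix.cons_val_one, Matrix.cons_val_fin_one,
    smul_eq_mul, Fin.isValue, Fin.val_zero, Fin.val_one, pow_zero, pow_one,
    ← sub_eq_add_neg]
  generalize ((1 / Real.sqrt 2 : ℝ) : ℂ) = c at *
  linear_combination (ψ (0, (x + 1, y + 1)) + ψ (0, (x - 1, y + 1)) +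
    Complex.I * ψ (1, (x + 1, y + 1)) - Complex.I * ψ (1, (x - 1, y + 1))) * h -
    c * c * ψ (0, (x - 1, y + 1)) * Complex.I_mul_I

theorem walkStep_apply_one (ψ : Walker n) (x y : ZMod n) :
    walkStep ψ (1, (x, y)) = (1 / 2) * (ψ (1, (x + 1, y - 1)) + ψ (1, (x - 1, y - 1))) -
      (Complex.I / 2) * (ψ (0, (x + 1, y - 1)) - ψ (0, (x - 1, y - 1))) := by
  have h := coe_inv_sqrt_two_mul_self
  simp only [walkStep, LinearMap.comp_apply, shiftX, shiftY, coinOp, coinX, coinY,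
    LinearMap.coe_mk, AddHom.coe_mk, Fin.sum_univ_two, Matrix.smul_apply, Matrix.of_apply,
    Matrix.cons_val', Matrix.cons_val_zero, Matrix.cons_val_one, Matrix.cons_val_fin_one,
    smul_eq_mul, Fin.isValue, Fin.val_zero, Fin.val_one, pow_zero, pow_one,
    ← sub_eq_add_neg]
  generalize ((1 / Real.sqrt 2 : ℝ) : ℂ) = c at *
  linear_combination (ψ (1, (x + 1, y - 1)) + ψ (1, (x - 1, y - 1)) -
    Complex.I * ψ (0, (x + 1, y - 1)) + Complex.I * ψ (0, (x - 1, y - 1))) * h -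
    c * c * ψ (1, (x + 1, y - 1)) * Complex.I_mul_I

/-- The inverse of `walkStep`. -/
noncomputable def walkBack : Module.End ℂ (Walker n) where
  toFun ψ := WithLp.toLp 2 fun p =>
    if p.1 = 0 then
      (1 / 2) * (ψ (0, (p.2.1 + 1, p.2.2 - 1)) + ψ (0, (p.2.1 - 1, p.2.2 - 1))) -
        (Complex.I / 2) * (ψ (1, (p.2.1 + 1, p.2.2 + 1)) - ψ (1, (p.2.1 - 1, p.2.2 + 1)))
    else
      (1 / 2) * (ψ (1, (p.2.1 + 1, p.2.2 + 1)) + ψ (1, (p.2.1 - 1, p.2.2 + 1))) +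
        (Complex.I / 2) * (ψ (0, (p.2.1 + 1, p.2.2 - 1)) - ψ (0, (p.2.1 - 1, p.2.2 - 1)))
  map_add' ψ φ := by
    ext p
    simp only [PiLp.add_apply]
    split_ifs <;> ring
  map_smul' c ψ := by
    ext p
    simp only [PiLp.smul_apply, smul_eq_mul, RingHom.id_apply]
    split_ifs <;> ring

theorem walkBack_apply_zero (ψ : Walker n) (x y : ZMod n) :
    walkBack ψ (0, (x, y)) = (1 / 2) * (ψ (0, (x + 1, y - 1)) + ψ (0, (x - 1, y - 1))) -
      (Complex.I / 2) * (ψ (1, (x + 1, y + 1)) - ψ (1, (x - 1, y + 1))) := by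
  simp [walkBack]

theorem walkBack_apply_one (ψ : Walker n) (x y : ZMod n) :
    walkBack ψ (1, (x, y)) = (1 / 2) * (ψ (1, (x + 1, y + 1)) + ψ (1, (x - 1, y + 1))) +
      (Complex.I / 2) * (ψ (0, (x + 1, y - 1)) - ψ (0, (x - 1, y - 1))) := by
  simp [walkBack]

theorem walkStep_walkBack (ψ : Walker n) : walkStep (walkBack ψ) = ψ := by
  apply walker_ext
  · rintro ⟨x, y⟩
    simp only [walkStep_apply_zero, walkBack_apply_zero, walkBack_apply_one, add_sub_cancel_right,
      sub_add_cancel]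
    linear_combination ((ψ (0, (x+1+1, y)) - 2 * ψ (0, (x, y)) +
      ψ (0, (x-1-1, y))) / 4) * Complex.I_mul_I
  · rintro ⟨x, y⟩
    simp only [walkStep_apply_one, walkBack_apply_zero, walkBack_apply_one, add_sub_cancel_right,
      sub_add_cancel]
    linear_combination ((ψ (1, (x+1+1, y)) - 2 * ψ (1, (x, y)) +
      ψ (1, (x-1-1, y))) / 4) * Complex.I_mul_I

theorem walkBack_walkStep (ψ : Walker n) : walkBack (walkStep ψ) = ψ := by
  apply walker_ext
  · rintro ⟨x, y⟩
    simp only [walkStep_apply_zero, walkStep_apply_one, walkBack_apply_zero, add_sub_cancel_right,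
      sub_add_cancel]
    linear_combination ((ψ (0, (x+1+1, y)) - 2 * ψ (0, (x, y)) +
      ψ (0, (x-1-1, y))) / 4) * Complex.I_mul_I
  · rintro ⟨x, y⟩
    simp only [walkStep_apply_zero, walkStep_apply_one, walkBack_apply_one, add_sub_cancel_right,
      sub_add_cancel]
    linear_combination ((ψ (1, (x+1+1, y)) - 2 * ψ (1, (x, y)) +
      ψ (1, (x-1-1, y))) / 4) * Complex.I_mul_I

/-- The sum of a function over the four diagonal neighbours of a vertex. -/
def diagSum {A : Type*} [Add A] (f : Vertex n → A) (q : Vertex n) : A :=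
  f (q.1 + 1, q.2 + 1) + f (q.1 - 1, q.2 + 1) + f (q.1 + 1, q.2 - 1) + f (q.1 - 1, q.2 - 1)

/-- The terms with `Complex.I`, which couple the two coin states, enter `U` and `U⁻¹` with opposite
signs. Their cancellation reduces the spectral analysis to a scalar operator on the torus that
characters diagonalise. -/
theorem walkStep_add_walkBack_apply (ψ : Walker n) (v : Fin 2) (q : Vertex n) :
    (walkStep ψ + walkBack ψ) (v, q) = (1 / 2) * diagSum (fun r => ψ (v, r)) q := by
  obtain ⟨x, y⟩ := q
  fin_cases v
  · simp only [PiLp.add_apply, Fin.zero_eta, walkStep_apply_zero, walkBack_apply_zero, diagSum]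
    ring
  · simp only [PiLp.add_apply, Fin.mk_one, walkStep_apply_one, walkBack_apply_one, diagSum]
    ring

theorem diagKet_apply (m : Vertex n) (v : Fin 2) (q : Vertex n) :
    diagKet m (v, q) = if q = m then ((1 / Real.sqrt 2 : ℝ) : ℂ) else 0 := by
  fin_cases v <;> by_cases h : q = m <;> simp [diagKet, ket, h]

variable [NeZero n]

theorem inner_walker (φ ψ : Walker n) :
    inner ℂ φ ψ = ∑ q : Vertex n, (ψ (0, q) * star (φ (0, q)) + ψ (1, q) * star (φ (1, q))) := by
  rw [PiLp.inner_apply, Fintype.sum_prod_type, Fin.sum_univ_two, ← Finset.sum_add_distrib]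
  rfl

theorem inner_shiftX (φ ψ : Walker n) : inner ℂ (shiftX φ) (shiftX ψ) = inner ℂ φ ψ := by
  simp only [PiLp.inner_apply, Fintype.sum_prod_type (α₁ := Fin 2)]
  refine Finset.sum_congr rfl fun v _ => ?_
  exact Equiv.sum_comp ((Equiv.addRight ((-1 : ZMod n) ^ (v : ℕ))).prodCongr (Equiv.refl (ZMod n)))
    fun q => inner ℂ (φ (v, q)) (ψ (v, q))

theorem inner_shiftY (φ ψ : Walker n) : inner ℂ (shiftY φ) (shiftY ψ) = inner ℂ φ ψ := by
  simp only [PiLp.inner_apply, Fintype.sum_prod_type (α₁ := Fin 2)]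
  refine Finset.sum_congr rfl fun v _ => ?_
  exact Equiv.sum_comp ((Equiv.refl (ZMod n)).prodCongr (Equiv.addRight ((-1 : ZMod n) ^ (v : ℕ))))
    fun q => inner ℂ (φ (v, q)) (ψ (v, q))

theorem inner_coinX (φ ψ : Walker n) :
    inner ℂ (coinOp coinX φ) (coinOp coinX ψ) = inner ℂ φ ψ := by
  have h := coe_inv_sqrt_two_mul_self
  rw [inner_walker, inner_walker]
  refine Finset.sum_congr rfl fun q _ => ?_
  simp only [coinOp, coinX, LinearMap.coe_mk, AddHom.coe_mk, Fin.sum_univ_two, Matrix.smul_apply,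
    Matrix.of_apply, Matrix.cons_val', Matrix.cons_val_zero, Matrix.cons_val_one,
    Matrix.cons_val_fin_one, smul_eq_mul, star_add, star_mul, Complex.star_def, Complex.conj_I,
    Complex.conj_ofReal, map_one]
  generalize ((1 / Real.sqrt 2 : ℝ) : ℂ) = c at *
  linear_combination 2 * (ψ (0, q) * (starRingEnd ℂ) (φ (0, q)) +
    ψ (1, q) * (starRingEnd ℂ) (φ (1, q))) * h - c * c * (ψ (0, q) * (starRingEnd ℂ) (φ (0, q)) +
    ψ (1, q) * (starRingEnd ℂ) (φ (1, q))) * Complex.I_mul_I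

theorem inner_coinY (φ ψ : Walker n) :
    inner ℂ (coinOp coinY φ) (coinOp coinY ψ) = inner ℂ φ ψ := by
  have h := coe_inv_sqrt_two_mul_self
  rw [inner_walker, inner_walker]
  refine Finset.sum_congr rfl fun q _ => ?_
  simp only [coinOp, coinY, LinearMap.coe_mk, AddHom.coe_mk, Fin.sum_univ_two, Matrix.smul_apply,
    Matrix.of_apply, Matrix.cons_val', Matrix.cons_val_zero, Matrix.cons_val_one,
    Matrix.cons_val_fin_one, smul_eq_mul, star_add, star_mul, Complex.star_def, Complex.conj_I,
    Complex.conj_ofReal, map_one, map_neg, neg_neg]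
  generalize ((1 / Real.sqrt 2 : ℝ) : ℂ) = c at *
  linear_combination 2 * (ψ (0, q) * (starRingEnd ℂ) (φ (0, q)) +
    ψ (1, q) * (starRingEnd ℂ) (φ (1, q))) * h - c * c * (ψ (0, q) * (starRingEnd ℂ) (φ (0, q)) +
    ψ (1, q) * (starRingEnd ℂ) (φ (1, q))) * Complex.I_mul_I

theorem inner_walkStep_walkStep (φ ψ : Walker n) :
    inner ℂ (walkStep φ) (walkStep ψ) = inner ℂ φ ψ := by
  simp only [walkStep, LinearMap.comp_apply, inner_shiftX, inner_shiftY, inner_coinX, inner_coinY]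

theorem inner_walkStep_left (φ ψ : Walker n) :
    inner ℂ (walkStep φ) ψ = inner ℂ φ (walkBack ψ) := by
  rw [← inner_walkStep_walkStep φ (walkBack ψ), walkStep_walkBack]

theorem inner_diagKet (m : Vertex n) (ψ : Walker n) :
    inner ℂ (diagKet m) ψ = ((1 / Real.sqrt 2 : ℝ) : ℂ) * (ψ (0, m) + ψ (1, m)) := by
  rw [inner_walker, Finset.sum_eq_single m]
  · simp only [diagKet_apply, if_true, Complex.star_def, Complex.conj_ofReal]
    ring
  · intro q _ h
    simp [diagKet_apply, h]
  · simp

theorem inner_diagKet_self (m : Vertex n) : inner ℂ (diagKet m) (diagKet m) = 1 := by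
  rw [inner_diagKet, diagKet_apply, diagKet_apply, if_pos rfl, mul_add, coe_inv_sqrt_two_mul_self]
  norm_num

theorem oracle_singleton_apply (m : Vertex n) (ψ : Walker n) :
    oracle {m} ψ = ψ - (2 * inner ℂ (diagKet m) ψ) • diagKet m := by
  rw [oracle_apply, Finset.sum_singleton, smul_smul]

theorem searchStep_singleton_apply (m : Vertex n) (ψ : Walker n) :
    searchStep {m} ψ = walkStep ψ - (2 * inner ℂ (diagKet m) ψ) • walkStep (diagKet m) := by
  simp [searchStep, oracle_singleton_apply]

theorem oracle_oracle (m : Vertex n) (ψ : Walker n) : oracle {m} (oracle {m} ψ) = ψ := by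
  rw [oracle_singleton_apply, oracle_singleton_apply, inner_sub_right, inner_smul_right,
    inner_diagKet_self]
  module

theorem inner_oracle_left (m : Vertex n) (φ ψ : Walker n) :
    inner ℂ (oracle {m} φ) ψ = inner ℂ φ (oracle {m} ψ) := by
  simp only [oracle_singleton_apply, inner_sub_left, inner_sub_right, inner_smul_left,
    inner_smul_right, map_mul, inner_conj_symm, map_ofNat]
  ring

/-- The inverse of the search operator for one marked vertex. -/
noncomputable def searchBack (m : Vertex n) : Module.End ℂ (Walker n) := oracle {m} * walkBack

theorem searchStep_searchBack (m : Vertex n) (ψ : Walker n) :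
    searchStep {m} (searchBack m ψ) = ψ := by
  simp [searchStep, searchBack, oracle_oracle, walkStep_walkBack]

theorem searchBack_searchStep (m : Vertex n) (ψ : Walker n) :
    searchBack m (searchStep {m} ψ) = ψ := by
  simp [searchStep, searchBack, oracle_oracle, walkBack_walkStep]

theorem inner_searchStep_left (m : Vertex n) (φ ψ : Walker n) :
    inner ℂ (searchStep {m} φ) ψ = inner ℂ φ (searchBack m ψ) := by
  simp [searchStep, searchBack, inner_walkStep_left, inner_oracle_left]

end WalkBasics
-- Parity sublattices, decoupling and translation invariance.
section Decoupling

variable {n : ℕ} [NeZero n]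

omit [NeZero n] in
-- Reduction modulo n keeps parity because 2 divides n, so any natural representative may be used.
theorem even_val_iff {x : ZMod n} {a : ℕ} (hn : Even n) (h : (a : ZMod n) = x) :
    Even x.val ↔ Even a := by
  rw [← h, ZMod.val_natCast, Nat.even_iff, Nat.even_iff, Nat.mod_mod_of_dvd _ hn.two_dvd]

theorem even_val_add_one (hn : Even n) (x : ZMod n) : Even (x + 1).val ↔ ¬ Even x.val := by
  rw [even_val_iff (a := x.val + 1) hn (by simp), Nat.even_add_one]

theorem even_val_sub_one (hn : Even n) (x : ZMod n) : Even (x - 1).val ↔ ¬ Even x.val := by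
  have := even_val_add_one hn (x - 1)
  rw [sub_add_cancel] at this
  tauto

theorem evenVertex_add_add (hn : Even n) (x y : ZMod n) :
    EvenVertex (x + 1, y + 1) ↔ EvenVertex (x, y) := by
  simp only [EvenVertex, Nat.even_add, even_val_add_one hn]
  tauto

theorem evenVertex_sub_add (hn : Even n) (x y : ZMod n) :
    EvenVertex (x - 1, y + 1) ↔ EvenVertex (x, y) := by
  simp only [EvenVertex, Nat.even_add, even_val_add_one hn, even_val_sub_one hn]
  tauto

theorem evenVertex_add_sub (hn : Even n) (x y : ZMod n) :
    EvenVertex (x + 1, y - 1) ↔ EvenVertex (x, y) := by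
  simp only [EvenVertex, Nat.even_add, even_val_add_one hn, even_val_sub_one hn]
  tauto

theorem evenVertex_sub_sub (hn : Even n) (x y : ZMod n) :
    EvenVertex (x - 1, y - 1) ↔ EvenVertex (x, y) := by
  simp only [EvenVertex, Nat.even_add, even_val_sub_one hn]
  tauto

/-- Multiplication of a state by the indicator function of a set of vertices. -/
noncomputable def restrictTo (S : Set (Vertex n)) : Module.End ℂ (Walker n) where
  toFun ψ := WithLp.toLp 2 fun p => S.indicator (fun q => ψ (p.1, q)) p.2
  map_add' ψ φ := by
    classical
    ext p
    by_cases h : p.2 ∈ S <;> simp [h]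
  map_smul' c ψ := by
    classical
    ext p
    by_cases h : p.2 ∈ S <;> simp [h]

omit [NeZero n] in
theorem restrictTo_apply_of_mem {S : Set (Vertex n)} (ψ : Walker n) (v : Fin 2) {q : Vertex n}
    (h : q ∈ S) : restrictTo S ψ (v, q) = ψ (v, q) := by
  simp [restrictTo, h]

omit [NeZero n] in
theorem restrictTo_apply_of_notMem {S : Set (Vertex n)} (ψ : Walker n) (v : Fin 2) {q : Vertex n}
    (h : q ∉ S) : restrictTo S ψ (v, q) = 0 := by
  simp [restrictTo, h]

/-- A set of vertices closed under the four diagonal steps. -/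
structure DiagClosed (S : Set (Vertex n)) : Prop where
  add_add : ∀ x y, (x + 1, y + 1) ∈ S ↔ (x, y) ∈ S
  sub_add : ∀ x y, (x - 1, y + 1) ∈ S ↔ (x, y) ∈ S
  add_sub : ∀ x y, (x + 1, y - 1) ∈ S ↔ (x, y) ∈ S
  sub_sub : ∀ x y, (x - 1, y - 1) ∈ S ↔ (x, y) ∈ S

theorem diagClosed_even (hn : Even n) : DiagClosed {q : Vertex n | EvenVertex q} :=
  ⟨evenVertex_add_add hn, evenVertex_sub_add hn, evenVertex_add_sub hn, evenVertex_sub_sub hn⟩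

omit [NeZero n] in
theorem DiagClosed.compl {S : Set (Vertex n)} (h : DiagClosed S) : DiagClosed Sᶜ :=
  ⟨fun x y => not_congr (h.add_add x y), fun x y => not_congr (h.sub_add x y),
    fun x y => not_congr (h.add_sub x y), fun x y => not_congr (h.sub_sub x y)⟩

omit [NeZero n] in
theorem restrictTo_walkStep {S : Set (Vertex n)} (hS : DiagClosed S) (ψ : Walker n) :
    restrictTo S (walkStep ψ) = walkStep (restrictTo S ψ) := by
  apply walker_ext
  · rintro ⟨x, y⟩
    by_cases h : (x, y) ∈ S
    · rw [restrictTo_apply_of_mem _ _ h, walkStep_apply_zero, walkStep_apply_zero,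
        restrictTo_apply_of_mem _ _ ((hS.add_add x y).2 h),
        restrictTo_apply_of_mem _ _ ((hS.add_add x y).2 h),
        restrictTo_apply_of_mem _ _ ((hS.sub_add x y).2 h),
        restrictTo_apply_of_mem _ _ ((hS.sub_add x y).2 h)]
    · rw [restrictTo_apply_of_notMem _ _ h, walkStep_apply_zero,
        restrictTo_apply_of_notMem _ _ (mt (hS.add_add x y).1 h),
        restrictTo_apply_of_notMem _ _ (mt (hS.add_add x y).1 h),
        restrictTo_apply_of_notMem _ _ (mt (hS.sub_add x y).1 h),
        restrictTo_apply_of_notMem _ _ (mt (hS.sub_add x y).1 h)]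
      simp
  · rintro ⟨x, y⟩
    by_cases h : (x, y) ∈ S
    · rw [restrictTo_apply_of_mem _ _ h, walkStep_apply_one, walkStep_apply_one,
        restrictTo_apply_of_mem _ _ ((hS.add_sub x y).2 h),
        restrictTo_apply_of_mem _ _ ((hS.add_sub x y).2 h),
        restrictTo_apply_of_mem _ _ ((hS.sub_sub x y).2 h),
        restrictTo_apply_of_mem _ _ ((hS.sub_sub x y).2 h)]
    · rw [restrictTo_apply_of_notMem _ _ h, walkStep_apply_one,
        restrictTo_apply_of_notMem _ _ (mt (hS.add_sub x y).1 h),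
        restrictTo_apply_of_notMem _ _ (mt (hS.add_sub x y).1 h),
        restrictTo_apply_of_notMem _ _ (mt (hS.sub_sub x y).1 h),
        restrictTo_apply_of_notMem _ _ (mt (hS.sub_sub x y).1 h)]
      simp

omit [NeZero n] in
theorem restrictTo_diagKet_of_mem {S : Set (Vertex n)} {m : Vertex n} (hm : m ∈ S) :
    restrictTo S (diagKet m) = diagKet m := by
  ext ⟨v, q⟩
  by_cases h : q ∈ S
  · rw [restrictTo_apply_of_mem _ _ h]
  · rw [restrictTo_apply_of_notMem _ _ h, diagKet_apply, if_neg]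
    rintro rfl
    exact h hm

omit [NeZero n] in
theorem restrictTo_diagKet_of_notMem {S : Set (Vertex n)} {m : Vertex n} (hm : m ∉ S) :
    restrictTo S (diagKet m) = 0 := by
  ext ⟨v, q⟩
  by_cases h : q ∈ S
  · rw [restrictTo_apply_of_mem _ _ h, diagKet_apply, if_neg]
    · rfl
    · rintro rfl
      exact hm h
  · rw [restrictTo_apply_of_notMem _ _ h]
    rfl

theorem inner_diagKet_restrictTo {S : Set (Vertex n)} {m : Vertex n} (hm : m ∈ S) (ψ : Walker n) :
    inner ℂ (diagKet m) (restrictTo S ψ) = inner ℂ (diagKet m) ψ := by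
  rw [inner_diagKet, inner_diagKet, restrictTo_apply_of_mem _ _ hm, restrictTo_apply_of_mem _ _ hm]

theorem inner_diagKet_restrictTo_of_notMem {S : Set (Vertex n)} {m : Vertex n} (hm : m ∉ S)
    (ψ : Walker n) : inner ℂ (diagKet m) (restrictTo S ψ) = 0 := by
  rw [inner_diagKet, restrictTo_apply_of_notMem _ _ hm, restrictTo_apply_of_notMem _ _ hm]
  simp

theorem searchStep_pair_apply {m₀ m₁ : Vertex n} (h : m₀ ≠ m₁) (ψ : Walker n) :
    searchStep {m₀, m₁} ψ = walkStep ψ - (2 * inner ℂ (diagKet m₀) ψ) • walkStep (diagKet m₀)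
      - (2 * inner ℂ (diagKet m₁) ψ) • walkStep (diagKet m₁) := by
  simp only [searchStep, Module.End.mul_apply, oracle_apply, Finset.sum_pair h, map_sub, map_smul,
    map_add]
  module

theorem searchStep_pair_restrictTo {S : Set (Vertex n)} {m₀ m₁ : Vertex n}
    (h₀ : m₀ ∈ S) (h₁ : m₁ ∉ S) (ψ : Walker n) :
    searchStep {m₀, m₁} (restrictTo S ψ) = searchStep {m₀} (restrictTo S ψ) := by
  have h : m₀ ≠ m₁ := by
    rintro rfl
    exact h₁ h₀
  rw [searchStep_pair_apply h, searchStep_singleton_apply,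
    inner_diagKet_restrictTo_of_notMem h₁]
  simp

theorem restrictTo_searchStep_pair {S : Set (Vertex n)} (hS : DiagClosed S) {m₀ m₁ : Vertex n}
    (h₀ : m₀ ∈ S) (h₁ : m₁ ∉ S) (ψ : Walker n) :
    restrictTo S (searchStep {m₀, m₁} ψ) = searchStep {m₀} (restrictTo S ψ) := by
  have h : m₀ ≠ m₁ := by
    rintro rfl
    exact h₁ h₀
  rw [searchStep_pair_apply h, searchStep_singleton_apply, map_sub, map_sub, map_smul, map_smul,
    restrictTo_walkStep hS, restrictTo_walkStep hS, restrictTo_walkStep hS,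
    restrictTo_diagKet_of_mem h₀, restrictTo_diagKet_of_notMem h₁, inner_diagKet_restrictTo h₀]
  simp

theorem restrictTo_searchStep_singleton {S : Set (Vertex n)} (hS : DiagClosed S) {m : Vertex n}
    (h : m ∈ S) (ψ : Walker n) :
    restrictTo S (searchStep {m} ψ) = searchStep {m} (restrictTo S ψ) := by
  rw [searchStep_singleton_apply, searchStep_singleton_apply, map_sub, map_smul,
    restrictTo_walkStep hS, restrictTo_walkStep hS, restrictTo_diagKet_of_mem h,
    inner_diagKet_restrictTo h]

omit [NeZero n] in
theorem restrictTo_compl_add (S : Set (Vertex n)) (ψ : Walker n) :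
    restrictTo S ψ + restrictTo Sᶜ ψ = ψ := by
  ext ⟨v, q⟩
  by_cases h : q ∈ S
  · rw [PiLp.add_apply, restrictTo_apply_of_mem _ _ h,
      restrictTo_apply_of_notMem _ _ (Set.notMem_compl_iff.2 h), add_zero]
  · rw [PiLp.add_apply, restrictTo_apply_of_notMem _ _ h, restrictTo_apply_of_mem _ _ h, zero_add]

/-- The two states need not agree, but their restrictions to S do at every time: both evolve from
the restriction of ψ(0) under the single-target walk. D lives in S, so this suffices. -/
theorem inner_stateAt_pair {S : Set (Vertex n)} (hS : DiagClosed S) {m₀ m₁ : Vertex n}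
    (h₀ : m₀ ∈ S) (h₁ : m₁ ∉ S) (t : ℕ) :
    inner ℂ (diagKet m₀) (stateAt {m₀, m₁} t) = inner ℂ (diagKet m₀) (stateAt {m₀} t) := by
  rw [← inner_diagKet_restrictTo h₀, ← inner_diagKet_restrictTo h₀ (stateAt {m₀} t)]
  congr 1
  induction t with
  | zero => rfl
  | succ t ih =>
    have e (M : Finset (Vertex n)) : stateAt M (t + 1) = searchStep M (stateAt M t) := by
      rw [stateAt, pow_succ', Module.End.mul_apply, stateAt]
    rw [e, e, restrictTo_searchStep_pair hS h₀ h₁, restrictTo_searchStep_singleton hS h₀, ih]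

/-- The submodule of states supported on a set of vertices is the range of the restriction. -/
theorem mem_span_ket_iff (S : Set (Vertex n)) (ψ : Walker n) :
    ψ ∈ Submodule.span ℂ {ψ | ∃ (v : Fin 2) (m : Vertex n), m ∈ S ∧ ψ = ket v m} ↔
      restrictTo S ψ = ψ := by
  constructor
  · intro h
    induction h using Submodule.span_induction with
    | mem φ h =>
      obtain ⟨v, m, hm, rfl⟩ := h
      ext ⟨w, q⟩
      by_cases h : q ∈ S
      · rw [restrictTo_apply_of_mem _ _ h]
      · rw [restrictTo_apply_of_notMem _ _ h]
        have : q ≠ m := by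
          rintro rfl
          exact h hm
        simp [ket, this]
    | zero => simp
    | add φ χ _ _ h₁ h₂ => rw [map_add, h₁, h₂]
    | smul c φ _ h => rw [map_smul, h]
  · intro h
    have e : ψ = ∑ p : Fin 2 × Vertex n, ψ p • ket p.1 p.2 := by
      ext p
      simp [ket, Pi.single_apply]
    rw [e]
    refine Submodule.sum_mem _ fun p _ => ?_
    by_cases hp : p.2 ∈ S
    · exact Submodule.smul_mem _ _ (Submodule.subset_span ⟨p.1, p.2, hp, rfl⟩)
    · have : ψ p = 0 := by
        rw [← h]
        exact restrictTo_apply_of_notMem ψ p.1 hp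
      rw [this, zero_smul]
      exact Submodule.zero_mem _

theorem mem_evenSpace_iff (ψ : Walker n) :
    ψ ∈ evenSpace n ↔ restrictTo {q | EvenVertex q} ψ = ψ :=
  mem_span_ket_iff {q | EvenVertex q} ψ

theorem mem_oddSpace_iff (ψ : Walker n) :
    ψ ∈ oddSpace n ↔ restrictTo {q | EvenVertex q}ᶜ ψ = ψ :=
  mem_span_ket_iff {q | EvenVertex q}ᶜ ψ

theorem inner_ket (v : Fin 2) (m : Vertex n) (ψ : Walker n) : inner ℂ (ket v m) ψ = ψ (v, m) := by
  simp [ket, EuclideanSpace.inner_single_left]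

theorem evenSpace_orthogonal : (evenSpace n)ᗮ = oddSpace n := by
  ext ψ
  rw [mem_oddSpace_iff]
  constructor
  · intro h
    ext ⟨v, q⟩
    by_cases hq : q ∈ {q : Vertex n | EvenVertex q}
    · rw [restrictTo_apply_of_notMem _ _ (Set.notMem_compl_iff.2 hq), ← inner_ket]
      exact ((Submodule.mem_orthogonal _ _).1 h _ (Submodule.subset_span ⟨v, q, hq, rfl⟩)).symm
    · rw [restrictTo_apply_of_mem _ _ hq]
  · intro h
    rw [Submodule.mem_orthogonal]
    intro φ hφ
    rw [mem_evenSpace_iff] at hφ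
    rw [PiLp.inner_apply]
    refine Finset.sum_eq_zero fun p _ => ?_
    by_cases hq : p.2 ∈ {q : Vertex n | EvenVertex q}
    · have : ψ p = 0 := by
        rw [← h]
        exact restrictTo_apply_of_notMem ψ p.1 (Set.notMem_compl_iff.2 hq)
      simp [this]
    · have : φ p = 0 := by
        rw [← hφ]
        exact restrictTo_apply_of_notMem φ p.1 hq
      simp [this]

/-- Translation of a state. -/
def translate (s : Vertex n) (ψ : Walker n) : Walker n :=
  WithLp.toLp 2 fun p => ψ (p.1, p.2 + s)

omit [NeZero n] in
theorem translate_apply (s : Vertex n) (ψ : Walker n) (v : Fin 2) (q : Vertex n) :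
    translate s ψ (v, q) = ψ (v, q + s) := rfl

omit [NeZero n] in
theorem translate_walkStep (s : Vertex n) (ψ : Walker n) :
    translate s (walkStep ψ) = walkStep (translate s ψ) := by
  obtain ⟨a, b⟩ := s
  have e₁ (x : ZMod n) : x + 1 + a = x + a + 1 := by ring
  have e₂ (x : ZMod n) : x - 1 + a = x + a - 1 := by ring
  have e₃ (x : ZMod n) : x + 1 + b = x + b + 1 := by ring
  have e₄ (x : ZMod n) : x - 1 + b = x + b - 1 := by ring
  apply walker_ext
  · rintro ⟨x, y⟩
    simp only [translate_apply, walkStep_apply_zero, Prod.mk_add_mk, e₁, e₂, e₃]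
  · rintro ⟨x, y⟩
    simp only [translate_apply, walkStep_apply_one, Prod.mk_add_mk, e₁, e₂, e₄]

/-- Translation by m - m' commutes with `U`, fixes ψ(0) and carries one marked state to the other.
It may exchange the sublattices, which is what makes the two halves of the search comparable. -/
theorem inner_stateAt_singleton_eq (m m' : Vertex n) (t : ℕ) :
    inner ℂ (diagKet m) (stateAt {m} t) = inner ℂ (diagKet m') (stateAt {m'} t) := by
  have hD : translate (m - m') (diagKet m) = diagKet m' := by
    ext ⟨v, q⟩
    rw [translate_apply, diagKet_apply, diagKet_apply]
    have : q + (m - m') = m ↔ q = m' := by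
      rw [← sub_eq_zero, ← sub_eq_zero (b := m'), show q + (m - m') - m = q - m' by abel]
    simp only [this]
  have hi (ψ : Walker n) :
      inner ℂ (diagKet m') (translate (m - m') ψ) = inner ℂ (diagKet m) ψ := by
    rw [inner_diagKet, inner_diagKet, translate_apply, translate_apply]
    simp
  have hadd (φ ψ : Walker n) (c : ℂ) : translate (m - m') (φ - c • ψ) =
      translate (m - m') φ - c • translate (m - m') ψ := by
    ext ⟨v, q⟩
    simp only [PiLp.sub_apply, PiLp.smul_apply, translate_apply]
  have key : translate (m - m') (stateAt {m} t) = stateAt {m'} t := by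
    induction t with
    | zero =>
      ext ⟨v, q⟩
      simp only [stateAt, pow_zero, Module.End.one_apply, translate_apply, initState]
    | succ t ih =>
      have e (M : Finset (Vertex n)) : stateAt M (t + 1) = searchStep M (stateAt M t) := by
        rw [stateAt, pow_succ', Module.End.mul_apply, stateAt]
      rw [e, e, searchStep_singleton_apply, searchStep_singleton_apply, hadd, translate_walkStep,
        translate_walkStep, hD, ← ih, hi]
  rw [← hi, key]

theorem successProb_singleton (m : Vertex n) (t : ℕ) :
    successProb {m} t = ‖inner ℂ (diagKet m) (stateAt {m} t)‖ ^ 2 := by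
  rw [successProb, Finset.sum_singleton]

theorem successProb_singleton_eq (m m' : Vertex n) (t : ℕ) :
    successProb {m} t = successProb {m'} t := by
  rw [successProb_singleton, successProb_singleton, inner_stateAt_singleton_eq m m']

theorem decoupling (hn : Even n) (m₀ m₁ : Vertex n) (h₀ : EvenVertex m₀) (h₁ : ¬ EvenVertex m₁) :
    (evenSpace n)ᗮ = oddSpace n ∧
      (∀ ψ ∈ evenSpace n,
        searchStep {m₀, m₁} ψ ∈ evenSpace n ∧
        searchStep {m₀, m₁} ψ = searchStep {m₀} ψ) ∧
      (∀ ψ ∈ oddSpace n,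
        searchStep {m₀, m₁} ψ ∈ oddSpace n ∧
        searchStep {m₀, m₁} ψ = searchStep {m₁} ψ) ∧
      (∀ t : ℕ,
        inner ℂ (diagKet m₀) (stateAt {m₀, m₁} t) = inner ℂ (diagKet m₀) (stateAt {m₀} t) ∧
        inner ℂ (diagKet m₁) (stateAt {m₀, m₁} t) = inner ℂ (diagKet m₁) (stateAt {m₁} t) ∧
        successProb {m₀, m₁} t = successProb {m₀} t + successProb {m₁} t ∧
        successProb {m₀} t = successProb {m₁} t) := by
  have hS := diagClosed_even hn
  have hc : m₁ ∉ {q : Vertex n | EvenVertex q} := h₁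
  have hc' : m₀ ∉ {q : Vertex n | EvenVertex q}ᶜ := fun h => h h₀
  have hne : m₀ ≠ m₁ := by
    rintro rfl
    exact h₁ h₀
  refine ⟨evenSpace_orthogonal, fun ψ hψ => ?_, fun ψ hψ => ?_, fun t => ?_⟩
  · rw [mem_evenSpace_iff] at hψ ⊢
    have e := searchStep_pair_restrictTo (S := {q | EvenVertex q}) h₀ hc ψ
    rw [hψ] at e
    refine ⟨?_, e⟩
    rw [restrictTo_searchStep_pair hS h₀ hc, hψ, e]
  · rw [mem_oddSpace_iff] at hψ ⊢
    have e := searchStep_pair_restrictTo (S := {q | EvenVertex q}ᶜ) h₁ hc' ψ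
    rw [hψ, Finset.pair_comm] at e
    refine ⟨?_, e⟩
    rw [Finset.pair_comm, restrictTo_searchStep_pair hS.compl h₁ hc', hψ, Finset.pair_comm, e]
  · have e₀ := inner_stateAt_pair hS h₀ hc t
    have e₁ := inner_stateAt_pair hS.compl h₁ hc' t
    rw [Finset.pair_comm] at e₁
    refine ⟨e₀, e₁, ?_, successProb_singleton_eq _ _ _⟩
    rw [successProb, Finset.sum_pair hne, e₀, e₁, successProb_singleton, successProb_singleton]

/-- An eigenvector for the pair has a nonzero restriction to at least one sublattice, and that
restriction is an eigenvector of a single-target walk. Conversely, a single-target eigenvector could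
vanish when restricted; the nonzero overlap demanded by `hsuf` rules this out. -/
theorem hasEigenvalue_pair_iff (hn : Even n) {m₀ m₁ : Vertex n} (h₀ : EvenVertex m₀)
    (h₁ : ¬ EvenVertex m₁) {z : ℂ} (P : Prop)
    (hnec : ∀ m : Vertex n, Module.End.HasEigenvalue (searchStep {m}) z → P)
    (hsuf : P → ∀ m : Vertex n, ∃ φ, searchStep {m} φ = z • φ ∧ inner ℂ (diagKet m) φ ≠ 0) :
    Module.End.HasEigenvalue (searchStep {m₀, m₁}) z ↔ P := by
  have hS := diagClosed_even hn
  have hc : m₁ ∉ {q : Vertex n | EvenVertex q} := h₁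
  have hc' : m₀ ∉ {q : Vertex n | EvenVertex q}ᶜ := fun h => h h₀
  constructor
  · intro h
    obtain ⟨φ, hφ⟩ := h.exists_hasEigenvector
    have e := hφ.apply_eq_smul
    by_cases hz : restrictTo {q : Vertex n | EvenVertex q} φ = 0
    · apply hnec m₁
      refine Module.End.hasEigenvalue_of_hasEigenvector
        (x := restrictTo {q : Vertex n | EvenVertex q}ᶜ φ) ⟨?_, ?_⟩
      · rw [Module.End.mem_eigenspace_iff, ← restrictTo_searchStep_pair hS.compl h₁ hc',
          Finset.pair_comm, e, map_smul]
      · intro hz'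
        apply hφ.2
        rw [← restrictTo_compl_add {q : Vertex n | EvenVertex q} φ, hz, hz', add_zero]
    · apply hnec m₀
      refine Module.End.hasEigenvalue_of_hasEigenvector
        (x := restrictTo {q : Vertex n | EvenVertex q} φ) ⟨?_, hz⟩
      rw [Module.End.mem_eigenspace_iff, ← restrictTo_searchStep_pair hS h₀ hc, e, map_smul]
  · intro h
    obtain ⟨φ, e, hφ⟩ := hsuf h m₀
    refine Module.End.hasEigenvalue_of_hasEigenvector
        (x := restrictTo {q : Vertex n | EvenVertex q} φ) ⟨?_, ?_⟩
    · rw [Module.End.mem_eigenspace_iff, searchStep_pair_restrictTo h₀ hc,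
        ← restrictTo_searchStep_singleton hS h₀, e, map_smul]
    · intro hz
      apply hφ
      rw [← inner_diagKet_restrictTo (S := {q : Vertex n | EvenVertex q}) h₀, hz, inner_zero_right]

end Decoupling
-- Spectral measure of a unitary in terms of the cosines of its phases.
section UnitarySpectrum

variable {E : Type*} [NormedAddCommGroup E] [InnerProductSpace ℂ E] [FiniteDimensional ℂ E]

/-- The spectral measure of a unitary operator `V`, with inverse `W`, at a unit vector `D`, in
terms of the cosines `τ` of the eigenphases: its moments and its Herglotz transform. -/
theorem exists_spectral_measure {V W : Module.End ℂ E} (hVW : ∀ x, V (W x) = x)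
    (hWV : ∀ x, W (V x) = x) (hadj : ∀ x y, inner ℂ (V x) y = inner ℂ x (W y)) {D : E}
    (hD : inner ℂ D D = 1) :
    ∃ (k : ℕ) (κ τ : Fin k → ℝ), (∀ i, 0 ≤ κ i) ∧ ∑ i, κ i = 1 ∧ (∀ i, -1 ≤ τ i ∧ τ i ≤ 1) ∧
      (∀ s : ℕ, (inner ℂ D ((V ^ s) D)).re = ∑ i, κ i * Real.cos (s * Real.arccos (τ i))) ∧
      (∀ z : ℝ, 1 < z → ∀ x, (z : ℂ) • x - V x = (z : ℂ) • D →
        ∑ i, κ i / ((z + 1 / z) / 2 - τ i) =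
          2 * z * (2 * (inner ℂ D x).re - 1) / (z ^ 2 - 1)) := by
  have hadj' (x y : E) : inner ℂ (W x) y = inner ℂ x (V y) := by
    rw [← inner_conj_symm, ← hadj, inner_conj_symm]
  have hnV (x : E) : ‖V x‖ = ‖x‖ := by
    have : inner ℂ (V x) (V x) = inner ℂ x x := by rw [hadj, hWV]
    rw [inner_self_eq_norm_sq_to_K, inner_self_eq_norm_sq_to_K] at this
    have h2 : ‖V x‖ ^ 2 = ‖x‖ ^ 2 := by exact_mod_cast this
    exact (sq_eq_sq₀ (norm_nonneg _) (norm_nonneg _)).1 h2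
  have hnW (x : E) : ‖W x‖ = ‖x‖ := by rw [← hnV (W x), hVW]
  have hD1 : ‖D‖ ^ 2 = 1 := by
    have := inner_self_eq_norm_sq (𝕜 := ℂ) D
    rw [hD] at this
    simpa using this.symm
  -- Averaging with the inverse gives a symmetric operator with an orthonormal eigenbasis; its
  -- eigenvalues are the cosines of the phases. Phases ±θ are merged, which is harmless for real
  -- parts of moments.
  set T : Module.End ℂ E := (1 / 2 : ℂ) • (V + W) with hTdef
  have hTa (x : E) : V x + W x = (2 : ℂ) • T x := by
    simp [hTdef, smul_smul]
  have hT : T.IsSymmetric := by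
    intro x y
    simp only [hTdef, LinearMap.smul_apply, LinearMap.add_apply, inner_smul_left, inner_smul_right,
      inner_add_left, inner_add_right, hadj, hadj', map_div₀, map_one, map_ofNat]
    ring
  set b := hT.eigenvectorBasis rfl with hb
  set τ := hT.eigenvalues rfl with hτ
  have hTb (i) : T (b i) = (τ i : ℂ) • b i := hT.apply_eigenvectorBasis rfl i
  have hnb (i) : ‖b i‖ = 1 := b.orthonormal.1 i
  have hτ1 (i) : -1 ≤ τ i ∧ τ i ≤ 1 := by
    rw [← abs_le]
    have h1 : ‖(2 : ℂ) • T (b i)‖ ≤ 2 := by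
      rw [← hTa]
      refine (norm_add_le _ _).trans ?_
      rw [hnV, hnW, hnb]
      norm_num
    rw [hTb, norm_smul, norm_smul, hnb] at h1
    simp at h1
    exact h1
  -- `V ^ s + W ^ s` obeys the Chebyshev recurrence of 2 cos(sθ), θ = arccos τ.
  have hcos (s : ℕ) (i) : (V ^ s) (b i) + (W ^ s) (b i) =
      ((2 * Real.cos (s * Real.arccos (τ i)) : ℝ) : ℂ) • b i := by
    have hp (A : Module.End ℂ E) (s : ℕ) (x : E) : (A ^ (s + 1)) x = A ((A ^ s) x) := by
      rw [pow_succ', Module.End.mul_apply]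
    have hp' (A : Module.End ℂ E) (s : ℕ) (x : E) : (A ^ (s + 1)) x = (A ^ s) (A x) := by
      rw [pow_succ, Module.End.mul_apply]
    induction s using Nat.twoStepInduction with
    | zero => simp [two_smul]
    | one =>
      simp only [pow_one, hTa, hTb, Nat.cast_one, one_mul]
      rw [Real.cos_arccos (hτ1 i).1 (hτ1 i).2, smul_smul]
      push_cast
      rfl
    | more s h1 h2 =>
      have e : (V ^ (s + 2)) (b i) + (W ^ (s + 2)) (b i) =
          (2 * (τ i : ℂ)) • ((V ^ (s + 1)) (b i) + (W ^ (s + 1)) (b i)) -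
            ((V ^ s) (b i) + (W ^ s) (b i)) := by
        have e1 : (V ^ (s + 1)) (V (b i) + W (b i)) = (V ^ (s + 2)) (b i) + (V ^ s) (b i) := by
          rw [map_add, ← hp', hp' V s (W (b i)), hVW]
        have e2 : (W ^ (s + 1)) (V (b i) + W (b i)) = (W ^ s) (b i) + (W ^ (s + 2)) (b i) := by
          rw [map_add, ← hp' W (s + 1), hp' W s (V (b i)), hWV]
        rw [hTa, hTb, map_smul, map_smul] at e1 e2
        rw [smul_add, mul_smul, mul_smul, e1, e2]
        abel
      rw [e, h1, h2, smul_smul, ← sub_smul]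
      congr 1
      have : Real.cos ((s + 2 : ℕ) * Real.arccos (τ i)) =
          2 * τ i * Real.cos ((s + 1 : ℕ) * Real.arccos (τ i)) -
            Real.cos (s * Real.arccos (τ i)) := by
        have h3 := Real.cos_add_cos ((s + 2 : ℕ) * Real.arccos (τ i)) (s * Real.arccos (τ i))
        have h4 : ((s + 2 : ℕ) * Real.arccos (τ i) + s * Real.arccos (τ i)) / 2 =
          (s + 1 : ℕ) * Real.arccos (τ i) := by push_cast; ring
        have h5 : ((s + 2 : ℕ) * Real.arccos (τ i) - s * Real.arccos (τ i)) / 2 =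
          Real.arccos (τ i) := by push_cast; ring
        rw [h4, h5, Real.cos_arccos (hτ1 i).1 (hτ1 i).2] at h3
        linarith
      rw [this]
      push_cast
      ring
  have hDsum : D = ∑ i, inner ℂ (b i) D • b i := (b.sum_repr' D).symm
  have hconj (i) : inner ℂ D (b i) * inner ℂ (b i) D = ((‖inner ℂ (b i) D‖ ^ 2 : ℝ) : ℂ) := by
    rw [← inner_conj_symm D (b i), Complex.conj_mul']
    push_cast
    rfl
  refine ⟨Module.finrank ℂ E, fun i => ‖inner ℂ (b i) D‖ ^ 2, τ, fun i => sq_nonneg _, ?_, hτ1,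
    fun s => ?_, fun z hz x hx => ?_⟩
  · rw [b.sum_sq_norm_inner_right]
    exact hD1
  · have e1 : inner ℂ D ((V ^ s) D) + inner ℂ D ((W ^ s) D) =
        ((2 * (inner ℂ D ((V ^ s) D)).re : ℝ) : ℂ) := by
      have h (s : ℕ) (x y : E) : inner ℂ ((V ^ s) x) y = inner ℂ x ((W ^ s) y) := by
        induction s generalizing x with
        | zero => rfl
        | succ s ih => rw [pow_succ, pow_succ', Module.End.mul_apply, ih, Module.End.mul_apply,
            hadj]
      rw [← h, ← inner_conj_symm ((V ^ s) D) D, Complex.add_conj]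
    have e2 : inner ℂ D ((V ^ s) D) + inner ℂ D ((W ^ s) D) =
        ((∑ i, ‖inner ℂ (b i) D‖ ^ 2 * (2 * Real.cos (s * Real.arccos (τ i))) : ℝ) : ℂ) := by
      have : (V ^ s) D + (W ^ s) D = ∑ i, inner ℂ (b i) D •
          ((2 * Real.cos (s * Real.arccos (τ i)) : ℝ) : ℂ) • b i := by
        conv_lhs => rw [hDsum]
        rw [map_sum, map_sum, ← Finset.sum_add_distrib]
        refine Finset.sum_congr rfl fun i _ => ?_
        rw [map_smul, map_smul, ← smul_add, hcos]
      rw [← inner_add_right, this, inner_sum, Complex.ofReal_sum]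
      refine Finset.sum_congr rfl fun i _ => ?_
      rw [inner_smul_right, inner_smul_right, Complex.ofReal_mul (_ ^ 2), ← hconj]
      ring
    rw [e1] at e2
    have e3 := Complex.ofReal_injective e2
    rw [← mul_right_inj' (two_ne_zero (α := ℝ)), e3, Finset.mul_sum]
    exact Finset.sum_congr rfl fun i _ => by ring
  · have hz0 : z ≠ 0 := by positivity
    have hzc : (z : ℂ) ≠ 0 := by exact_mod_cast hz0
    set u := (z + 1 / z) / 2 with hu
    have hu1 : 1 < u := by
      rw [hu, lt_div_iff₀ two_pos, ← sub_pos]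
      have : z + 1 / z - 1 * 2 = (z - 1) ^ 2 / z := by field_simp; ring
      rw [this]
      have : 0 < z - 1 := by linarith
      positivity
    have huτ (i) : u - τ i ≠ 0 := by linarith [(hτ1 i).2]
    -- The resolvent of T at u applied to D. Because (z - V)(z - W) = 2z(u - T), it is tied to x by
    -- (z - W)h = 2x, once z - V is known to be injective.
    set h : E := ∑ i, (inner ℂ (b i) D / ((u - τ i : ℝ) : ℂ)) • b i with hh
    have hTh : (u : ℂ) • h - T h = D := by
      rw [hh, map_sum, Finset.smul_sum, ← Finset.sum_sub_distrib]
      conv_rhs => rw [hDsum]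
      refine Finset.sum_congr rfl fun i _ => ?_
      have : ((u - τ i : ℝ) : ℂ) ≠ 0 := by exact_mod_cast huτ i
      rw [map_smul, hTb, smul_comm, ← smul_sub, ← sub_smul, smul_smul, ← Complex.ofReal_sub,
        div_mul_cancel₀ _ this]
    have hDh : inner ℂ D h = ((∑ i, ‖inner ℂ (b i) D‖ ^ 2 / (u - τ i) : ℝ) : ℂ) := by
      rw [hh, inner_sum, Complex.ofReal_sum]
      refine Finset.sum_congr rfl fun i _ => ?_
      rw [inner_smul_right, Complex.ofReal_div, ← hconj]
      ring
    have hzu : (2 * u : ℂ) = z + 1 / z := by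
      rw [hu]
      push_cast
      ring
    have hker (y : E) (hy : (z : ℂ) • y = V y) : y = 0 := by
      have := congrArg norm hy
      rw [norm_smul, hnV, Complex.norm_real, Real.norm_of_nonneg (by linarith)] at this
      have h0 : (z - 1) * ‖y‖ = 0 := by linarith
      rcases mul_eq_zero.1 h0 with h0 | h0
      · linarith
      · exact norm_eq_zero.1 h0
    have hWh : (z : ℂ) • h - W h = (2 : ℂ) • x := by
      rw [← sub_eq_zero]
      apply hker
      rw [map_sub, map_sub, map_smul, map_smul, hVW, ← sub_eq_zero]
      have h1 : V h + W h = (2 * u : ℂ) • h - (2 : ℂ) • D := by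
        rw [hTa, ← hTh, mul_smul, smul_sub]
        abel
      have h2 : V h = (2 * u : ℂ) • h - (2 : ℂ) • D - W h := by rw [← h1]; abel
      have h3 : V x = (z : ℂ) • x - (z : ℂ) • D := by rw [← hx]; abel
      rw [h2, h3, hzu]
      simp only [smul_sub, smul_add, smul_smul, add_smul]
      rw [mul_one_div_cancel hzc]
      module
    have hz1 : inner ℂ D h * z = 2 * (‖x‖ : ℂ) ^ 2 := by
      have : inner ℂ ((z : ℂ) • D) h = inner ℂ x ((2 : ℂ) • x) := by
        rw [← hx, ← hWh, inner_sub_left, inner_sub_right, inner_smul_left, inner_smul_right, hadj,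
          Complex.conj_ofReal]
      rw [inner_smul_left, inner_smul_right, Complex.conj_ofReal] at this
      rw [mul_comm, this, inner_self_eq_norm_sq_to_K]
      rfl
    -- Norms of both sides of Vx = z(x - D), V being isometric. Together with `hz1` this eliminates
    -- ‖x‖².
    have hz2 : (z ^ 2 - 1) * ‖x‖ ^ 2 = z ^ 2 * (2 * (inner ℂ D x).re - 1) := by
      have h3 : V x = (z : ℂ) • (x - D) := by rw [smul_sub, ← hx]; abel
      have h4 := congrArg (fun y => ‖y‖ ^ 2) h3
      have h5 : ‖x - D‖ ^ 2 = ‖x‖ ^ 2 - 2 * (inner ℂ D x).re + 1 := by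
        rw [norm_sub_sq (𝕜 := ℂ), hD1, ← inner_conj_symm, RCLike.conj_re]
        rfl
      simp only [norm_smul, hnV, mul_pow, h5, Complex.norm_real, Real.norm_eq_abs, sq_abs] at h4
      linarith
    rw [hDh] at hz1
    have hz3 : (∑ i, ‖inner ℂ (b i) D‖ ^ 2 / (u - τ i)) * z = 2 * ‖x‖ ^ 2 := by
      exact_mod_cast hz1
    have hz4 : z ^ 2 - 1 ≠ 0 := by nlinarith
    rw [eq_div_iff hz4, ← mul_left_inj' hz0]
    linear_combination (z ^ 2 - 1) * hz3 + 2 * hz2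

end UnitarySpectrum
-- Lattice Green's function, resolvent of the walk and the rank-one perturbation.
section Resolvent

variable {n : ℕ} [NeZero n]

/-- `cos (2πj/n)` for a residue `j` modulo `n`. -/
noncomputable def cosMod (j : ZMod n) : ℝ := (ZMod.stdAddChar j).re

theorem stdAddChar_eq_exp (j : ZMod n) :
    ZMod.stdAddChar j = Complex.exp ((2 * Real.pi * j.val / n : ℝ) * Complex.I) := by
  rw [ZMod.stdAddChar_apply, ZMod.toCircle_apply]
  congr 1
  push_cast
  ring

theorem cosMod_eq_cos (j : ZMod n) : cosMod j = Real.cos (2 * Real.pi * j.val / n) := by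
  rw [cosMod, stdAddChar_eq_exp, Complex.exp_ofReal_mul_I_re]

theorem stdAddChar_neg_eq_conj (j : ZMod n) :
    ZMod.stdAddChar (-j) = (starRingEnd ℂ) (ZMod.stdAddChar j) := by
  rw [AddChar.map_neg_eq_inv, stdAddChar_eq_exp, ← Complex.exp_neg, ← Complex.exp_conj, map_mul,
    Complex.conj_ofReal, Complex.conj_I, mul_neg]

theorem cosMod_zero : cosMod (0 : ZMod n) = 1 := by
  simp [cosMod, AddChar.map_zero_eq_one]

theorem cosMod_neg (j : ZMod n) : cosMod (-j) = cosMod j := by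
  rw [cosMod, stdAddChar_neg_eq_conj, Complex.conj_re, cosMod]

theorem abs_cosMod_le_one (j : ZMod n) : |cosMod j| ≤ 1 := by
  rw [cosMod_eq_cos]
  exact Real.abs_cos_le_one _

theorem cosMod_add_add_cosMod_sub (a b : ZMod n) :
    cosMod (a + b) + cosMod (a - b) = 2 * cosMod a * cosMod b := by
  simp only [cosMod, sub_eq_add_neg, AddChar.map_add_eq_mul, stdAddChar_neg_eq_conj,
    Complex.mul_re, Complex.conj_re, Complex.conj_im]
  ring

theorem sum_cosMod_mul (x : ZMod n) :
    ∑ j : ZMod n, cosMod (j * x) = if x = 0 then (n : ℝ) else 0 := by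
  have h := congrArg Complex.re (AddChar.sum_mulShift x (ZMod.isPrimitive_stdAddChar n))
  rw [Complex.re_sum] at h
  refine h.trans ?_
  split_ifs <;> simp [ZMod.card]

/-- The eigenvalues `cos k cos l` of the average over the diagonal neighbours. -/
noncomputable def level (p : Vertex n) : ℝ := cosMod p.1 * cosMod p.2

/-- The lattice Green's function of the average over the diagonal neighbours. -/
noncomputable def green (u : ℝ) (s : Vertex n) : ℝ :=
  (∑ p : Vertex n, cosMod (p.1 * s.1) * cosMod (p.2 * s.2) / (u - level p)) / gridSize n

/-- The Stieltjes transform of the spectrum of the average over the diagonal neighbours. -/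
noncomputable def levelTransform (n : ℕ) [NeZero n] (u : ℝ) : ℝ :=
  (∑ p : Vertex n, 1 / (u - level p)) / gridSize n

omit [NeZero n] in
theorem gridSize_pos [NeZero n] : 0 < gridSize n := by
  have : (0 : ℝ) < n := by exact_mod_cast NeZero.pos n
  unfold gridSize
  positivity

theorem green_zero (u : ℝ) : green u (0 : Vertex n) = levelTransform n u := by
  simp [green, levelTransform, cosMod_zero]

theorem green_neg_left (u : ℝ) (x y : ZMod n) : green u (-x, y) = green u (x, y) := by
  simp [green, cosMod_neg]

/-- The diagonal sum multiplies the mode p by 4 `level p` = 4u - 4(u - `level p`). The second part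
cancels the denominator and leaves a sum of characters, which orthogonality turns into a delta at 0.
-/
theorem diagSum_green {u : ℝ} (hu : ∀ p : Vertex n, u ≠ level p) (s : Vertex n) :
    diagSum (green u) s = 4 * (u * green u s - if s = 0 then 1 else 0) := by
  obtain ⟨x, y⟩ := s
  have hg := (gridSize_pos (n := n)).ne'
  have hdelta : (∑ p : Vertex n, cosMod (p.1 * x) * cosMod (p.2 * y)) =
      gridSize n * if (x, y) = (0 : Vertex n) then 1 else 0 := by
    rw [Fintype.sum_prod_type]
    simp_rw [← Finset.mul_sum]
    rw [← Finset.sum_mul, sum_cosMod_mul, sum_cosMod_mul, gridSize]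
    by_cases hx : x = 0 <;> by_cases hy : y = 0 <;> simp [hx, hy, sq]
  have hterm (p : Vertex n) :
      cosMod (p.1 * (x + 1)) * cosMod (p.2 * (y + 1)) / (u - level p) +
      cosMod (p.1 * (x - 1)) * cosMod (p.2 * (y + 1)) / (u - level p) +
      cosMod (p.1 * (x + 1)) * cosMod (p.2 * (y - 1)) / (u - level p) +
      cosMod (p.1 * (x - 1)) * cosMod (p.2 * (y - 1)) / (u - level p) =
      4 * u * (cosMod (p.1 * x) * cosMod (p.2 * y) / (u - level p)) -
        4 * (cosMod (p.1 * x) * cosMod (p.2 * y)) := by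
    have h := sub_ne_zero.2 (hu p)
    have h1 := cosMod_add_add_cosMod_sub (p.1 * x) p.1
    have h2 := cosMod_add_add_cosMod_sub (p.2 * y) p.2
    have e : 4 * (cosMod (p.1 * x) * cosMod (p.2 * y)) =
        4 * (cosMod (p.1 * x) * cosMod (p.2 * y)) * (u - level p) / (u - level p) := by
      field_simp
    rw [e, ← add_div, ← add_div, ← add_div, mul_div_assoc', ← sub_div]
    congr 1
    simp only [mul_add, mul_sub, mul_one]
    rw [level]
    linear_combination (cosMod (p.2 * y + p.2) + cosMod (p.2 * y - p.2)) * h1 +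
      2 * cosMod (p.1 * x) * cosMod p.1 * h2
  have hsum := Finset.sum_congr (rfl : (Finset.univ : Finset (Vertex n)) = _)
    fun p _ => hterm p
  simp only [Finset.sum_add_distrib, Finset.sum_sub_distrib, ← Finset.mul_sum, hdelta] at hsum
  simp only [diagSum, green]
  field_simp
  linear_combination hsum

/-- The Green's function at `m`, with coin state `c`. -/
noncomputable def spinGreen (c : Fin 2 → ℂ) (m : Vertex n) (u : ℝ) : Walker n :=
  WithLp.toLp 2 fun p => c p.1 * (green u (p.2 - m) : ℂ)

theorem spinGreen_equation (c : Fin 2 → ℂ) (m : Vertex n) {u : ℝ}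
    (hu : ∀ p : Vertex n, u ≠ level p) (v : Fin 2) (q : Vertex n) :
    ((2 * u : ℂ) • spinGreen c m u - (walkStep (spinGreen c m u) + walkBack (spinGreen c m u)))
      (v, q) = if q = m then 2 * c v else 0 := by
  have h := diagSum_green hu (q - m)
  have e : diagSum (fun r => spinGreen c m u (v, r)) q =
      c v * (diagSum (green u) (q - m) : ℝ) := by
    obtain ⟨x, y⟩ := q
    obtain ⟨a, b⟩ := m
    simp only [diagSum, spinGreen, Prod.mk_sub_mk, add_sub_right_comm, sub_right_comm _ (1 : ZMod n)]
    push_cast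
    ring
  rw [PiLp.sub_apply, walkStep_add_walkBack_apply, e, h, PiLp.smul_apply]
  simp only [spinGreen, smul_eq_mul, sub_eq_zero]
  split_ifs <;> push_cast <;> ring

/-- The only solution of `U φ = z φ` is zero if `(z + 1/z)/2` is real and not a level. -/
theorem eq_zero_of_walkStep_eq_smul {z : ℂ} {u : ℝ} (hz : z ^ 2 + 1 = 2 * u * z)
    (hu : ∀ p : Vertex n, u ≠ level p) {φ : Walker n} (h : walkStep φ = z • φ) : φ = 0 := by
  have hb : z • walkBack φ = φ := by
    rw [← map_smul, ← h, walkBack_walkStep]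
  have hz0 : z ≠ 0 := by
    rintro rfl
    simp at hz
  have hsum : walkStep φ + walkBack φ = (2 * u : ℂ) • φ := by
    apply smul_right_injective (Walker n) hz0
    simp only [smul_add, hb, h, smul_smul]
    nth_rewrite 2 [← one_smul ℂ φ]
    rw [← add_smul]
    congr 1
    linear_combination hz
  have hadj (x y : Walker n) : inner ℂ (walkBack x) y = inner ℂ x (walkStep y) := by
    rw [← inner_conj_symm, ← inner_walkStep_left, inner_conj_symm]
  -- The coordinate φ(v, m) is recovered by pairing φ with (2u - U - U⁻¹)g, where g is the Green's
  -- function for |v,m⟩; self-adjointness moves the operator onto φ, which it kills.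
  ext ⟨v, m⟩
  have hk : (2 * u : ℂ) • spinGreen (Pi.single v 1) m u -
      (walkStep (spinGreen (Pi.single v 1) m u) + walkBack (spinGreen (Pi.single v 1) m u)) =
      (2 : ℂ) • ket v m := by
    ext ⟨w, q⟩
    rw [spinGreen_equation _ _ hu]
    by_cases h1 : w = v <;> by_cases h2 : q = m <;> simp [ket, h1, h2]
  have h0 : inner ℂ ((2 : ℂ) • ket v m) φ = 0 := by
    rw [← hk, inner_sub_left, inner_add_left, inner_walkStep_left, hadj, ← inner_add_right,
      add_comm (walkBack φ), hsum, inner_smul_left, inner_smul_right]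
    simp [map_ofNat]
  rw [inner_smul_left, inner_ket] at h0
  simpa using h0

/-- The resolvent `(1 - U/z)⁻¹` applied to `|d, m⟩`, where `u = (z + 1/z)/2`. -/
noncomputable def resolventVec (m : Vertex n) (z : ℂ) (u : ℝ) : Walker n :=
  (1 / 2 : ℂ) • (z • spinGreen (fun _ => ((1 / Real.sqrt 2 : ℝ) : ℂ)) m u -
    walkBack (spinGreen (fun _ => ((1 / Real.sqrt 2 : ℝ) : ℂ)) m u))

/-- Rests on (z - U)(z - U⁻¹) = z(2u - U - U⁻¹). The Green's function g solves (2u - U - U⁻¹)g = 2D,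
so z - U maps half of (z - U⁻¹)g to zD. -/
theorem walkStep_resolventVec (m : Vertex n) {z : ℂ} {u : ℝ} (hz : z ^ 2 + 1 = 2 * u * z)
    (hu : ∀ p : Vertex n, u ≠ level p) :
    walkStep (resolventVec m z u) = z • resolventVec m z u - z • diagKet m := by
  have hk : (2 * u : ℂ) • spinGreen (fun _ => ((1 / Real.sqrt 2 : ℝ) : ℂ)) m u -
      (walkStep (spinGreen (fun _ => ((1 / Real.sqrt 2 : ℝ) : ℂ)) m u) +
        walkBack (spinGreen (fun _ => ((1 / Real.sqrt 2 : ℝ) : ℂ)) m u)) =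
      (2 : ℂ) • diagKet m := by
    ext ⟨w, q⟩
    rw [spinGreen_equation _ _ hu, PiLp.smul_apply, diagKet_apply]
    split_ifs <;> simp
  rw [resolventVec, map_smul, map_sub, map_smul, walkStep_walkBack]
  generalize spinGreen (fun _ => ((1 / Real.sqrt 2 : ℝ) : ℂ)) m u = g at hk ⊢
  have hd : diagKet m = (1 / 2 : ℂ) • ((2 * u : ℂ) • g - (walkStep g + walkBack g)) := by
    rw [hk, smul_smul]
    norm_num
  have hg : (z * (2 * u)) • g = (z ^ 2) • g + g := by
    nth_rewrite 3 [← one_smul ℂ g]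
    rw [← add_smul, hz]
    congr 1
    ring
  rw [hd]
  simp only [smul_sub, smul_add, smul_smul]
  rw [show z * (1 / 2 * (2 * u)) = 1 / 2 * (z * (2 * u)) by ring, mul_smul (1 / 2 : ℂ) (z * (2 * u)),
    hg, smul_add, smul_smul]
  module

/-- The Green's function is even in x, so the coin-mixing terms of `U⁻¹g` cancel at m. What remains
is its diagonal sum at 0, which equals 4(uL(u) - 1). -/
theorem inner_diagKet_resolventVec (m : Vertex n) {z : ℂ} {u : ℝ}
    (hu : ∀ p : Vertex n, u ≠ level p) :
    2 * inner ℂ (diagKet m) (resolventVec m z u) - 1 = (z - u) * levelTransform n u := by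
  have hs := coe_inv_sqrt_two_mul_self
  have h := diagSum_green hu 0
  have e1 : green u ((0 - 1 : ZMod n), (0 + 1 : ZMod n)) =
      green u ((0 + 1 : ZMod n), (0 + 1 : ZMod n)) := by
    rw [← green_neg_left]
    simp
  have e2 : green u ((0 - 1 : ZMod n), (0 - 1 : ZMod n)) =
      green u ((0 + 1 : ZMod n), (0 - 1 : ZMod n)) := by
    rw [← green_neg_left]
    simp
  simp only [diagSum, Prod.fst_zero, Prod.snd_zero, e1, e2, if_true] at h
  have h' := congrArg (Complex.ofReal) h
  push_cast at h'
  obtain ⟨a, b⟩ := m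
  rw [inner_diagKet]
  simp only [resolventVec, PiLp.smul_apply, PiLp.sub_apply, smul_eq_mul, walkBack_apply_zero,
    walkBack_apply_one]
  simp only [spinGreen, Prod.mk_sub_mk, add_sub_right_comm, sub_right_comm _ (1 : ZMod n), sub_self,
    e1, e2]
  rw [← green_zero]
  generalize ((1 / Real.sqrt 2 : ℝ) : ℂ) = c at *
  linear_combination (2 * z * (green u (0 : Vertex n) : ℂ) - (green u ((0 + 1 : ZMod n), (0 + 1 : ZMod n)) : ℂ) -
    (green u ((0 + 1 : ZMod n), (0 - 1 : ZMod n)) : ℂ)) * hs - (1 / 4) * h'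

/-- If φ is an eigenvector with overlap a and x is the resolvent vector, then φ + 2a(x - D) is an
eigenvector of `U` or zero, hence zero. So a ≠ 0, and pairing with D yields a(z - u)L(u) = 0. -/
theorem hasEigenvalue_singleton (m : Vertex n) {z : ℂ} {u : ℝ} (hz : z ^ 2 + 1 = 2 * u * z)
    (hzu : z ≠ u) (hu : ∀ p : Vertex n, u ≠ level p)
    (h : Module.End.HasEigenvalue (searchStep {m}) z) : levelTransform n u = 0 := by
  obtain ⟨φ, hφ⟩ := h.exists_hasEigenvector
  have e := hφ.apply_eq_smul
  rw [searchStep_singleton_apply] at e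
  set a := inner ℂ (diagKet m) φ with ha
  set x := resolventVec m z u with hx
  have hx1 := walkStep_resolventVec m hz hu
  have hx2 := inner_diagKet_resolventVec m (z := z) hu
  rw [← hx] at hx1 hx2
  have hφ0 : φ + (2 * a) • (x - diagKet m) = 0 := by
    apply eq_zero_of_walkStep_eq_smul hz hu
    have e' : walkStep φ = z • φ + (2 * a) • walkStep (diagKet m) := by rw [← e]; abel
    rw [map_add, map_smul, map_sub, hx1, e']
    module
  have hφ1 : φ = -((2 * a) • (x - diagKet m)) := eq_neg_of_add_eq_zero_left hφ0
  have ha0 : a ≠ 0 := by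
    intro h0
    apply hφ.2
    rw [hφ1, h0]
    simp
  have h2 : a = -(2 * a * (inner ℂ (diagKet m) x - 1)) := by
    nth_rewrite 1 [ha, hφ1]
    rw [inner_neg_right, inner_smul_right, inner_sub_right, inner_diagKet_self]
  have h3 : a * ((z - u) * levelTransform n u) = 0 := by
    rw [← hx2]
    linear_combination h2
  have h4 : (levelTransform n u : ℂ) = 0 := by
    rcases mul_eq_zero.1 h3 with h | h
    · exact absurd h ha0
    · rcases mul_eq_zero.1 h with h | h
      · exact absurd (sub_eq_zero.1 h) hzu
      · exact h
  exact_mod_cast h4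

/-- When L(u) = 0 the resolvent vector x has overlap exactly 1/2 with D. The oracle then sends x - D
to x, and Ux = z(x - D). -/
theorem exists_eigenvector_singleton (m : Vertex n) {z : ℂ} {u : ℝ} (hz : z ^ 2 + 1 = 2 * u * z)
    (hu : ∀ p : Vertex n, u ≠ level p) (h : levelTransform n u = 0) :
    ∃ φ, searchStep {m} φ = z • φ ∧ inner ℂ (diagKet m) φ ≠ 0 := by
  have hx1 := walkStep_resolventVec m hz hu
  have hx2 := inner_diagKet_resolventVec m (z := z) hu
  have hx3 : inner ℂ (diagKet m) (resolventVec m z u) = 1 / 2 := by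
    rw [h, Complex.ofReal_zero] at hx2
    linear_combination (1 / 2) * hx2
  refine ⟨resolventVec m z u - diagKet m, ?_, ?_⟩
  · rw [searchStep_singleton_apply, map_sub, hx1, inner_sub_right, hx3, inner_diagKet_self]
    module
  · rw [inner_sub_right, hx3, inner_diagKet_self]
    norm_num

/-- The transforms of the spectral measures of `U` and `U'` at the marked state are inverse. -/
theorem exists_resolvent_searchStep (m : Vertex n) {z : ℂ} {u : ℝ} (hz : z ^ 2 + 1 = 2 * u * z)
    (hu : ∀ p : Vertex n, u ≠ level p) (hzu : z ≠ u) (h : levelTransform n u ≠ 0) :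
    ∃ x, z • x - searchStep {m} x = z • diagKet m ∧
      2 * inner ℂ (diagKet m) x - 1 = 1 / ((z - u) * levelTransform n u) := by
  have hx1 := walkStep_resolventVec m hz hu
  have hx2 := inner_diagKet_resolventVec m (z := z) hu
  set y := resolventVec m z u with hy
  have hc : (z - u) * levelTransform n u ≠ 0 :=
    mul_ne_zero (sub_ne_zero.2 hzu) (by exact_mod_cast h)
  set c := (z - u) * levelTransform n u with hcdef
  set Y := inner ℂ (diagKet m) y with hY
  have hYc : Y = (c + 1) / 2 := by linear_combination (1 / 2) * hx2
  have hX : inner ℂ (diagKet m) (y - (2 * (Y / c)) • (y - diagKet m)) = Y / c := by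
    rw [inner_sub_right, inner_smul_right, inner_sub_right, inner_diagKet_self, ← hY, hYc]
    field_simp
    ring
  -- Rank-one resolvent formula: in y - 2X(y - D) the number X must be the vector's own overlap with
  -- D, and this consistency condition gives X = Y/(2Y - 1) = Y/c.
  refine ⟨y - (2 * (Y / c)) • (y - diagKet m), ?_, ?_⟩
  · rw [searchStep_singleton_apply, hX, map_sub, map_smul, map_sub, hx1]
    module
  · rw [hX, hYc]
    field_simp
    ring

end Resolvent
-- The amplitude at the marked vertex as a spectral integral.
section Amplitude

variable {n : ℕ}

/-- Complex conjugation combined with the reflection `x ↦ 2 m.1 - x`. -/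
noncomputable def conjReflect (m : Vertex n) (ψ : Walker n) : Walker n :=
  WithLp.toLp 2 fun p => (starRingEnd ℂ) (ψ (p.1, (2 * m.1 - p.2.1, p.2.2)))

theorem conjReflect_apply (m : Vertex n) (ψ : Walker n) (v : Fin 2) (x y : ZMod n) :
    conjReflect m ψ (v, (x, y)) = (starRingEnd ℂ) (ψ (v, (2 * m.1 - x, y))) := rfl

theorem conjReflect_sub_smul (m : Vertex n) (φ ψ : Walker n) (c : ℂ) :
    conjReflect m (φ - c • ψ) = conjReflect m φ - (starRingEnd ℂ) c • conjReflect m ψ := by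
  ext ⟨v, x, y⟩
  simp only [conjReflect_apply, PiLp.sub_apply, PiLp.smul_apply, smul_eq_mul, map_sub, map_mul]

/-- Conjugation flips the sign of the imaginary terms; the reflection exchanges the neighbours at x
+ 1 and x - 1, whose difference those terms contain. The two signs cancel. -/
theorem conjReflect_walkStep (m : Vertex n) (ψ : Walker n) :
    conjReflect m (walkStep ψ) = walkStep (conjReflect m ψ) := by
  have e1 (x : ZMod n) : 2 * m.1 - (x + 1) = 2 * m.1 - x - 1 := by ring
  have e2 (x : ZMod n) : 2 * m.1 - (x - 1) = 2 * m.1 - x + 1 := by ring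
  apply walker_ext
  · rintro ⟨x, y⟩
    simp only [conjReflect_apply, walkStep_apply_zero, e1, e2, map_add, map_sub, map_mul, map_div₀,
      map_one, map_ofNat, Complex.conj_I]
    ring
  · rintro ⟨x, y⟩
    simp only [conjReflect_apply, walkStep_apply_one, e1, e2, map_add, map_sub, map_mul, map_div₀,
      map_one, map_ofNat, Complex.conj_I]
    ring

theorem conjReflect_diagKet (m : Vertex n) : conjReflect m (diagKet m) = diagKet m := by
  obtain ⟨a, b⟩ := m
  ext ⟨v, x, y⟩
  have : 2 * a - x = a ↔ x = a := by
    constructor <;> intro h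
    · linear_combination -h
    · linear_combination -h
  rw [conjReflect_apply, diagKet_apply, diagKet_apply]
  simp only [Prod.mk.injEq, this]
  split_ifs <;> simp [Complex.conj_ofReal]

theorem walkStep_initState : walkStep (initState : Walker n) = initState := by
  apply walker_ext
  · rintro ⟨x, y⟩
    simp only [walkStep_apply_zero, initState]
    ring
  · rintro ⟨x, y⟩
    simp only [walkStep_apply_one, initState]
    ring

variable [NeZero n]

theorem inner_diagKet_conjReflect (m : Vertex n) (ψ : Walker n) :
    inner ℂ (diagKet m) (conjReflect m ψ) = (starRingEnd ℂ) (inner ℂ (diagKet m) ψ) := by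
  obtain ⟨a, b⟩ := m
  rw [inner_diagKet, inner_diagKet, conjReflect_apply, conjReflect_apply]
  simp only [map_mul, map_add, Complex.conj_ofReal]
  rw [show 2 * a - a = a by ring]

theorem stateAt_succ (M : Finset (Vertex n)) (t : ℕ) :
    stateAt M (t + 1) = searchStep M (stateAt M t) := by
  rw [stateAt, pow_succ', Module.End.mul_apply, stateAt]

/-- The antiunitary symmetry fixes ψ(0) and D, hence every state of the search. Reality of the
amplitude is what lets it be computed from cosine moments alone. -/
theorem conj_inner_stateAt (m : Vertex n) (t : ℕ) :
    (starRingEnd ℂ) (inner ℂ (diagKet m) (stateAt {m} t)) =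
      inner ℂ (diagKet m) (stateAt {m} t) := by
  have key : conjReflect m (stateAt {m} t) = stateAt {m} t := by
    induction t with
    | zero =>
      ext ⟨v, x, y⟩
      simp only [stateAt, pow_zero, Module.End.one_apply, conjReflect_apply, initState,
        Complex.conj_ofReal]
    | succ t ih =>
      rw [stateAt_succ, searchStep_singleton_apply, conjReflect_sub_smul, conjReflect_walkStep,
        conjReflect_walkStep, conjReflect_diagKet, ih, map_mul, ← inner_diagKet_conjReflect, ih,
        map_ofNat]
  rw [← inner_diagKet_conjReflect, key]

omit [NeZero n] in
theorem sqrt_gridSize : Real.sqrt (gridSize n) = n := by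
  rw [gridSize, Real.sqrt_sq (Nat.cast_nonneg n)]

theorem inner_diagKet_initState (m : Vertex n) :
    inner ℂ (diagKet m) initState = ((1 / n : ℝ) : ℂ) := by
  have hn : (n : ℝ) ≠ 0 := by exact_mod_cast NeZero.ne n
  rw [inner_diagKet]
  simp only [initState]
  rw [← Complex.ofReal_add, ← Complex.ofReal_mul, Real.sqrt_mul zero_le_two, sqrt_gridSize]
  congr 1
  have h2 : Real.sqrt 2 * Real.sqrt 2 = 2 := Real.mul_self_sqrt zero_le_two
  have h3 : Real.sqrt 2 ≠ 0 := by positivity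
  field_simp
  linear_combination -h2

/-- `U` fixes ψ(0) and U'D = -UD, so one search step adds (2/n)U'D to ψ(0). Iteration accumulates
the powers 1, …, t, the source of the Dirichlet kernel. -/
theorem stateAt_singleton_eq (m : Vertex n) (t : ℕ) :
    stateAt {m} t = initState + ((2 / n : ℝ) : ℂ) •
      ∑ s ∈ Finset.range t, (searchStep {m} ^ (s + 1)) (diagKet m) := by
  induction t with
  | zero => simp [stateAt]
  | succ t ih =>
    have e1 : searchStep {m} (initState : Walker n) =
        initState + ((2 / n : ℝ) : ℂ) • searchStep {m} (diagKet m) := by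
      rw [searchStep_singleton_apply, searchStep_singleton_apply, walkStep_initState,
        inner_diagKet_initState, inner_diagKet_self]
      push_cast
      module
    rw [stateAt_succ, ih, map_add, map_smul, map_sum, e1, Finset.sum_range_succ']
    have e2 (s : ℕ) : searchStep {m} ((searchStep {m} ^ (s + 1)) (diagKet m)) =
        (searchStep {m} ^ (s + 1 + 1)) (diagKet m) := by
      rw [pow_succ' _ (s + 1), Module.End.mul_apply]
    simp only [e2, zero_add, pow_one, smul_add]
    abel

theorem level_le_one (p : Vertex n) : level p ≤ 1 := by
  rw [level]
  refine (le_abs_self _).trans ?_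
  rw [abs_mul]
  exact mul_le_one₀ (abs_cosMod_le_one _) (abs_nonneg _) (abs_cosMod_le_one _)

theorem levelTransform_pos {u : ℝ} (hu : 1 < u) : 0 < levelTransform n u := by
  refine div_pos (Finset.sum_pos (fun p _ => ?_) ⟨0, Finset.mem_univ _⟩) gridSize_pos
  have := level_le_one p
  exact one_div_pos.2 (by linarith)

/-- The amplitude at the marked vertex in terms of a probability measure on `[-1, 1]`, whose
Stieltjes transform is the inverse of that of the levels. -/
theorem exists_amplitude_formula (m : Vertex n) :
    ∃ (k : ℕ) (κ τ : Fin k → ℝ), (∀ i, 0 ≤ κ i) ∧ ∑ i, κ i = 1 ∧ (∀ i, -1 ≤ τ i ∧ τ i ≤ 1) ∧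
      (∀ t : ℕ, inner ℂ (diagKet m) (stateAt {m} t) = (((∑ i, κ i *
        (1 + 2 * ∑ s ∈ Finset.range t, Real.cos ((s + 1 : ℕ) * Real.arccos (τ i)))) / n : ℝ) : ℂ)) ∧
      (∀ u : ℝ, 1 < u → (u ^ 2 - 1) * levelTransform n u * ∑ i, κ i / (u - τ i) = 1) := by
  obtain ⟨k, κ, τ, hκ, hκ1, hτ, hmom, htr⟩ := exists_spectral_measure (searchStep_searchBack m)
    (searchBack_searchStep m) (inner_searchStep_left m) (inner_diagKet_self m)
  refine ⟨k, κ, τ, hκ, hκ1, hτ, fun t => ?_, fun u hu => ?_⟩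
  · have hre := Complex.conj_eq_iff_re.1 (conj_inner_stateAt m t)
    rw [← hre]
    congr 1
    rw [stateAt_singleton_eq, inner_add_right, inner_smul_right, inner_sum,
      inner_diagKet_initState, Complex.add_re, Complex.ofReal_re, Complex.re_ofReal_mul,
      Complex.re_sum]
    simp only [hmom, mul_add, mul_one, Finset.sum_add_distrib, hκ1]
    rw [Finset.sum_comm]
    simp only [Finset.mul_sum, Finset.sum_div, add_div]
    congr 1
    exact Finset.sum_congr rfl fun i _ => Finset.sum_congr rfl fun s _ => by ring
  -- The root z > 1 of (z + 1/z)/2 = u. The factor u² - 1 comes from z² - 1 = 2z(z - u) and (z - u)²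
  -- = u² - 1.
  · set z := u + Real.sqrt (u ^ 2 - 1) with hz
    have hpos : 0 < u ^ 2 - 1 := by nlinarith
    have hs : 0 < Real.sqrt (u ^ 2 - 1) := Real.sqrt_pos.2 hpos
    have hs2 : Real.sqrt (u ^ 2 - 1) ^ 2 = u ^ 2 - 1 := Real.sq_sqrt hpos.le
    have hz1 : 1 < z := by linarith
    have hzz : z ^ 2 + 1 = 2 * u * z := by
      rw [hz]
      linear_combination hs2
    have hzc : (z : ℂ) ^ 2 + 1 = 2 * u * z := by exact_mod_cast hzz
    have hzu : (z : ℂ) ≠ u := by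
      rw [Ne, Complex.ofReal_inj]
      linarith
    have hL := levelTransform_pos (n := n) hu
    obtain ⟨x, hx1, hx2⟩ := exists_resolvent_searchStep m hzc
      (fun p => by linarith [level_le_one p]) hzu hL.ne'
    have h := htr z hz1 x hx1
    have hX : 2 * (inner ℂ (diagKet m) x).re - 1 = 1 / ((z - u) * levelTransform n u) := by
      have := congrArg Complex.re hx2
      rw [← Complex.ofReal_sub, ← Complex.ofReal_mul, ← Complex.ofReal_one, ← Complex.ofReal_div,
        Complex.ofReal_re, Complex.sub_re, Complex.ofReal_re] at this
      rw [← this]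
      simp
    have hu' : (z + 1 / z) / 2 = u := by
      field_simp
      linear_combination hzz
    rw [hu', hX] at h
    rw [h]
    have h1 : z ^ 2 - 1 = 2 * z * (z - u) := by linear_combination -hzz
    have h2 : u ^ 2 - 1 = (z - u) ^ 2 := by rw [← hs2, hz]; ring
    have h3 : z - u ≠ 0 := by
      rw [hz]
      linarith
    have h4 : z ≠ 0 := by linarith
    rw [h1, h2]
    field_simp

end Amplitude
-- Reciprocal Stieltjes transforms: atoms, zeros and residues.
section StieltjesTransforms

open Filter Topology

variable {ι ι' : Type*} [Fintype ι] [Fintype ι']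

theorem exists_polynomials_of_sum_div (a γ : ι → ℝ) :
    ∃ P Q : Polynomial ℝ, ∀ u, (∀ j, u ≠ γ j) → Q.eval u ≠ 0 ∧
      ∑ j, a j / (u - γ j) = P.eval u / Q.eval u := by
  classical
  refine ⟨∑ j, Polynomial.C (a j) * ∏ i ∈ Finset.univ.erase j, (Polynomial.X - Polynomial.C (γ i)),
    ∏ i, (Polynomial.X - Polynomial.C (γ i)), fun u hu => ?_⟩
  have hQ : (∏ i, (Polynomial.X - Polynomial.C (γ i))).eval u ≠ 0 := by
    rw [Polynomial.eval_prod, Finset.prod_ne_zero_iff]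
    intro i _
    simpa [sub_eq_zero] using hu i
  refine ⟨hQ, ?_⟩
  rw [eq_div_iff hQ, Finset.sum_mul, Polynomial.eval_finsetSum]
  refine Finset.sum_congr rfl fun j _ => ?_
  have h := sub_ne_zero.2 (hu j)
  rw [← Finset.mul_prod_erase Finset.univ _ (Finset.mem_univ j)]
  simp only [Polynomial.eval_mul, Polynomial.eval_sub, Polynomial.eval_X, Polynomial.eval_C]
  field_simp

/-- An identity between Stieltjes transforms of finite measures extends off the supports. -/
theorem stieltjes_identity_extend {a γ : ι → ℝ} {b τ : ι' → ℝ} (hγ : ∀ j, γ j ≤ 1)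
    (hτ : ∀ i, τ i ≤ 1)
    (h : ∀ u, 1 < u → (u ^ 2 - 1) * (∑ j, a j / (u - γ j)) * ∑ i, b i / (u - τ i) = 1)
    {u : ℝ} (hu : ∀ j, u ≠ γ j) (hu' : ∀ i, u ≠ τ i) :
    (u ^ 2 - 1) * (∑ j, a j / (u - γ j)) * ∑ i, b i / (u - τ i) = 1 := by
  obtain ⟨P, Q, hPQ⟩ := exists_polynomials_of_sum_div a γ
  obtain ⟨P', Q', hPQ'⟩ := exists_polynomials_of_sum_div b τ
  -- With denominators cleared, the identity on (1, ∞) is one between polynomials at infinitely many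
  -- points, hence holds identically.
  have hpoly : (Polynomial.X ^ 2 - 1) * P * P' = Q * Q' := by
    apply Polynomial.eq_of_infinite_eval_eq
    refine (Set.Ioi_infinite (1 : ℝ)).mono fun v hv => ?_
    have hv' : (1 : ℝ) < v := hv
    obtain ⟨h1, h2⟩ := hPQ v fun j => by linarith [hγ j]
    obtain ⟨h3, h4⟩ := hPQ' v fun i => by linarith [hτ i]
    have h5 := h v hv'
    rw [h2, h4] at h5
    field_simp at h5
    simpa using h5
  obtain ⟨h1, h2⟩ := hPQ u hu
  obtain ⟨h3, h4⟩ := hPQ' u hu'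
  have h5 := congrArg (Polynomial.eval u) hpoly
  simp only [Polynomial.eval_mul, Polynomial.eval_sub, Polynomial.eval_pow, Polynomial.eval_X,
    Polynomial.eval_one] at h5
  rw [h2, h4]
  field_simp
  exact h5

theorem eventually_ne_of_finite (γ : ι → ℝ) (x : ℝ) : ∀ᶠ u in 𝓝[≠] x, ∀ j, u ≠ γ j := by
  rw [eventually_all]
  intro j
  by_cases h : γ j = x
  · rw [h]
    exact self_mem_nhdsWithin
  · exact (eventually_ne_nhds (Ne.symm h)).filter_mono nhdsWithin_le_nhds

theorem tendsto_sub_mul_stieltjes (a γ : ι → ℝ) (x : ℝ) :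
    Tendsto (fun u => (u - x) * ∑ j, a j / (u - γ j)) (𝓝[≠] x)
      (𝓝 (∑ j, if γ j = x then a j else 0)) := by
  simp only [Finset.mul_sum]
  refine tendsto_finsetSum _ fun j _ => ?_
  split_ifs with h
  · refine tendsto_const_nhds.congr' ?_
    filter_upwards [self_mem_nhdsWithin] with u hu
    have : u - x ≠ 0 := sub_ne_zero.2 hu
    rw [h]
    field_simp
  · have h' : x - γ j ≠ 0 := sub_ne_zero.2 (Ne.symm h)
    have : ContinuousAt (fun u => (u - x) * (a j / (u - γ j))) x := by
      refine ContinuousAt.mul (by fun_prop) (ContinuousAt.div (by fun_prop) (by fun_prop) h')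
    have h2 := this.tendsto.mono_left (nhdsWithin_le_nhds (s := {x}ᶜ))
    simpa using h2

theorem continuousAt_stieltjes (a γ : ι → ℝ) {x : ℝ} (hx : ∀ j, x ≠ γ j) :
    ContinuousAt (fun u => ∑ j, a j / (u - γ j)) x := by
  refine tendsto_finsetSum _ fun j _ => ?_
  exact ContinuousAt.div (by fun_prop) (by fun_prop) (sub_ne_zero.2 (hx j))

section Duality

variable {a γ : ι → ℝ} {b τ : ι' → ℝ} (hγ : ∀ j, γ j ≤ 1) (hτ : ∀ i, τ i ≤ 1)
  (h : ∀ u, 1 < u → (u ^ 2 - 1) * (∑ j, a j / (u - γ j)) * ∑ i, b i / (u - τ i) = 1)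

include hγ hτ h

/-- Multiply the identity by u - x and let u tend to x. Off the levels, the dual measure has atoms
only at zeros of the first transform or at ±1. -/
theorem dual_mass_mul_eq_zero {x : ℝ} (hx : ∀ j, x ≠ γ j) :
    (x ^ 2 - 1) * (∑ j, a j / (x - γ j)) * (∑ i, if τ i = x then b i else 0) = 0 := by
  have h1 : Tendsto (fun u => (u ^ 2 - 1) * (∑ j, a j / (u - γ j)) *
      ((u - x) * ∑ i, b i / (u - τ i))) (𝓝[≠] x) (𝓝 ((x ^ 2 - 1) * (∑ j, a j / (x - γ j)) *
        (∑ i, if τ i = x then b i else 0))) := by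
    refine Tendsto.mul (Tendsto.mono_left ?_ nhdsWithin_le_nhds) (tendsto_sub_mul_stieltjes b τ x)
    exact Tendsto.mul ((by fun_prop : Continuous fun u : ℝ => u ^ 2 - 1).tendsto x)
      (continuousAt_stieltjes a γ hx)
  have h2 : Tendsto (fun u => u - x) (𝓝[≠] x) (𝓝 0) := by
    have := ((by fun_prop : Continuous fun u : ℝ => u - x).tendsto x).mono_left
      (nhdsWithin_le_nhds (s := {x}ᶜ))
    simpa using this
  refine tendsto_nhds_unique h1 (h2.congr' ?_)
  filter_upwards [eventually_ne_of_finite γ x, eventually_ne_of_finite τ x] with u hu hu'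
  linear_combination (x - u) * stieltjes_identity_extend hγ hτ h hu hu'

/-- Atoms of both measures at 1 would give a double pole, against the simple zero of u² - 1. As the
level 1 carries mass, the search operator has none at phase 0. -/
theorem dual_mass_one_mul_eq_zero :
    (∑ j, if γ j = 1 then a j else 0) * (∑ i, if τ i = 1 then b i else 0) = 0 := by
  have h1 := ((tendsto_sub_mul_stieltjes a γ 1).mul (tendsto_sub_mul_stieltjes b τ 1)).mul
    (((by fun_prop : Continuous fun u : ℝ => u + 1).tendsto 1).mono_left
      (nhdsWithin_le_nhds (s := {1}ᶜ)))
  have h2 : Tendsto (fun u : ℝ => u - 1) (𝓝[≠] 1) (𝓝 0) := by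
    have := ((by fun_prop : Continuous fun u : ℝ => u - 1).tendsto 1).mono_left
      (nhdsWithin_le_nhds (s := {1}ᶜ))
    simpa using this
  have h3 := tendsto_nhds_unique h1 (h2.congr' ?_)
  · linarith
  · filter_upwards [eventually_ne_of_finite γ 1, eventually_ne_of_finite τ 1] with u hu hu'
    linear_combination (1 - u) * stieltjes_identity_extend hγ hτ h hu hu'

/-- The residue at a zero is governed by the reciprocal of the derivative. Since the transform
vanishes at x, its difference quotient is exactly the sum of a/((u - γ)(x - γ)) up to sign, and no
differentiation is needed. -/
theorem dual_mass_root {x : ℝ} (hx : ∀ j, x ≠ γ j) (h0 : ∑ j, a j / (x - γ j) = 0) :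
    (1 - x ^ 2) * (∑ j, a j / (x - γ j) ^ 2) * (∑ i, if τ i = x then b i else 0) = 1 := by
  have hcont : ContinuousAt (fun u => ∑ j, a j / ((u - γ j) * (x - γ j))) x := by
    refine tendsto_finsetSum _ fun j _ => ?_
    have := sub_ne_zero.2 (hx j)
    exact ContinuousAt.div (by fun_prop) (by fun_prop) (mul_ne_zero this this)
  have h1 : Tendsto (fun u => (1 - u ^ 2) * (∑ j, a j / ((u - γ j) * (x - γ j))) *
      ((u - x) * ∑ i, b i / (u - τ i))) (𝓝[≠] x) (𝓝 ((1 - x ^ 2) *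
        (∑ j, a j / ((x - γ j) * (x - γ j))) * (∑ i, if τ i = x then b i else 0))) := by
    refine Tendsto.mul (Tendsto.mono_left ?_ nhdsWithin_le_nhds) (tendsto_sub_mul_stieltjes b τ x)
    exact Tendsto.mul ((by fun_prop : Continuous fun u : ℝ => 1 - u ^ 2).tendsto x) hcont
  have h3 := tendsto_nhds_unique h1 ((tendsto_const_nhds (x := (1 : ℝ))).congr' ?_)
  · simpa only [sq] using h3
  · filter_upwards [eventually_ne_of_finite γ x, eventually_ne_of_finite τ x] with u hu hu'
    have e : ∑ j, a j / (u - γ j) = (x - u) * ∑ j, a j / ((u - γ j) * (x - γ j)) := by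
      rw [← sub_zero (∑ j, a j / (u - γ j)), ← h0, ← Finset.sum_sub_distrib, Finset.mul_sum]
      refine Finset.sum_congr rfl fun j _ => ?_
      have h5 := sub_ne_zero.2 (hx j)
      have h6 := sub_ne_zero.2 (hu j)
      field_simp
      ring
    have h4 := stieltjes_identity_extend hγ hτ h hu hu'
    rw [e] at h4
    linear_combination -h4

omit hγ in
-- An atom b with τ ≥ 1 - ε contributes at least b/(2ε) to the dual transform at 1 + ε. There the
-- identity bounds that transform by 1/(2εA), where A is the first transform, because u² - 1 ≥ 2ε.
theorem dual_mass_near_one (hb : ∀ i, 0 ≤ b i) (ha : ∀ u, 1 < u → 0 < ∑ j, a j / (u - γ j))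
    {ε : ℝ} (hε : 0 < ε) :
    (∑ i, if 1 - ε ≤ τ i then b i else 0) ≤ 1 / ∑ j, a j / (1 + ε - γ j) := by
  have h1 := h (1 + ε) (by linarith)
  have hA := ha (1 + ε) (by linarith)
  have h2 : (∑ i, if 1 - ε ≤ τ i then b i else 0) / (2 * ε) ≤ ∑ i, b i / (1 + ε - τ i) := by
    rw [Finset.sum_div]
    refine Finset.sum_le_sum fun i _ => ?_
    have h3 : 0 < 1 + ε - τ i := by linarith [hτ i]
    split_ifs with h4
    · exact div_le_div_of_nonneg_left (hb i) h3 (by linarith)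
    · rw [zero_div]
      exact div_nonneg (hb i) h3.le
  rw [le_div_iff₀ hA]
  rw [div_le_iff₀ (by positivity)] at h2
  set B := ∑ i, b i / (1 + ε - τ i)
  set A := ∑ j, a j / (1 + ε - γ j)
  have hB : 0 ≤ B := Finset.sum_nonneg fun i _ => div_nonneg (hb i) (by linarith [hτ i])
  have : (∑ i, if 1 - ε ≤ τ i then b i else 0) * A ≤ B * (2 * ε) * A := by gcongr
  nlinarith [mul_nonneg (mul_nonneg hB hA.le) (sq_nonneg ε)]

end Duality

/-- The Dirichlet kernel, in product form so that sin(α/2) = 0 needs no exception. -/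
theorem one_add_two_mul_sum_cos (t : ℕ) (α : ℝ) :
    Real.sin (α / 2) * (1 + 2 * ∑ s ∈ Finset.range t, Real.cos ((s + 1 : ℕ) * α)) =
      Real.sin ((t + 1 / 2) * α) := by
  induction t with
  | zero => simp [div_eq_inv_mul]
  | succ t ih =>
    rw [Finset.sum_range_succ]
    have h1 := Real.sin_sub_sin (((t + 1 : ℕ) + 1 / 2) * α) ((t + 1 / 2) * α)
    have e1 : ((((t + 1 : ℕ) : ℝ) + 1 / 2) * α - (t + 1 / 2) * α) / 2 = α / 2 := by
      push_cast; ring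
    have e2 : ((((t + 1 : ℕ) : ℝ) + 1 / 2) * α + (t + 1 / 2) * α) / 2 = (t + 1 : ℕ) * α := by
      push_cast; ring
    rw [e1, e2] at h1
    linear_combination ih - h1

theorem sin_half_arccos {x : ℝ} (h1 : -1 ≤ x) (h2 : x ≤ 1) :
    Real.sin (Real.arccos x / 2) = Real.sqrt ((1 - x) / 2) := by
  have h3 := Real.arccos_nonneg x
  have h4 := Real.arccos_le_pi x
  rw [Real.sin_half_eq_sqrt h3 (by linarith [Real.pi_pos]), Real.cos_arccos h1 h2]

end StieltjesTransforms

/-! ### The zero next to the double pole at 1. -/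

section RootOfTransform

variable {ι : Type*} [Fintype ι] {γ : ι → ℝ} {g : ℝ}

/-- The sum of `1 / (1 - γ)` over the `γ ≠ 1`. -/
noncomputable def deflatedSum (γ : ι → ℝ) : ℝ := ∑ j, if γ j = 1 then 0 else 1 / (1 - γ j)

theorem stieltjes_split (hcard : (∑ j, if γ j = 1 then (1 : ℝ) else 0) = 2) (x : ℝ) :
    ∑ j, 1 / (1 - x - γ j) = -(2 / x) + ∑ j, if γ j = 1 then 0 else 1 / (1 - x - γ j) := by
  rw [← hcard, Finset.sum_div, ← Finset.sum_neg_distrib, ← Finset.sum_add_distrib]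
  refine Finset.sum_congr rfl fun j _ => ?_
  split_ifs with h
  · rw [h, add_zero, sub_sub_cancel_left, div_neg]
  · simp

/-- Each summand decreases strictly on (1 - g, 1), whether its pole lies to the left or is the pole
at 1. This gives uniqueness of the zero in the gap. -/
theorem stieltjes_strictAnti (hgap : ∀ j, γ j = 1 ∨ γ j ≤ 1 - g) [Nonempty ι] {u v : ℝ}
    (hu : 1 - g < u) (huv : u < v) (hv : v < 1) :
    ∑ j, 1 / (v - γ j) < ∑ j, 1 / (u - γ j) := by
  refine Finset.sum_lt_sum_of_nonempty Finset.univ_nonempty fun j _ => ?_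
  rcases hgap j with h | h
  · exact one_div_lt_one_div_of_neg_of_lt (by linarith) (by linarith)
  · exact one_div_lt_one_div_of_lt (by linarith) (by linarith)

/-- The double pole contributes -2/x, the other points a sum between S and S/(1 - x/g). Solving 2/x
= S and 2/x = S/(1 - x/g) gives the two endpoints for the intermediate value theorem. -/
theorem exists_stieltjes_root (hg : 0 < g) (hgap : ∀ j, γ j = 1 ∨ γ j ≤ 1 - g)
    (hcard : (∑ j, if γ j = 1 then (1 : ℝ) else 0) = 2) (hS : 2 / g < deflatedSum γ) :
    ∃ x, 2 / (deflatedSum γ + 2 / g) ≤ x ∧ x ≤ 2 / deflatedSum γ ∧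
      ∑ j, 1 / (1 - x - γ j) = 0 := by
  set S := deflatedSum γ with hSdef
  have hg2 : 0 < 2 / g := by positivity
  have hS0 : 0 < S := by linarith
  have hx2 : 2 / S < g := by
    rw [div_lt_iff₀ hS0]
    rw [div_lt_iff₀ hg] at hS
    linarith
  have hx12 : 2 / (S + 2 / g) ≤ 2 / S := by gcongr; linarith
  have hcont : ContinuousOn (fun x => ∑ j, 1 / (1 - x - γ j))
      (Set.Icc (2 / (S + 2 / g)) (2 / S)) := by
    refine continuousOn_finsetSum _ fun j _ => ContinuousOn.div (by fun_prop) (by fun_prop) ?_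
    intro x hx
    have hx0 : 0 < x := lt_of_lt_of_le (by positivity) hx.1
    rcases hgap j with h | h
    · rw [h]
      linarith
    · linarith [hx.2]
  have hleft : ∑ j, 1 / (1 - 2 / (S + 2 / g) - γ j) ≤ 0 := by
    set x := 2 / (S + 2 / g) with hx
    have hx0 : 0 < x := by positivity
    have hxg : x < g := lt_of_le_of_lt hx12 hx2
    have h1 : (∑ j, if γ j = 1 then 0 else 1 / (1 - x - γ j)) ≤ S / (1 - x / g) := by
      rw [hSdef, deflatedSum, Finset.sum_div]
      refine Finset.sum_le_sum fun j _ => ?_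
      split_ifs with h
      · simp
      · have h2 := (hgap j).resolve_left h
        have h3 : 0 < 1 - x / g := by
          rw [sub_pos, div_lt_one hg]
          exact hxg
        have h4 : 0 < 1 - γ j := by linarith
        rw [div_div]
        apply one_div_le_one_div_of_le (by positivity)
        have : x ≤ (1 - γ j) * (x / g) := by
          rw [mul_div_assoc', le_div_iff₀ hg]
          nlinarith
        linarith
    rw [stieltjes_split hcard]
    have h3 : 0 < 1 - x / g := by
      rw [sub_pos, div_lt_one hg]
      exact hxg
    have h4 : S / (1 - x / g) = 2 / x := by
      rw [div_eq_div_iff h3.ne' hx0.ne', hx]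
      field_simp
      ring
    linarith
  have hright : 0 ≤ ∑ j, 1 / (1 - 2 / S - γ j) := by
    have h1 : S ≤ ∑ j, if γ j = 1 then 0 else 1 / (1 - 2 / S - γ j) := by
      rw [hSdef, deflatedSum, ← deflatedSum, ← hSdef]
      refine Finset.sum_le_sum fun j _ => ?_
      split_ifs with h
      · rfl
      · have h2 := (hgap j).resolve_left h
        have : 0 < 2 / S := by positivity
        exact one_div_le_one_div_of_le (by linarith) (by linarith)
    rw [stieltjes_split hcard]
    have : 2 / (2 / S) = S := by field_simp
    linarith
  obtain ⟨x, hx, hx0⟩ := intermediate_value_Icc hx12 hcont ⟨hleft, hright⟩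
  exact ⟨x, hx.1, hx.2, hx0⟩

/-- At the root, the points away from `1` contribute little to the derivative. -/
theorem stieltjes_deriv_bounds (hgap : ∀ j, γ j = 1 ∨ γ j ≤ 1 - g)
    (hcard : (∑ j, if γ j = 1 then (1 : ℝ) else 0) = 2) {x : ℝ} (hx0 : 0 < x) (hxg : x < g)
    (hx : ∑ j, 1 / (1 - x - γ j) = 0) :
    2 ≤ x ^ 2 * ∑ j, 1 / (1 - x - γ j) ^ 2 ∧
      x ^ 2 * ∑ j, 1 / (1 - x - γ j) ^ 2 ≤ 2 + 2 * x / (g - x) := by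
  have e : x ^ 2 * ∑ j, 1 / (1 - x - γ j) ^ 2 =
      2 + x ^ 2 * ∑ j, if γ j = 1 then 0 else 1 / (1 - x - γ j) ^ 2 := by
    rw [← hcard, Finset.mul_sum, Finset.mul_sum, ← Finset.sum_add_distrib]
    refine Finset.sum_congr rfl fun j _ => ?_
    split_ifs with h
    · rw [h, sub_sub_cancel_left, neg_sq, mul_one_div_cancel (by positivity), mul_zero, add_zero]
    · simp
  rw [stieltjes_split hcard] at hx
  have hgx : 0 < g - x := by linarith
  -- One factor of each square is bounded through the gap; the sum of the other is exactly 2/x by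
  -- the root equation.
  have hQ : (∑ j, if γ j = 1 then 0 else 1 / (1 - x - γ j) ^ 2) ≤ (2 / x) / (g - x) := by
    have : 2 / x = ∑ j, if γ j = 1 then 0 else 1 / (1 - x - γ j) := by linarith
    rw [this, Finset.sum_div]
    refine Finset.sum_le_sum fun j _ => ?_
    split_ifs with h
    · simp
    · have h2 := (hgap j).resolve_left h
      rw [div_div, sq]
      have h3 : 0 < 1 - x - γ j := by linarith
      refine one_div_le_one_div_of_le (by positivity) ?_
      exact mul_le_mul_of_nonneg_left (by linarith) h3.le
  rw [e]
  constructor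
  · have : 0 ≤ ∑ j, if γ j = 1 then 0 else 1 / (1 - x - γ j) ^ 2 :=
      Finset.sum_nonneg fun j _ => by split_ifs <;> positivity
    nlinarith [mul_nonneg (sq_nonneg x) this]
  · have h4 : x ^ 2 * ((2 / x) / (g - x)) = 2 * x / (g - x) := by field_simp
    rw [← h4]
    gcongr

end RootOfTransform
-- Sums over one momentum in closed form.
section RowSums

variable {n : ℕ} [NeZero n]

theorem sum_stdAddChar_pow {m : ℕ} (h0 : m ≠ 0) (hm : m < n) :
    ∑ l : ZMod n, (ZMod.stdAddChar l : ℂ) ^ m = 0 := by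
  have h := AddChar.sum_mulShift (m : ZMod n) (ZMod.isPrimitive_stdAddChar n)
  rw [if_neg] at h
  · rw [Nat.cast_zero] at h
    rw [← h]
    refine Finset.sum_congr rfl fun l _ => ?_
    rw [← AddChar.map_nsmul_eq_pow, nsmul_eq_mul, mul_comm]
  · rw [ZMod.natCast_eq_zero_iff]
    exact fun hd => absurd (Nat.le_of_dvd (Nat.pos_of_ne_zero h0) hd) (by omega)

theorem stdAddChar_pow_self (l : ZMod n) : (ZMod.stdAddChar l : ℂ) ^ n = 1 := by
  rw [← AddChar.map_nsmul_eq_pow, nsmul_eq_mul, ZMod.natCast_self, zero_mul,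
    AddChar.map_zero_eq_one]

/-- Since ωⁿ = 1, the geometric series closes after n terms; summed over all roots of unity, only
the constant term survives. -/
theorem sum_one_div_one_sub_stdAddChar {r : ℝ} (hr : |r| < 1) :
    ∑ l : ZMod n, 1 / (1 - (r : ℂ) * ZMod.stdAddChar l) = n / (1 - (r : ℂ) ^ n) := by
  have hn0 : n ≠ 0 := NeZero.ne n
  have hrn : (1 - (r : ℂ) ^ n) ≠ 0 := by
    intro h
    have h1 : ‖(r : ℂ) ^ n‖ = 1 := by
      rw [← sub_eq_zero.1 h, norm_one]
    rw [norm_pow, Complex.norm_real, Real.norm_eq_abs] at h1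
    exact absurd h1 (pow_lt_one₀ (abs_nonneg r) hr hn0).ne
  have hterm (l : ZMod n) : 1 / (1 - (r : ℂ) * ZMod.stdAddChar l) =
      (∑ m ∈ Finset.range n, (r : ℂ) ^ m * (ZMod.stdAddChar l : ℂ) ^ m) / (1 - (r : ℂ) ^ n) := by
    have hg := mul_neg_geom_sum ((r : ℂ) * ZMod.stdAddChar l) n
    rw [mul_pow, stdAddChar_pow_self, mul_one] at hg
    have h1 : 1 - (r : ℂ) * ZMod.stdAddChar l ≠ 0 := by
      intro h
      rw [h, zero_mul] at hg
      exact hrn hg.symm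
    rw [div_eq_div_iff h1 hrn, one_mul, ← hg, mul_comm]
    simp only [mul_pow]
  simp only [hterm, ← Finset.sum_div]
  congr 1
  rw [Finset.sum_comm, Finset.sum_eq_single 0]
  · simp [ZMod.card]
  · intro m hm h0
    rw [← Finset.mul_sum, sum_stdAddChar_pow h0 (Finset.mem_range.1 hm), mul_zero]
  · intro h
    exact absurd (Finset.mem_range.2 (Nat.pos_of_ne_zero hn0)) h

/-- The sum of `1 / (u - c cos l)` over the `n`-th roots of unity. -/
theorem sum_one_div_sub_mul_cosMod {u c w : ℝ} (hu : 0 < u) (hw : 0 < w)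
    (hwu : w ^ 2 = u ^ 2 - c ^ 2) :
    ∑ l : ZMod n, 1 / (u - c * cosMod l) =
      n / w * ((1 + (c / (u + w)) ^ n) / (1 - (c / (u + w)) ^ n)) := by
  -- Chosen so that u - c cos l = ((u + w)/2)|1 - r e^{il}|², which makes the summand a Poisson
  -- kernel.
  set r := c / (u + w) with hr
  have huw : 0 < u + w := by positivity
  have hrc : c = r * (u + w) := by rw [hr]; field_simp
  have hcu : |c| < u := abs_lt_of_sq_lt_sq (by nlinarith) hu.le
  have hr1 : |r| < 1 := by
    rw [hr, abs_div, abs_of_pos huw, div_lt_one huw]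
    linarith
  have hrn : 1 - r ^ n ≠ 0 := by
    have := (abs_lt.1 (show |r ^ n| < 1 by
      rw [abs_pow]; exact pow_lt_one₀ (abs_nonneg r) hr1 (NeZero.ne n))).2
    linarith
  have h2 : r ^ 2 * (u + w) = u - w := by
    have h1 : (r * (u + w)) ^ 2 = (u - w) * (u + w) := by
      rw [← hrc]
      linarith
    exact mul_right_cancel₀ huw.ne' (by linarith)
  clear_value r
  have hterm (l : ZMod n) : 1 / (u - c * cosMod l) =
      (2 * (1 / (1 - (r : ℂ) * ZMod.stdAddChar l)).re - 1) / w := by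
    have hunit : (ZMod.stdAddChar l : ℂ).re ^ 2 + (ZMod.stdAddChar l : ℂ).im ^ 2 = 1 := by
      rw [stdAddChar_eq_exp, Complex.exp_ofReal_mul_I_re, Complex.exp_ofReal_mul_I_im]
      exact Real.cos_sq_add_sin_sq _
    have hC : |cosMod l| ≤ 1 := abs_cosMod_le_one l
    have hcC : |c * cosMod l| < u := by
      rw [abs_mul]
      exact (mul_le_of_le_one_right (abs_nonneg c) hC).trans_lt hcu
    have hne : u - c * cosMod l ≠ 0 := by linarith [(abs_lt.1 hcC).2]
    rw [one_div (1 - (r : ℂ) * ZMod.stdAddChar l), Complex.inv_re, Complex.normSq_apply]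
    simp only [Complex.sub_re, Complex.sub_im, Complex.one_re, Complex.one_im, Complex.re_ofReal_mul,
      Complex.im_ofReal_mul]
    rw [← cosMod] at hunit ⊢
    have hden : (1 - r * cosMod l) * (1 - r * cosMod l) + (0 - r * (ZMod.stdAddChar l : ℂ).im) *
        (0 - r * (ZMod.stdAddChar l : ℂ).im) = 2 * (u - c * cosMod l) / (u + w) := by
      rw [eq_div_iff huw.ne', hrc]
      linear_combination r ^ 2 * (u + w) * hunit + h2
    have hnum : 1 - r * cosMod l = (u - c * cosMod l + w) / (u + w) := by
      rw [eq_div_iff huw.ne']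
      linear_combination cosMod l * hrc
    rw [hden, hnum]
    field_simp
    ring
  have hsum := congrArg Complex.re (sum_one_div_one_sub_stdAddChar (n := n) hr1)
  rw [Complex.re_sum] at hsum
  have hright : ((n : ℂ) / (1 - (r : ℂ) ^ n)).re = n / (1 - r ^ n) := by
    rw [show (n : ℂ) / (1 - (r : ℂ) ^ n) = ((n / (1 - r ^ n) : ℝ) : ℂ) by push_cast; rfl,
      Complex.ofReal_re]
  rw [hright] at hsum
  simp only [hterm, ← Finset.sum_div, Finset.sum_sub_distrib, ← Finset.mul_sum, hsum]
  simp only [Finset.sum_const, Finset.card_univ, ZMod.card, nsmul_eq_mul, mul_one]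
  field_simp
  ring

/-- For even n, rⁿ ≥ 0 whatever the sign of c, so the correction factor (1 + rⁿ)/(1 - rⁿ) is at
least 1. -/
theorem le_sum_one_div_sub_mul_cosMod (hn : Even n) {u c w : ℝ} (hu : 0 < u) (hw : 0 < w)
    (hwu : w ^ 2 = u ^ 2 - c ^ 2) :
    n / w ≤ ∑ l : ZMod n, 1 / (u - c * cosMod l) := by
  rw [sum_one_div_sub_mul_cosMod hu hw hwu]
  have hr1 : |c / (u + w)| < 1 := by
    have hcu : |c| < u := abs_lt_of_sq_lt_sq (by nlinarith) hu.le
    rw [abs_div, abs_of_pos (by positivity : 0 < u + w), div_lt_one (by positivity)]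
    linarith
  have h1 : (c / (u + w)) ^ n < 1 := by
    rw [← hn.pow_abs]
    exact pow_lt_one₀ (abs_nonneg _) hr1 (NeZero.ne n)
  have h0 : 0 ≤ (c / (u + w)) ^ n := hn.pow_nonneg _
  refine le_mul_of_one_le_right (by positivity) ?_
  rw [one_le_div (by linarith)]
  linarith

/-- Bernoulli's inequality gives rⁿ ≤ 1/(1 + nw), which caps the correction factor at 1 + 2/(nw). -/
theorem sum_one_div_one_sub_mul_cosMod_le (hn : Even n) {c w : ℝ} (hw : 0 < w)
    (hwu : w ^ 2 = 1 - c ^ 2) :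
    ∑ l : ZMod n, 1 / (1 - c * cosMod l) ≤ n / w + 2 / w ^ 2 := by
  rw [sum_one_div_sub_mul_cosMod one_pos hw (by rw [hwu, one_pow])]
  have hn0 : (0 : ℝ) < n := by exact_mod_cast NeZero.pos n
  have hc : |c| ≤ 1 := abs_le_of_sq_le_sq' (by nlinarith) zero_le_one |> abs_le.2
  have h1 : (c / (1 + w)) ^ n ≤ 1 / (1 + n * w) := by
    rw [← hn.pow_abs, abs_div, abs_of_pos (by positivity : 0 < 1 + w)]
    calc (|c| / (1 + w)) ^ n ≤ (1 / (1 + w)) ^ n := by gcongr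
      _ = 1 / (1 + w) ^ n := by rw [div_pow, one_pow]
      _ ≤ 1 / (1 + n * w) := by
        apply one_div_le_one_div_of_le (by positivity)
        exact one_add_mul_le_pow (by linarith) n
  have h0 : 0 ≤ (c / (1 + w)) ^ n := hn.pow_nonneg _
  set q := (c / (1 + w)) ^ n
  have hnw : 0 < n * w := by positivity
  have hq : q * (1 + n * w) ≤ 1 := (le_div_iff₀ (by positivity)).1 h1
  have hq1 : 0 < 1 - q := by nlinarith
  have : (1 + q) / (1 - q) ≤ 1 + 2 / (n * w) := by
    rw [div_le_iff₀ hq1, ← sub_nonneg]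
    have : (1 + 2 / (n * w)) * (1 - q) - (1 + q) = 2 * (1 - q * (1 + n * w)) / (n * w) := by
      field_simp
      ring
    rw [this]
    exact div_nonneg (by linarith) hnw.le
  calc n / w * ((1 + q) / (1 - q)) ≤ n / w * (1 + 2 / (n * w)) := by gcongr
    _ = n / w + 2 / w ^ 2 := by field_simp

end RowSums

/-! ### Sums of 1/sin and 1/sin² over equally spaced points. -/

section TrigSums

theorem half_le_sin {x : ℝ} (h0 : 0 ≤ x) (hx : x ≤ Real.pi / 2) : x / 2 ≤ Real.sin x := by
  refine le_trans ?_ (Real.mul_le_sin h0 hx)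
  rw [div_eq_mul_inv, mul_comm]
  gcongr
  rw [le_div_iff₀ Real.pi_pos]
  linarith [Real.pi_le_four]

/-- Both poles of 1/sin are subtracted; the symmetry x ↦ π - x reduces the estimate to (0, π/2]. -/
theorem abs_one_div_sin_sub_le {x : ℝ} (h0 : 0 < x) (hπ : x < Real.pi) :
    |1 / Real.sin x - (1 / x + 1 / (Real.pi - x))| ≤ 1 := by
  have half (y : ℝ) (h0 : 0 < y) (hy : y ≤ Real.pi / 2) :
      |1 / Real.sin y - (1 / y + 1 / (Real.pi - y))| ≤ 1 := by
    have hp := Real.pi_gt_three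
    have hp4 := Real.pi_le_four
    have hs : 0 < Real.sin y := Real.sin_pos_of_pos_of_lt_pi h0 (by linarith)
    have h1 := half_le_sin h0.le hy
    have h2 := Real.sin_gt_sub_cube h0
    have h3 : 1 / (Real.pi - y) ≤ 1 := by
      rw [div_le_one (by linarith)]
      linarith
    have h3' : 0 < 1 / (Real.pi - y) := one_div_pos.2 (by linarith)
    have h4 : 1 / Real.sin y - 1 / y = (y - Real.sin y) / (y * Real.sin y) := by
      field_simp
    have h5 : (y - Real.sin y) / (y * Real.sin y) ≤ 1 := by
      rw [div_le_one (by positivity)]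
      nlinarith [mul_le_mul_of_nonneg_left h1 h0.le, mul_pos h0 h0]
    have h6 : 0 ≤ (y - Real.sin y) / (y * Real.sin y) :=
      div_nonneg (by linarith [Real.sin_lt h0]) (by positivity)
    rw [abs_le]
    constructor <;> linarith
  rcases le_total x (Real.pi / 2) with h | h
  · exact half x h0 h
  · have := half (Real.pi - x) (by linarith) (by linarith)
    rw [Real.sin_pi_sub, sub_sub_cancel, add_comm] at this
    exact this

theorem one_div_sin_sq_le {x : ℝ} (h0 : 0 < x) (hπ : x < Real.pi) :
    1 / Real.sin x ^ 2 ≤ Real.pi ^ 2 / 4 * (1 / x ^ 2 + 1 / (Real.pi - x) ^ 2) := by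
  have half (y : ℝ) (h0 : 0 < y) (hy : y ≤ Real.pi / 2) :
      1 / Real.sin y ^ 2 ≤ Real.pi ^ 2 / 4 * (1 / y ^ 2 + 1 / (Real.pi - y) ^ 2) := by
    have h1 := Real.mul_le_sin h0.le hy
    have hp := Real.pi_pos
    calc 1 / Real.sin y ^ 2 ≤ 1 / (2 / Real.pi * y) ^ 2 := by gcongr
      _ = Real.pi ^ 2 / 4 * (1 / y ^ 2) := by
        field_simp
        norm_num
      _ ≤ _ := by
        gcongr
        exact le_add_of_nonneg_right (by positivity)
  rcases le_total x (Real.pi / 2) with h | h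
  · exact half x h0 h
  · have := half (Real.pi - x) (by linarith) (by linarith)
    rw [Real.sin_pi_sub, sub_sub_cancel, add_comm] at this
    exact this

theorem log_div_le_sum_Ico {a b : ℕ} (ha : 0 < a) (hab : a ≤ b) :
    Real.log (b / a) ≤ ∑ j ∈ Finset.Ico a b, 1 / (j : ℝ) := by
  have ha' : (0 : ℝ) < a := by exact_mod_cast ha
  induction b, hab using Nat.le_induction with
  | base => simp [ha'.ne']
  | succ b hb ih =>
    have hb' : (0 : ℝ) < b := by exact_mod_cast (by omega : 0 < b)
    rw [Finset.sum_Ico_succ_top hb]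
    have h1 : Real.log ((b + 1 : ℕ) / a) = Real.log (b / a) + Real.log (1 + 1 / b) := by
      rw [← Real.log_mul (by positivity) (by positivity)]
      congr 1
      push_cast
      field_simp
    have h2 := Real.log_le_sub_one_of_pos (by positivity : (0 : ℝ) < 1 + 1 / b)
    linarith

theorem sum_Ico_le_one_add_log (b : ℕ) :
    ∑ j ∈ Finset.Ico 1 b, 1 / (j : ℝ) ≤ 1 + Real.log b := by
  have h := harmonic_le_one_add_log b
  rw [harmonic_eq_sum_Icc] at h
  push_cast at h
  refine le_trans ?_ h
  simp only [one_div]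
  refine Finset.sum_le_sum_of_subset_of_nonneg ?_ fun j _ _ => by positivity
  intro j hj
  rw [Finset.mem_Ico] at hj
  rw [Finset.mem_Icc]
  omega

theorem sum_Ico_comp_sub (f : ℕ → ℝ) (h : ℕ) :
    ∑ j ∈ Finset.Ico 1 h, f (h - j) = ∑ j ∈ Finset.Ico 1 h, f j := by
  have := Finset.sum_Ico_reflect f 1 (m := h) (n := h) (by omega)
  rw [this]
  congr 2
  omega

theorem pi_mul_div_mem {h j : ℕ} (hj : j ∈ Finset.Ico 1 h) :
    0 < Real.pi * j / h ∧ Real.pi * j / h < Real.pi ∧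
      Real.pi - Real.pi * j / h = Real.pi * (h - j : ℕ) / h := by
  rw [Finset.mem_Ico] at hj
  have h1 : (0 : ℝ) < j := by exact_mod_cast (by omega : 0 < j)
  have h2 : (j : ℝ) < h := by exact_mod_cast hj.2
  have h3 : (0 : ℝ) < h := h1.trans h2
  have hp := Real.pi_pos
  refine ⟨by positivity, ?_, ?_⟩
  · rw [div_lt_iff₀ h3]
    gcongr
  · rw [Nat.cast_sub hj.2.le]
    field_simp

theorem sum_Ico_comp_pi_sub (f : ℝ → ℝ) (h : ℕ) :
    ∑ j ∈ Finset.Ico 1 h, f (Real.pi - Real.pi * j / h) =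
      ∑ j ∈ Finset.Ico 1 h, f (Real.pi * j / h) := by
  rw [← sum_Ico_comp_sub fun j => f (Real.pi * j / h)]
  exact Finset.sum_congr rfl fun j hj => by rw [(pi_mul_div_mem hj).2.2]

theorem abs_sum_one_div_sin_sub_le (h : ℕ) :
    |∑ j ∈ Finset.Ico 1 h, 1 / Real.sin (Real.pi * j / h) -
      2 * h / Real.pi * ∑ j ∈ Finset.Ico 1 h, 1 / (j : ℝ)| ≤ h := by
  have e : 2 * h / Real.pi * ∑ j ∈ Finset.Ico 1 h, 1 / (j : ℝ) =
      ∑ j ∈ Finset.Ico 1 h, (1 / (Real.pi * j / h) + 1 / (Real.pi - Real.pi * j / h)) := by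
    rw [Finset.sum_add_distrib, sum_Ico_comp_pi_sub fun x => 1 / x, ← two_mul, mul_div_assoc,
      mul_assoc, Finset.mul_sum]
    congr 1
    refine Finset.sum_congr rfl fun j _ => ?_
    rw [one_div_div, div_mul_div_comm, mul_one]
  rw [e, ← Finset.sum_sub_distrib]
  refine (Finset.abs_sum_le_sum_abs _ _).trans ?_
  refine (Finset.sum_le_sum fun j hj => abs_one_div_sin_sub_le (pi_mul_div_mem hj).1
    (pi_mul_div_mem hj).2.1).trans ?_
  simp only [Finset.sum_const, Nat.card_Ico, nsmul_eq_mul, mul_one]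
  exact_mod_cast Nat.sub_le h 1

theorem sum_one_div_sin_sq_le (h : ℕ) :
    ∑ j ∈ Finset.Ico 1 h, 1 / Real.sin (Real.pi * j / h) ^ 2 ≤ (h : ℝ) ^ 2 := by
  have hp := Real.pi_pos
  refine (Finset.sum_le_sum fun j hj => one_div_sin_sq_le (pi_mul_div_mem hj).1
    (pi_mul_div_mem hj).2.1).trans ?_
  rw [← Finset.mul_sum, Finset.sum_add_distrib,
    sum_Ico_comp_pi_sub fun x => 1 / x ^ 2]
  have h1 : ∑ j ∈ Finset.Ico 1 h, 1 / (Real.pi * j / h) ^ 2 =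
      (h : ℝ) ^ 2 / Real.pi ^ 2 * ∑ j ∈ Finset.Ioo 0 h, ((j : ℝ) ^ 2)⁻¹ := by
    rw [Finset.mul_sum]
    refine Finset.sum_congr rfl fun j _ => ?_
    rw [div_pow, mul_pow, one_div_div]
    field_simp
  have h2 := sum_Ioo_inv_sq_le (α := ℝ) 0 h
  rw [h1]
  calc Real.pi ^ 2 / 4 * ((h : ℝ) ^ 2 / Real.pi ^ 2 * ∑ j ∈ Finset.Ioo 0 h, ((j : ℝ) ^ 2)⁻¹ +
      (h : ℝ) ^ 2 / Real.pi ^ 2 * ∑ j ∈ Finset.Ioo 0 h, ((j : ℝ) ^ 2)⁻¹)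
      = (h : ℝ) ^ 2 / 2 * ∑ j ∈ Finset.Ioo 0 h, ((j : ℝ) ^ 2)⁻¹ := by field_simp; ring
    _ ≤ (h : ℝ) ^ 2 / 2 * 2 := by
      gcongr
      simpa using h2
    _ = (h : ℝ) ^ 2 := by ring

end TrigSums
-- Spectral gap, multiplicity of the top level and size of the lattice sums.
section LevelSums

variable {n : ℕ} [NeZero n] {h : ℕ}

theorem sum_zmod_eq_sum_range (G : ZMod n → ℝ) :
    ∑ k, G k = ∑ j ∈ Finset.range n, G (j : ZMod n) := by
  refine Finset.sum_nbij' (fun k => k.val) (fun j => (j : ZMod n)) ?_ ?_ ?_ ?_ ?_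
  · exact fun k _ => Finset.mem_range.2 (ZMod.val_lt k)
  · exact fun j _ => Finset.mem_univ _
  · exact fun k _ => ZMod.natCast_zmod_val k
  · exact fun j hj => ZMod.val_cast_of_lt (Finset.mem_range.1 hj)
  · exact fun k _ => by rw [ZMod.natCast_zmod_val]

theorem stdAddChar_natCast (j : ℕ) :
    (ZMod.stdAddChar (j : ZMod n) : ℂ) = Complex.exp ((2 * Real.pi * j / n : ℝ) * Complex.I) := by
  have := ZMod.stdAddChar_coe (N := n) (j : ℤ)
  rw [Int.cast_natCast] at this
  rw [this]
  congr 1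
  push_cast
  ring

theorem cosMod_natCast (j : ℕ) : cosMod (j : ZMod n) = Real.cos (2 * Real.pi * j / n) := by
  rw [cosMod, stdAddChar_natCast, Complex.exp_ofReal_mul_I_re]

theorem cosMod_add_half (hn : n = 2 * h) (k : ZMod n) : cosMod (k + (h : ZMod n)) = -cosMod k := by
  have hh : (h : ℝ) ≠ 0 := by
    have := NeZero.ne n
    exact_mod_cast (by omega : h ≠ 0)
  have e : (ZMod.stdAddChar (h : ZMod n) : ℂ) = -1 := by
    rw [stdAddChar_natCast, ← Complex.exp_pi_mul_I]
    congr 3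
    rw [hn]
    push_cast
    field_simp
  rw [cosMod, AddChar.map_add_eq_mul, e, mul_neg_one, Complex.neg_re, cosMod]

theorem cosMod_half (hn : n = 2 * h) : cosMod (h : ZMod n) = -1 := by
  have := cosMod_add_half hn 0
  rwa [zero_add, cosMod_zero] at this

theorem one_sub_cosMod_natCast_sq (hn : n = 2 * h) (j : ℕ) :
    1 - cosMod (j : ZMod n) ^ 2 = Real.sin (Real.pi * j / h) ^ 2 := by
  have hh : (h : ℝ) ≠ 0 := by
    have := NeZero.ne n
    exact_mod_cast (by omega : h ≠ 0)
  rw [cosMod_natCast, Real.sin_sq, hn]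
  congr 3
  push_cast
  field_simp

theorem two_div_le_sin {j : ℕ} (hj : j ∈ Finset.Ico 1 h) :
    2 / h ≤ Real.sin (Real.pi * j / h) := by
  obtain ⟨h1, h2, h3⟩ := pi_mul_div_mem hj
  rw [Finset.mem_Ico] at hj
  have hh : (0 : ℝ) < h := by exact_mod_cast (by omega : 0 < h)
  have key (i : ℕ) (hi : 1 ≤ i) (hx : Real.pi * i / h ≤ Real.pi / 2) :
      2 / h ≤ Real.sin (Real.pi * i / h) := by
    have hi' : (1 : ℝ) ≤ i := by exact_mod_cast hi
    have hp := Real.pi_pos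
    refine le_trans ?_ (Real.mul_le_sin (by positivity) hx)
    have : 2 / Real.pi * (Real.pi * i / h) = 2 * i / h := by field_simp
    rw [this]
    gcongr
    linarith
  rcases le_total (Real.pi * j / h) (Real.pi / 2) with hx | hx
  · exact key j hj.1 hx
  · rw [← Real.sin_pi_sub, h3]
    exact key (h - j) (by omega) (by rw [← h3]; linarith)

theorem natCast_eq_or_mem (hn : n = 2 * h) (k : ZMod n) :
    k = 0 ∨ k = (h : ZMod n) ∨
      ∃ j ∈ Finset.Ico 1 h, 1 - cosMod k ^ 2 = Real.sin (Real.pi * j / h) ^ 2 := by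
  have hv := ZMod.val_lt k
  have hk := ZMod.natCast_zmod_val k
  generalize k.val = v at hv hk
  by_cases h0 : v = 0
  · left
    rw [← hk, h0, Nat.cast_zero]
  by_cases h1 : v = h
  · right; left
    rw [← hk, h1]
  right; right
  rcases lt_or_ge v h with h2 | h2
  · refine ⟨v, Finset.mem_Ico.2 ⟨by omega, h2⟩, ?_⟩
    rw [← hk, one_sub_cosMod_natCast_sq hn]
  · refine ⟨v - h, Finset.mem_Ico.2 ⟨by omega, by omega⟩, ?_⟩
    rw [← one_sub_cosMod_natCast_sq hn, ← hk]
    have : ((v - h : ℕ) : ZMod n) + (h : ZMod n) = v := by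
      rw [← Nat.cast_add]
      congr 1
      omega
    rw [← this, cosMod_add_half hn, neg_sq]

/-- Jordan's inequality gives |sin k| ≥ 2/h = 4/n, so cos² k ≤ 1 - 16/N ≤ (1 - 8/N)². -/
theorem abs_cosMod_le (hn : n = 2 * h) {k : ZMod n} (h0 : k ≠ 0) (h1 : k ≠ (h : ZMod n)) :
    |cosMod k| ≤ 1 - 8 / gridSize n := by
  obtain ⟨j, hj, e⟩ := ((natCast_eq_or_mem hn k).resolve_left h0).resolve_left h1
  have hs := two_div_le_sin hj
  rw [Finset.mem_Ico] at hj
  have hh : (2 : ℝ) ≤ h := by exact_mod_cast (by omega : 2 ≤ h)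
  have hs2 : (2 / h : ℝ) ^ 2 ≤ Real.sin (Real.pi * j / h) ^ 2 :=
    pow_le_pow_left₀ (by positivity) hs 2
  have hg : 8 / gridSize n = (2 / h : ℝ) ^ 2 / 2 := by
    rw [gridSize, hn]
    push_cast
    field_simp
    norm_num
  have hle : (2 / h : ℝ) ^ 2 ≤ 1 := by
    apply pow_le_one₀ (by positivity)
    rw [div_le_one (by positivity)]
    exact hh
  rw [hg]
  apply abs_le_of_sq_le_sq _ (by linarith)
  nlinarith [sq_nonneg ((2 / h : ℝ) ^ 2)]

theorem level_gap (hn : n = 2 * h) (hh : 2 ≤ h) (p : Vertex n) :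
    level p = 1 ∨ level p ≤ 1 - 8 / gridSize n := by
  have hg : 8 / gridSize n ≤ 1 / 2 := by
    rw [gridSize, hn]
    have : (2 : ℝ) ≤ h := by exact_mod_cast hh
    rw [div_le_div_iff₀ (by positivity) two_pos]
    push_cast
    nlinarith
  have key (k l : ZMod n) (h0 : k ≠ 0) (h1 : k ≠ (h : ZMod n)) :
      cosMod k * cosMod l ≤ 1 - 8 / gridSize n := by
    refine (le_abs_self _).trans ?_
    rw [abs_mul]
    exact (mul_le_of_le_one_right (abs_nonneg _) (abs_cosMod_le_one l)).trans
      (abs_cosMod_le hn h0 h1)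
  obtain ⟨k, l⟩ := p
  simp only [level]
  by_cases h0 : k = 0
  · by_cases h2 : l = 0
    · left; rw [h0, h2, cosMod_zero, one_mul]
    · by_cases h3 : l = (h : ZMod n)
      · right; rw [h0, h3, cosMod_zero, cosMod_half hn]; linarith
      · right; rw [mul_comm]; exact key l k h2 h3
  · by_cases h1 : k = (h : ZMod n)
    · by_cases h2 : l = 0
      · right; rw [h1, h2, cosMod_zero, cosMod_half hn]; linarith
      · by_cases h3 : l = (h : ZMod n)
        · left; rw [h1, h3, cosMod_half hn]; norm_num
        · right; rw [mul_comm]; exact key l k h2 h3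
    · right; exact key k l h0 h1

theorem natCast_half_ne_zero (hn : n = 2 * h) : (h : ZMod n) ≠ 0 := by
  intro h0
  have h1 := cosMod_half hn
  rw [h0, cosMod_zero] at h1
  norm_num at h1

/-- Both cosines must be 1 or both -1. The second solution, momentum (π, π), reflects the two
sublattices and is the reason for the 2 in the root equation. -/
theorem level_eq_one_iff (hn : n = 2 * h) (p : Vertex n) :
    level p = 1 ↔ p = (0, 0) ∨ p = ((h : ZMod n), (h : ZMod n)) := by
  have hg : 0 < 8 / gridSize n := div_pos (by norm_num) gridSize_pos
  have key (k l : ZMod n) (h0 : k ≠ 0) (h1 : k ≠ (h : ZMod n)) : cosMod k * cosMod l ≠ 1 := by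
    intro h2
    have h3 := mul_le_of_le_one_right (abs_nonneg (cosMod k)) (abs_cosMod_le_one l)
    rw [← abs_mul, h2, abs_one] at h3
    linarith [abs_cosMod_le hn h0 h1]
  obtain ⟨k, l⟩ := p
  constructor
  · intro hp
    simp only [level] at hp
    have hk : k = 0 ∨ k = (h : ZMod n) := by
      by_contra! hc
      exact key k l hc.1 hc.2 hp
    have hl : l = 0 ∨ l = (h : ZMod n) := by
      by_contra! hc
      rw [mul_comm] at hp
      exact key l k hc.1 hc.2 hp
    rcases hk with rfl | rfl <;> rcases hl with rfl | rfl
    · left; rfl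
    · rw [cosMod_zero, cosMod_half hn] at hp
      norm_num at hp
    · rw [cosMod_zero, cosMod_half hn] at hp
      norm_num at hp
    · right; rfl
  · rintro (hp | hp) <;> rw [hp, level]
    · rw [cosMod_zero, one_mul]
    · rw [cosMod_half hn]
      norm_num

theorem sum_level_eq_one (hn : n = 2 * h) :
    (∑ p : Vertex n, if level p = 1 then (1 : ℝ) else 0) = 2 := by
  have hne : ((0, 0) : Vertex n) ≠ ((h : ZMod n), (h : ZMod n)) := by
    intro h0
    exact natCast_half_ne_zero hn (Prod.mk.inj h0).1.symm
  have e (p : Vertex n) : (if level p = 1 then (1 : ℝ) else 0) =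
      (if p = (0, 0) then 1 else 0) + if p = ((h : ZMod n), (h : ZMod n)) then 1 else 0 := by
    simp only [level_eq_one_iff hn]
    by_cases h1 : p = (0, 0)
    · simp only [h1, true_or, if_true, if_neg hne, add_zero]
    · simp only [h1, false_or, if_false, zero_add]
  simp only [e, Finset.sum_add_distrib, Finset.sum_ite_eq', Finset.mem_univ, if_true]
  norm_num

/-- Sums of functions of `sin² k` over the momenta `k ≠ 0, π`. -/
theorem sum_off_poles (hn : n = 2 * h) (F : ℝ → ℝ) :
    (∑ k : ZMod n, if k = 0 ∨ k = (h : ZMod n) then 0 else F (1 - cosMod k ^ 2)) =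
      2 * ∑ j ∈ Finset.Ico 1 h, F (Real.sin (Real.pi * j / h) ^ 2) := by
  have hn0 := NeZero.ne n
  have hpos : 0 < h := by omega
  have hcast {i j : ℕ} (hi : i < n) (hj : j < n) (e : (i : ZMod n) = j) : i = j := by
    have := congrArg ZMod.val e
    rwa [ZMod.val_cast_of_lt hi, ZMod.val_cast_of_lt hj] at this
  rw [sum_zmod_eq_sum_range, show Finset.range n = Finset.range (h + h) by rw [hn, two_mul],
    Finset.sum_range_add, two_mul]
  congr 1
  · rw [Finset.range_eq_Ico, Finset.sum_eq_sum_Ico_succ_bot hpos]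
    simp only [Nat.cast_zero, true_or, if_true, zero_add]
    refine Finset.sum_congr rfl fun j hj => ?_
    rw [Finset.mem_Ico] at hj
    rw [if_neg, one_sub_cosMod_natCast_sq hn]
    rintro (e | e)
    · have := hcast (i := j) (j := 0) (by omega) (by omega) (by simpa using e)
      omega
    · have := hcast (i := j) (j := h) (by omega) (by omega) e
      omega
  · rw [Finset.range_eq_Ico, Finset.sum_eq_sum_Ico_succ_bot hpos]
    simp only [add_zero, or_true, if_true, zero_add]
    refine Finset.sum_congr rfl fun j hj => ?_
    rw [Finset.mem_Ico] at hj
    rw [if_neg, ← one_sub_cosMod_natCast_sq hn]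
    · rw [Nat.cast_add, add_comm, cosMod_add_half hn, neg_sq]
    rintro (e | e)
    · have := hcast (i := h + j) (j := 0) (by omega) (by omega) (by simpa using e)
      omega
    · have := hcast (i := h + j) (j := h) (by omega) (by omega) e
      omega

theorem sum_one_div_one_sub_cosMod_le :
    (∑ l : ZMod n, if cosMod l = 1 then 0 else 1 / (1 - cosMod l)) ≤ gridSize n := by
  have hpos : 0 < n := NeZero.pos n
  have hn0 : (0 : ℝ) < n := by exact_mod_cast hpos
  rw [sum_zmod_eq_sum_range, Finset.range_eq_Ico, Finset.sum_eq_sum_Ico_succ_bot hpos]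
  simp only [Nat.cast_zero, cosMod_zero, if_true, zero_add]
  refine le_trans (Finset.sum_le_sum fun j hj => ?_) (sum_one_div_sin_sq_le n)
  obtain ⟨h1, h2, -⟩ := pi_mul_div_mem hj
  have hs := Real.sin_pos_of_pos_of_lt_pi h1 h2
  have e : 1 - cosMod (j : ZMod n) = 2 * Real.sin (Real.pi * j / n) ^ 2 := by
    rw [cosMod_natCast, Real.sin_sq_eq_half_sub, ]
    rw [show 2 * Real.pi * j / n = 2 * (Real.pi * j / n) by ring]
    ring
  split_ifs
  · positivity
  · rw [e]
    apply one_div_le_one_div_of_le (by positivity)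
    nlinarith [sq_nonneg (Real.sin (Real.pi * j / n))]

/-- Row by row in k. For k ≠ 0, π the closed form with w = |sin k| gives n/|sin k| with an excess of
at most 2/sin² k, and these excesses sum to at most N. The rows k = 0 and k = π contribute R ≤ N
each, whence 3N. -/
theorem deflatedSum_bounds (hn : n = 2 * h) :
    2 * n * ∑ j ∈ Finset.Ico 1 h, 1 / Real.sin (Real.pi * j / h) ≤
        deflatedSum (level : Vertex n → ℝ) ∧
      deflatedSum (level : Vertex n → ℝ) ≤
        2 * n * ∑ j ∈ Finset.Ico 1 h, 1 / Real.sin (Real.pi * j / h) + 3 * gridSize n := by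
  have heven : Even n := ⟨h, by omega⟩
  set R := ∑ l : ZMod n, if cosMod l = 1 then 0 else 1 / (1 - cosMod l) with hR
  have hR0 : 0 ≤ R := by
    refine Finset.sum_nonneg fun l _ => ?_
    split_ifs
    · exact le_rfl
    · have := (abs_le.1 (abs_cosMod_le_one l)).2
      exact one_div_nonneg.2 (by linarith)
  have hR1 : R ≤ gridSize n := sum_one_div_one_sub_cosMod_le
  have hrow0 : (∑ l : ZMod n, if level (0, l) = 1 then 0 else 1 / (1 - level (0, l))) = R := by
    simp only [level, cosMod_zero, one_mul, hR]
  have hrowh : (∑ l : ZMod n, if level ((h : ZMod n), l) = 1 then 0 else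
      1 / (1 - level ((h : ZMod n), l))) = R := by
    rw [hR, ← Equiv.sum_comp (Equiv.addRight (h : ZMod n))]
    simp only [level, cosMod_half hn, Equiv.coe_addRight, cosMod_add_half hn, neg_mul_neg, one_mul]
  have hrow (k : ZMod n) (h0 : k ≠ 0) (h1 : k ≠ (h : ZMod n)) :
      0 < 1 - cosMod k ^ 2 ∧
      (∑ l : ZMod n, if level (k, l) = 1 then 0 else 1 / (1 - level (k, l))) =
        ∑ l : ZMod n, 1 / (1 - cosMod k * cosMod l) := by
    have hg : 0 < 8 / gridSize n := div_pos (by norm_num) gridSize_pos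
    have hk := abs_cosMod_le hn h0 h1
    refine ⟨?_, Finset.sum_congr rfl fun l _ => ?_⟩
    · have : |cosMod k| < 1 := by linarith
      rw [← sq_lt_one_iff_abs_lt_one] at this
      linarith
    · rw [if_neg, level]
      rw [level_eq_one_iff hn]
      rintro (e | e)
      · exact h0 (Prod.mk.inj e).1
      · exact h1 (Prod.mk.inj e).1
  rw [deflatedSum, Fintype.sum_prod_type]
  have hsin (j : ℕ) (hj : j ∈ Finset.Ico 1 h) : 0 < Real.sin (Real.pi * j / h) :=
    Real.sin_pos_of_pos_of_lt_pi (pi_mul_div_mem hj).1 (pi_mul_div_mem hj).2.1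
  have hA : 2 * n * ∑ j ∈ Finset.Ico 1 h, 1 / Real.sin (Real.pi * j / h) =
      ∑ k : ZMod n, if k = 0 ∨ k = (h : ZMod n) then 0 else n / Real.sqrt (1 - cosMod k ^ 2) := by
    rw [sum_off_poles hn fun s => n / Real.sqrt s, mul_assoc, Finset.mul_sum]
    congr 1
    refine Finset.sum_congr rfl fun j hj => ?_
    rw [Real.sqrt_sq (hsin j hj).le, mul_one_div]
  have hB : (∑ k : ZMod n, if k = 0 ∨ k = (h : ZMod n) then 0 else 2 / (1 - cosMod k ^ 2)) ≤
      gridSize n := by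
    rw [sum_off_poles hn fun s => 2 / s]
    have := sum_one_div_sin_sq_le h
    have e : ∑ j ∈ Finset.Ico 1 h, 2 / Real.sin (Real.pi * j / h) ^ 2 =
        2 * ∑ j ∈ Finset.Ico 1 h, 1 / Real.sin (Real.pi * j / h) ^ 2 := by
      rw [Finset.mul_sum]
      exact Finset.sum_congr rfl fun j _ => by ring
    rw [e, gridSize, hn]
    push_cast
    nlinarith
  rw [hA]
  constructor
  · refine Finset.sum_le_sum fun k _ => ?_
    by_cases h0 : k = 0
    · rw [if_pos (Or.inl h0), h0, hrow0]
      exact hR0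
    by_cases h1 : k = (h : ZMod n)
    · rw [if_pos (Or.inr h1), h1, hrowh]
      exact hR0
    · rw [if_neg (by tauto), (hrow k h0 h1).2]
      refine le_sum_one_div_sub_mul_cosMod heven one_pos (Real.sqrt_pos.2 (hrow k h0 h1).1) ?_
      rw [Real.sq_sqrt (hrow k h0 h1).1.le, one_pow]
  · have hC : (∑ k : ZMod n, ((if k = 0 then R else 0) + if k = (h : ZMod n) then R else 0)) =
        2 * R := by
      rw [Finset.sum_add_distrib]
      simp [two_mul]
    have : (∑ k : ZMod n, ∑ l : ZMod n, if level (k, l) = 1 then 0 else 1 / (1 - level (k, l))) ≤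
        ∑ k : ZMod n, (((if k = 0 ∨ k = (h : ZMod n) then 0 else
          n / Real.sqrt (1 - cosMod k ^ 2)) +
          (if k = 0 ∨ k = (h : ZMod n) then 0 else 2 / (1 - cosMod k ^ 2))) +
          ((if k = 0 then R else 0) + if k = (h : ZMod n) then R else 0)) := by
      refine Finset.sum_le_sum fun k _ => ?_
      by_cases h0 : k = 0
      · rw [if_pos (Or.inl h0), if_pos (Or.inl h0), if_pos h0, h0, hrow0]
        split_ifs <;> linarith
      by_cases h1 : k = (h : ZMod n)
      · rw [if_pos (Or.inr h1), if_pos (Or.inr h1), if_pos h1, if_neg h0, h1, hrowh]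
        linarith
      · rw [if_neg (by tauto), if_neg (by tauto), if_neg h0, if_neg h1, (hrow k h0 h1).2]
        have hp := (hrow k h0 h1).1
        have := sum_one_div_one_sub_mul_cosMod_le (n := n) heven (Real.sqrt_pos.2 hp)
          (Real.sq_sqrt hp.le)
        rw [Real.sq_sqrt hp.le] at this
        linarith
    rw [Finset.sum_add_distrib, Finset.sum_add_distrib, hC] at this
    linarith

/-- `∑ 1 / (1 - cos k cos l) = (N/π) ln N + O(N)` over the nontrivial momenta. -/
theorem abs_deflatedSum_sub_le (hn : n = 2 * h) :
    |deflatedSum (level : Vertex n → ℝ) - gridSize n / Real.pi * Real.log (gridSize n)| ≤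
      5 * gridSize n := by
  obtain ⟨h1, h2⟩ := deflatedSum_bounds hn
  have h3 := abs_le.1 (abs_sum_one_div_sin_sub_le h)
  have hpos : 0 < h := by
    have := NeZero.ne n
    omega
  have h4 := log_div_le_sum_Ico one_pos hpos
  have h5 := sum_Ico_le_one_add_log h
  rw [Nat.cast_one, div_one] at h4
  have hh0 : (0 : ℝ) < h := by exact_mod_cast hpos
  have hnr : (n : ℝ) = 2 * h := by exact_mod_cast hn
  have hlog : Real.log (gridSize n) = 2 * (Real.log 2 + Real.log h) := by
    rw [gridSize, Real.log_pow, hnr, Real.log_mul two_ne_zero hh0.ne']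
    norm_num
  have hlog2 : Real.log 2 ≤ 1 := by linarith [Real.log_two_lt_d9]
  have hlog2' : 0 ≤ Real.log 2 := Real.log_nonneg one_le_two
  have hg : gridSize n = 4 * (h : ℝ) ^ 2 := by rw [gridSize, hnr]; ring
  set A := ∑ j ∈ Finset.Ico 1 h, 1 / Real.sin (Real.pi * j / h)
  set H := ∑ j ∈ Finset.Ico 1 h, 1 / (j : ℝ)
  have hp := Real.pi_gt_three
  set q := 1 / Real.pi with hq
  have hq1 : q ≤ 1 / 2 := by
    rw [hq]
    exact one_div_le_one_div_of_le two_pos (by linarith)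
  have hq0 : 0 < q := by positivity
  have e1 : 2 * h / Real.pi * H = 2 * h * q * H := by rw [hq]; ring
  have e2 : gridSize n / Real.pi * Real.log (gridSize n) =
      8 * (h : ℝ) ^ 2 * q * (Real.log 2 + Real.log h) := by rw [hlog, hg, hq]; ring
  rw [e1] at h3
  rw [e2, abs_le, hg]
  rw [hg] at h2
  rw [hnr] at h1 h2
  have m1 : 2 * (2 * h) * A ≤ 2 * (2 * h) * (2 * h * q * H + h) := by gcongr; linarith
  have m2 : 2 * (2 * h) * (2 * h * q * H - h) ≤ 2 * (2 * h) * A := by gcongr; linarith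
  have m3 : 8 * (h : ℝ) ^ 2 * q * H ≤ 8 * (h : ℝ) ^ 2 * q * (1 + Real.log h) := by gcongr
  have m4 : 8 * (h : ℝ) ^ 2 * q * Real.log h ≤ 8 * (h : ℝ) ^ 2 * q * H := by gcongr
  have m5 : 8 * (h : ℝ) ^ 2 * q ≤ 8 * (h : ℝ) ^ 2 * (1 / 2) := by gcongr
  have m6 : 8 * (h : ℝ) ^ 2 * q * Real.log 2 ≤ 8 * (h : ℝ) ^ 2 * q * 1 := by gcongr
  have m7 : 0 ≤ 8 * (h : ℝ) ^ 2 * q * Real.log 2 := by positivity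
  constructor <;> nlinarith

/-- The Stieltjes transform of the levels grows logarithmically at distance `1/n` from `1`. -/
theorem log_le_levelTransform (hn : n = 2 * h) (hbig : 256 ≤ n) :
    Real.log n / 16 ≤ levelTransform n (1 + 1 / n) := by
  have heven : Even n := ⟨h, by omega⟩
  have hn0 : (0 : ℝ) < n := by exact_mod_cast NeZero.pos n
  have hh0 : (0 : ℝ) < h := by exact_mod_cast (by omega : 0 < h)
  have hnr : (n : ℝ) = 2 * h := by exact_mod_cast hn
  set u : ℝ := 1 + 1 / n with hu
  have hu1 : 1 < u := by rw [hu]; linarith [one_div_pos.2 hn0]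
  have hu0 : 0 < u := by linarith
  have hW (k : ZMod n) : 0 < u ^ 2 - cosMod k ^ 2 := by
    have := (sq_le_one_iff_abs_le_one _).2 (abs_cosMod_le_one k)
    nlinarith
  have h1 : ∑ k : ZMod n, n / Real.sqrt (u ^ 2 - cosMod k ^ 2) ≤
      levelTransform n u * gridSize n := by
    rw [levelTransform, div_mul_cancel₀ _ gridSize_pos.ne', Fintype.sum_prod_type]
    refine Finset.sum_le_sum fun k _ => ?_
    have hk := le_sum_one_div_sub_mul_cosMod heven hu0 (Real.sqrt_pos.2 (hW k))
      (Real.sq_sqrt (hW k).le)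
    simpa only [level] using hk
  have h2 : 2 * ∑ j ∈ Finset.Ico 1 h, (n : ℝ) / Real.sqrt (u ^ 2 - 1 + Real.sin (Real.pi * j / h) ^ 2) ≤
      ∑ k : ZMod n, n / Real.sqrt (u ^ 2 - cosMod k ^ 2) := by
    rw [← sum_off_poles hn fun s => (n : ℝ) / Real.sqrt (u ^ 2 - 1 + s)]
    refine Finset.sum_le_sum fun k _ => ?_
    split_ifs
    · positivity
    · rw [sub_add_sub_cancel]
  -- For j ≥ M one has j² ≥ n, so the shift u² - 1 ≈ 2/n is at most of order (j/n)², like the bound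
  -- on sin²(πj/h). The range from √n to n/2 still carries a fixed fraction of the logarithm.
  set M := Nat.sqrt n + 1 with hM
  have hMn : n ≤ M * M := (Nat.lt_succ_sqrt n).le
  have hsq : 16 ≤ Nat.sqrt n := by
    rw [Nat.le_sqrt]
    omega
  have hsq2 : Nat.sqrt n * Nat.sqrt n ≤ n := Nat.sqrt_le n
  have hM2 : M * M ≤ 4 * n := by nlinarith
  have hMh : M ≤ h := by nlinarith
  have hM0 : (0 : ℝ) < M := by positivity
  have h3 : ∑ j ∈ Finset.Ico M h, (h : ℝ) / 4 * n * (1 / j) ≤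
      ∑ j ∈ Finset.Ico 1 h, n / Real.sqrt (u ^ 2 - 1 + Real.sin (Real.pi * j / h) ^ 2) := by
    refine (Finset.sum_le_sum fun j hj => ?_).trans (Finset.sum_le_sum_of_subset_of_nonneg
      (Finset.Ico_subset_Ico_left (by omega : 1 ≤ M)) fun j _ _ => by positivity)
    rw [Finset.mem_Ico] at hj
    have hj0 : (0 : ℝ) < j := by exact_mod_cast (by omega : 0 < j)
    have hjn : (n : ℝ) ≤ (j : ℝ) ^ 2 := by
      exact_mod_cast (by nlinarith : n ≤ j ^ 2)
    have e1 : u ^ 2 - 1 ≤ 3 * (j : ℝ) ^ 2 / (2 * h) ^ 2 := by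
      rw [← hnr, le_div_iff₀ (by positivity), hu]
      have : ((1 + 1 / (n : ℝ)) ^ 2 - 1) * (n : ℝ) ^ 2 = 2 * n + 1 := by
        field_simp
        ring
      rw [this]
      have : (1 : ℝ) ≤ n := by exact_mod_cast (by omega : 1 ≤ n)
      linarith
    have e2 : Real.sin (Real.pi * j / h) ^ 2 ≤ 12 * (j : ℝ) ^ 2 / h ^ 2 := by
      refine Real.sin_sq_le_sq.trans ?_
      rw [div_pow, mul_pow]
      gcongr
      nlinarith [Real.pi_lt_d2, Real.pi_pos]
    have e3 : u ^ 2 - 1 + Real.sin (Real.pi * j / h) ^ 2 ≤ (4 * j / h) ^ 2 := by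
      have : (4 * j / h : ℝ) ^ 2 = 3 * (j : ℝ) ^ 2 / (2 * h) ^ 2 + 12 * (j : ℝ) ^ 2 / h ^ 2 +
          13 / 4 * ((j : ℝ) ^ 2 / h ^ 2) := by
        field_simp
        ring
      rw [this]
      have : 0 ≤ 13 / 4 * ((j : ℝ) ^ 2 / h ^ 2) := by positivity
      linarith
    have e4 : Real.sqrt (u ^ 2 - 1 + Real.sin (Real.pi * j / h) ^ 2) ≤ 4 * j / h := by
      rw [← Real.sqrt_sq (by positivity : (0 : ℝ) ≤ 4 * j / h)]
      exact Real.sqrt_le_sqrt e3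
    have e5 : 0 < Real.sqrt (u ^ 2 - 1 + Real.sin (Real.pi * j / h) ^ 2) := by
      apply Real.sqrt_pos.2
      have : 0 < u ^ 2 - 1 := by nlinarith
      positivity
    calc (h : ℝ) / 4 * n * (1 / j) = n / (4 * j / h) := by field_simp
      _ ≤ _ := by gcongr
  have h4 := log_div_le_sum_Ico (by omega : 0 < M) hMh
  rw [← Finset.mul_sum] at h3
  have h5 : Real.log n / 4 ≤ Real.log (h / M) := by
    have hlog : 4 * Real.log (h / M) = Real.log ((h / M : ℝ) ^ 4) := by
      rw [Real.log_pow]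
      norm_num
    have : (n : ℝ) ≤ (h / M : ℝ) ^ 4 := by
      rw [div_pow, le_div_iff₀ (by positivity)]
      have hM4 : (M : ℝ) ^ 4 ≤ (4 * n) ^ 2 := by
        have : (M : ℝ) * M ≤ 4 * n := by exact_mod_cast hM2
        calc (M : ℝ) ^ 4 = ((M : ℝ) * M) ^ 2 := by ring
          _ ≤ (4 * (n : ℝ)) ^ 2 := by gcongr
      have hbig' : (256 : ℝ) ≤ n := by exact_mod_cast hbig
      have hh4 : (h : ℝ) ^ 4 = n ^ 4 / 16 := by rw [hnr]; ring
      calc (n : ℝ) * M ^ 4 ≤ n * (4 * (n : ℝ)) ^ 2 := by gcongr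
        _ = 256 * (n : ℝ) ^ 3 / 16 := by ring
        _ ≤ n * (n : ℝ) ^ 3 / 16 := by gcongr
        _ = (h : ℝ) ^ 4 := by rw [hh4]; ring
    have := Real.log_le_log hn0 this
    linarith
  have hgs : gridSize n = n * (2 * h) := by rw [gridSize, ← hnr]; ring
  rw [hgs] at h1
  have h6 : (h : ℝ) / 4 * n * (Real.log n / 4) ≤ (h : ℝ) / 4 * n *
      ∑ j ∈ Finset.Ico M h, 1 / (j : ℝ) := by
    gcongr
    linarith
  have h7 : (n * h : ℝ) * (2 * (Real.log n / 16)) ≤ (n * h : ℝ) * (2 * levelTransform n u) := by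
    linarith
  have := le_of_mul_le_mul_left h7 (by positivity)
  linarith

end LevelSums
-- Eigenphases nearest zero and the single-sine approximation.
section SearchEstimates

variable {n : ℕ} [NeZero n] {h : ℕ}

theorem levelTransform_eq_sum (u : ℝ) :
    levelTransform n u = ∑ p : Vertex n, (1 / gridSize n) / (u - level p) := by
  rw [levelTransform, Finset.sum_div]
  exact Finset.sum_congr rfl fun p _ => by rw [div_div, div_div, mul_comm]

theorem levelTransform_eq_zero_iff (u : ℝ) :
    levelTransform n u = 0 ↔ ∑ p : Vertex n, 1 / (u - level p) = 0 := by
  rw [levelTransform, div_eq_zero_iff, or_iff_left gridSize_pos.ne']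

/-- Away from the levels, the eigenphases are the zeros of the Stieltjes transform. -/
theorem mem_eigenphases_iff (hn : Even n) {m₀ m₁ : Vertex n} (h₀ : EvenVertex m₀)
    (h₁ : ¬ EvenVertex m₁) {θ : ℝ} (hs : Real.sin θ ≠ 0)
    (hθ : ∀ p : Vertex n, Real.cos θ ≠ level p) :
    θ ∈ eigenphases {m₀, m₁} ↔ levelTransform n (Real.cos θ) = 0 := by
  have hexp : Complex.exp (θ * Complex.I) = Real.cos θ + Real.sin θ * Complex.I := by
    rw [Complex.exp_mul_I, Complex.ofReal_cos, Complex.ofReal_sin]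
  have hz : Complex.exp (θ * Complex.I) ^ 2 + 1 =
      2 * (Real.cos θ : ℝ) * Complex.exp (θ * Complex.I) := by
    rw [hexp]
    have h1 : ((Real.sin θ : ℝ) : ℂ) ^ 2 + ((Real.cos θ : ℝ) : ℂ) ^ 2 = 1 := by
      exact_mod_cast Real.sin_sq_add_cos_sq θ
    linear_combination ((Real.sin θ : ℝ) : ℂ) ^ 2 * Complex.I_sq - h1
  have hne : Complex.exp (θ * Complex.I) ≠ (Real.cos θ : ℝ) := by
    intro h
    have h2 := congrArg Complex.im h
    rw [Complex.exp_ofReal_mul_I_im, Complex.ofReal_im] at h2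
    exact hs h2
  exact hasEigenvalue_pair_iff hn h₀ h₁ _
    (fun m hm => hasEigenvalue_singleton m hz hne hθ hm)
    (fun hL m => exists_eigenvector_singleton m hz hθ hL)

omit [NeZero n] in
theorem eight_div_gridSize_le (hn : n = 2 * h) (hh : 2 ≤ h) : 8 / gridSize n ≤ 1 / 2 := by
  rw [gridSize, hn]
  have : (2 : ℝ) ≤ h := by exact_mod_cast hh
  rw [div_le_div_iff₀ (by positivity) two_pos]
  push_cast
  nlinarith

theorem ne_level_of_mem (hn : n = 2 * h) (hh : 2 ≤ h) {u : ℝ} (h1 : 1 - 8 / gridSize n < u)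
    (h2 : u < 1) (p : Vertex n) : u ≠ level p := by
  rcases level_gap hn hh p with h | h <;> linarith

/-- The eigenphases nearest zero. -/
theorem isLeast_eigenphases (hn : n = 2 * h) (hh : 2 ≤ h) {m₀ m₁ : Vertex n}
    (h₀ : EvenVertex m₀) (h₁ : ¬ EvenVertex m₁) {x : ℝ} (hx0 : 0 < x) (hxg : x < 8 / gridSize n)
    (hx : ∑ p : Vertex n, 1 / (1 - x - level p) = 0) :
    IsLeast {θ | θ ∈ eigenphases {m₀, m₁} ∧ 0 < θ} (Real.arccos (1 - x)) ∧
      IsGreatest {θ | θ ∈ eigenphases {m₀, m₁} ∧ θ < 0} (-Real.arccos (1 - x)) := by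
  have heven : Even n := ⟨h, by omega⟩
  have hg := eight_div_gridSize_le hn hh
  have hcos : Real.cos (Real.arccos (1 - x)) = 1 - x := Real.cos_arccos (by linarith) (by linarith)
  set lam := Real.arccos (1 - x) with hlam
  have hlam0 : 0 < lam := Real.arccos_pos.2 (by linarith)
  have hlampi : lam < Real.pi := by
    refine lt_of_le_of_ne (Real.arccos_le_pi _) fun h => ?_
    rw [h, Real.cos_pi] at hcos
    linarith
  have hsin : Real.sin lam ≠ 0 := (Real.sin_pos_of_pos_of_lt_pi hlam0 hlampi).ne'
  have hlevel : ∀ p : Vertex n, Real.cos lam ≠ level p := by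
    rw [hcos]
    exact ne_level_of_mem hn hh (by linarith) (by linarith)
  have hroot : levelTransform n (Real.cos lam) = 0 := by
    rw [hcos, levelTransform_eq_zero_iff, hx]
  have hnone (θ : ℝ) (h1 : 0 < θ) (h2 : θ < lam) : Real.sin θ ≠ 0 ∧
      (∀ p : Vertex n, Real.cos θ ≠ level p) ∧ levelTransform n (Real.cos θ) ≠ 0 := by
    have h3 : 1 - x < Real.cos θ := by
      rw [← hcos]
      exact Real.cos_lt_cos_of_nonneg_of_le_pi h1.le hlampi.le h2
    have h4 : Real.cos θ < 1 := by
      rw [← Real.cos_zero]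
      exact Real.cos_lt_cos_of_nonneg_of_le_pi le_rfl (by linarith) h1
    refine ⟨(Real.sin_pos_of_pos_of_lt_pi h1 (by linarith)).ne',
      ne_level_of_mem hn hh (by linarith) h4, ?_⟩
    rw [Ne, levelTransform_eq_zero_iff]
    have := stieltjes_strictAnti (level_gap hn hh) (by linarith : 1 - 8 / gridSize n < 1 - x) h3 h4
    rw [hx] at this
    exact this.ne
  refine ⟨⟨⟨(mem_eigenphases_iff heven h₀ h₁ hsin hlevel).2 hroot, hlam0⟩, ?_⟩,
    ⟨⟨(mem_eigenphases_iff heven h₀ h₁ ?_ ?_).2 ?_, by linarith⟩, ?_⟩⟩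
  · rintro θ ⟨hθ, hθ0⟩
    by_contra! hlt
    obtain ⟨e1, e2, e3⟩ := hnone θ hθ0 hlt
    exact e3 ((mem_eigenphases_iff heven h₀ h₁ e1 e2).1 hθ)
  · rwa [Real.sin_neg, neg_ne_zero]
  · rwa [Real.cos_neg]
  · rwa [Real.cos_neg]
  · rintro θ ⟨hθ, hθ0⟩
    by_contra! hlt
    obtain ⟨e1, e2, e3⟩ := hnone (-θ) (by linarith) (by linarith)
    rw [Real.sin_neg, neg_ne_zero] at e1
    rw [Real.cos_neg] at e2 e3
    exact e3 ((mem_eigenphases_iff heven h₀ h₁ e1 e2).1 hθ)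

/-- The kernel is at most 1/sin(α/2) = √(2/(1 - τ)) for every t; this is the source of uniformity in
time. -/
theorem abs_one_add_two_mul_sum_cos_le {τ c : ℝ} (h1 : -1 ≤ τ) (hc : 0 < c) (h2 : c ≤ 1 - τ)
    (t : ℕ) : |1 + 2 * ∑ s ∈ Finset.range t, Real.cos ((s + 1 : ℕ) * Real.arccos τ)| ≤
      1 / Real.sqrt (c / 2) := by
  have hD := one_add_two_mul_sum_cos t (Real.arccos τ)
  rw [sin_half_arccos h1 (by linarith)] at hD
  have hs : 0 < Real.sqrt (c / 2) := Real.sqrt_pos.2 (by positivity)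
  have hs2 : Real.sqrt (c / 2) ≤ Real.sqrt ((1 - τ) / 2) := Real.sqrt_le_sqrt (by linarith)
  have h3 := Real.abs_sin_le_one ((t + 1 / 2) * Real.arccos τ)
  rw [← hD, abs_mul, abs_of_nonneg (Real.sqrt_nonneg _)] at h3
  rw [le_div_iff₀ hs, mul_comm]
  exact (mul_le_mul_of_nonneg_right hs2 (abs_nonneg _)).trans h3

/-- The amplitude at the marked vertex is a single sine up to a small error. -/
theorem amplitude_estimate (hn : n = 2 * h) (hh : 2 ≤ h) (m : Vertex n) {x : ℝ} (hx0 : 0 < x)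
    (hxg : x < 8 / gridSize n) (hx : ∑ p : Vertex n, 1 / (1 - x - level p) = 0) :
    ∃ κ : ℝ, κ * (x * (2 - x) * ∑ p : Vertex n, 1 / (1 - x - level p) ^ 2) = gridSize n ∧
      ∀ t : ℕ, ∃ a : ℝ, inner ℂ (diagKet m) (stateAt {m} t) = (a : ℂ) ∧
        |a - κ / (n * Real.sqrt (x / 2)) * Real.sin ((t + 1 / 2) * Real.arccos (1 - x))| ≤
          1 / (2 * levelTransform n (1 + 1 / n)) + Real.sqrt (2 * n) / n := by
  have hg := eight_div_gridSize_le hn hh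
  have hN := gridSize_pos (n := n)
  have hn0 : (0 : ℝ) < n := by exact_mod_cast NeZero.pos n
  have hg0 : 0 < 8 / gridSize n := by positivity
  obtain ⟨k, κ, τ, hκ, hκ1, hτ, hamp, hid⟩ := exists_amplitude_formula m
  have hid' : ∀ u, 1 < u → (u ^ 2 - 1) * (∑ p : Vertex n, (1 / gridSize n) / (u - level p)) *
      ∑ i, κ i / (u - τ i) = 1 := by
    intro u hu
    rw [← levelTransform_eq_sum]
    exact hid u hu
  have hτ1 := fun i => (hτ i).2
  have hxlevel : ∀ p : Vertex n, 1 - x ≠ level p :=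
    ne_level_of_mem hn hh (by linarith) (by linarith)
  have hroot := dual_mass_root level_le_one hτ1 hid' hxlevel (by
    rw [← levelTransform_eq_sum, levelTransform_eq_zero_iff, hx])
  have hone := dual_mass_one_mul_eq_zero level_le_one hτ1 hid'
  have hnear := dual_mass_near_one hτ1 hid' hκ (fun u hu => by
    rw [← levelTransform_eq_sum]
    exact levelTransform_pos hu) (one_div_pos.2 hn0)
  rw [← levelTransform_eq_sum] at hnear
  set L := levelTransform n (1 + 1 / n) with hL
  -- Nothing but 1 - x is charged in (1 - 8/N, 1]: an interior atom would be a second zero, against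
  -- monotonicity, and an atom at 1 would collide with the mass of the level 1.
  have hsupp (i : Fin k) (hi : τ i ≠ 1 - x) (hi0 : κ i ≠ 0) : τ i ≤ 1 - 8 / gridSize n := by
    have hpos : 0 < ∑ j, if τ j = τ i then κ j else 0 := by
      refine lt_of_lt_of_le (lt_of_le_of_ne (hκ i) hi0.symm) ?_
      have := Finset.single_le_sum (f := fun j => if τ j = τ i then κ j else 0)
        (fun j _ => by split_ifs; exacts [hκ j, le_rfl]) (Finset.mem_univ i)
      simpa using this
    by_contra! hlt
    rcases (hτ1 i).lt_or_eq with h1 | h1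
    · have h2 := dual_mass_mul_eq_zero level_le_one hτ1 hid' (ne_level_of_mem hn hh hlt h1)
      rw [← levelTransform_eq_sum] at h2
      have h3 : τ i ^ 2 - 1 ≠ 0 := by nlinarith
      have h4 : levelTransform n (τ i) = 0 := by
        rcases mul_eq_zero.1 h2 with h5 | h5
        · exact (mul_eq_zero.1 h5).resolve_left h3
        · exact absurd h5 hpos.ne'
      rw [levelTransform_eq_zero_iff] at h4
      rcases lt_or_gt_of_ne hi with h5 | h5
      · have := stieltjes_strictAnti (level_gap hn hh) hlt h5 (by linarith)
        linarith
      · have := stieltjes_strictAnti (level_gap hn hh)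
          (by linarith : 1 - 8 / gridSize n < 1 - x) h5 h1
        linarith
    · rw [h1] at hpos
      rcases mul_eq_zero.1 hone with h2 | h2
      · have h3 := sum_level_eq_one (n := n) hn
        have h4 : (∑ p : Vertex n, if level p = 1 then 1 / gridSize n else 0) =
            (∑ p : Vertex n, if level p = 1 then (1 : ℝ) else 0) / gridSize n := by
          rw [Finset.sum_div]
          exact Finset.sum_congr rfl fun p _ => by split_ifs <;> simp
        rw [h4, h3] at h2
        have : 2 / gridSize n ≠ 0 := by positivity
        exact this h2
      · exact hpos.ne' h2
  set K := ∑ i, if τ i = 1 - x then κ i else 0 with hK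
  refine ⟨K, ?_, fun t => ⟨_, hamp t, ?_⟩⟩
  · have e : ∑ p : Vertex n, (1 / gridSize n) / (1 - x - level p) ^ 2 =
        (∑ p : Vertex n, 1 / (1 - x - level p) ^ 2) / gridSize n := by
      rw [Finset.sum_div]
      exact Finset.sum_congr rfl fun p _ => by rw [div_div, div_div, mul_comm]
    rw [e] at hroot
    field_simp at hroot
    linear_combination hroot
  · set D := fun i => 1 + 2 * ∑ s ∈ Finset.range t, Real.cos ((s + 1 : ℕ) * Real.arccos (τ i))
    have hsx : 0 < Real.sqrt (x / 2) := Real.sqrt_pos.2 (by positivity)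
    have hmain : K / (n * Real.sqrt (x / 2)) * Real.sin ((t + 1 / 2) * Real.arccos (1 - x)) =
        (∑ i, if τ i = 1 - x then κ i * D i else 0) / n := by
      have hD := one_add_two_mul_sum_cos t (Real.arccos (1 - x))
      rw [sin_half_arccos (by linarith) (by linarith), sub_sub_cancel] at hD
      have e : (∑ i, if τ i = 1 - x then κ i * D i else 0) = K *
          (1 + 2 * ∑ s ∈ Finset.range t, Real.cos ((s + 1 : ℕ) * Real.arccos (1 - x))) := by
        rw [hK, Finset.sum_mul]
        refine Finset.sum_congr rfl fun i _ => ?_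
        split_ifs with hi
        · simp only [D, hi]
        · rw [zero_mul]
      rw [e, ← hD]
      generalize 1 + 2 * ∑ s ∈ Finset.range t, Real.cos ((s + 1 : ℕ) * Real.arccos (1 - x)) = Z
      field_simp
    have hg2 : 1 / Real.sqrt (8 / gridSize n / 2) = n / 2 := by
      have : 8 / gridSize n / 2 = (2 / (n : ℝ)) ^ 2 := by
        rw [gridSize]
        field_simp
        norm_num
      rw [this, Real.sqrt_sq (by positivity), one_div_div]
    have he2 : 1 / Real.sqrt (1 / (n : ℝ) / 2) = Real.sqrt (2 * n) := by
      rw [one_div, ← Real.sqrt_inv]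
      congr 1
      field_simp
    -- The other atoms are split at distance 1/n from 1, the ε of `hnear`. Near ones have 1 - τ ≥
    -- 8/N by the gap, so kernel at most n/2; far ones have kernel at most √(2n).
    have hterm (i : Fin k) : |κ i * D i - (if τ i = 1 - x then κ i * D i else 0)| ≤
        n / 2 * (if 1 - 1 / (n : ℝ) ≤ τ i then κ i else 0) + Real.sqrt (2 * n) * κ i := by
      have hnn : 0 ≤ n / 2 * (if 1 - 1 / (n : ℝ) ≤ τ i then κ i else 0) := by
        split_ifs
        · exact mul_nonneg (by positivity) (hκ i)
        · rw [mul_zero]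
      have hnn' : 0 ≤ Real.sqrt (2 * n) * κ i := mul_nonneg (Real.sqrt_nonneg _) (hκ i)
      by_cases hi : τ i = 1 - x
      · rw [if_pos hi, sub_self, abs_zero]
        exact add_nonneg hnn hnn'
      rw [if_neg hi, sub_zero]
      by_cases hi0 : κ i = 0
      · have h0 : κ i * D i = 0 := by rw [hi0, zero_mul]
        rw [h0, abs_zero]
        exact add_nonneg hnn hnn'
      rw [abs_mul, abs_of_nonneg (hκ i)]
      by_cases hi1 : 1 - 1 / (n : ℝ) ≤ τ i
      · have h1 := abs_one_add_two_mul_sum_cos_le (hτ i).1 hg0 (by linarith [hsupp i hi hi0]) t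
        rw [hg2] at h1
        rw [if_pos hi1]
        have := mul_le_mul_of_nonneg_left h1 (hκ i)
        linarith
      · have h1 := abs_one_add_two_mul_sum_cos_le (hτ i).1 (one_div_pos.2 hn0)
          (by linarith) t
        rw [he2] at h1
        have := mul_le_mul_of_nonneg_left h1 (hκ i)
        linarith
    rw [hmain, ← sub_div, ← Finset.sum_sub_distrib, abs_div, abs_of_pos hn0]
    have hsum := (Finset.abs_sum_le_sum_abs _ _).trans (Finset.sum_le_sum (s := Finset.univ) fun i _ => hterm i)
    rw [Finset.sum_add_distrib, ← Finset.mul_sum, ← Finset.mul_sum, hκ1, mul_one] at hsum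
    rw [div_le_iff₀ hn0, add_mul, div_mul_cancel₀ _ hn0.ne']
    have hm : n / 2 * (∑ i, if 1 - 1 / (n : ℝ) ≤ τ i then κ i else 0) ≤ 1 / (2 * L) * n := by
      refine (mul_le_mul_of_nonneg_left hnear (by positivity)).trans (le_of_eq ?_)
      rw [div_mul_div_comm, mul_one, div_mul_eq_mul_div, one_mul]
    linarith

end SearchEstimates
-- Near-maxima of functions of integer time that are d²-close to sin²(λt).
section SineSquaredMaximum

theorem abs_sub_half_pi_le {φ σ d : ℝ} (h0 : 0 ≤ φ) (hπ : φ ≤ Real.pi) (hd : 0 ≤ d)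
    (hσ : 4 * σ ≤ d ^ 2) (h : 1 - σ ≤ Real.sin φ ^ 2) : |φ - Real.pi / 2| ≤ d := by
  have h1 : |φ - Real.pi / 2| ≤ Real.pi / 2 := by
    rw [abs_le]
    constructor <;> linarith
  have h2 := Real.mul_abs_le_abs_sin h1
  have h3 : Real.sin (φ - Real.pi / 2) ^ 2 ≤ σ := by
    rw [Real.sin_sub_pi_div_two, neg_sq, Real.cos_sq']
    linarith
  have h4 : |φ - Real.pi / 2| / 2 ≤ |Real.sin (φ - Real.pi / 2)| := by
    refine le_trans ?_ h2
    rw [div_eq_mul_inv, mul_comm]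
    gcongr
    rw [le_div_iff₀ Real.pi_pos]
    linarith [Real.pi_le_four]
  rw [← sq_abs] at h3
  have h5 : (|φ - Real.pi / 2| / 2) ^ 2 ≤ σ := (pow_le_pow_left₀ (by positivity) h4 2).trans h3
  refine abs_le_of_sq_le_sq ?_ hd
  rw [← sq_abs]
  nlinarith

theorem one_sub_sq_le_sin_sq {φ d : ℝ} (h : |φ - Real.pi / 2| ≤ d) :
    1 - d ^ 2 ≤ Real.sin φ ^ 2 := by
  have h1 := Real.sin_sq_le_sq (x := φ - Real.pi / 2)
  rw [Real.sin_sub_pi_div_two, neg_sq, Real.cos_sq'] at h1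
  have h2 : (φ - Real.pi / 2) ^ 2 ≤ d ^ 2 := sq_le_sq' (abs_le.1 h).1 (abs_le.1 h).2
  linarith

variable {d lam τ : ℝ} {f : ℕ → ℝ} (hd0 : 0 < d) (hd1 : d ≤ 1 / 8) (hlam0 : 0 < lam)
  (hlam1 : lam ≤ d ^ 2) (hτ0 : 0 < τ) (hτ : |lam * τ / (Real.pi / 2) - 1| ≤ d ^ 2)
  (hf : ∀ t : ℕ, |f t - Real.sin (lam * t) ^ 2| ≤ d ^ 2)

include hd0 hd1 hlam0 hlam1 hf

omit hd0 hd1 in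
theorem exists_nearly_maximal_time :
    ∃ t : ℕ, lam * t ≤ Real.pi ∧ 1 - 2 * d ^ 2 ≤ f t := by
  have hp := Real.pi_pos
  refine ⟨⌊Real.pi / 2 / lam⌋₊, ?_, ?_⟩
  · have := Nat.floor_le (by positivity : 0 ≤ Real.pi / 2 / lam)
    rw [le_div_iff₀ hlam0] at this
    linarith
  · have h1 := Nat.floor_le (by positivity : 0 ≤ Real.pi / 2 / lam)
    have h2 := Nat.lt_floor_add_one (Real.pi / 2 / lam)
    rw [le_div_iff₀ hlam0] at h1
    rw [div_lt_iff₀ hlam0] at h2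
    have h3 : |lam * (⌊Real.pi / 2 / lam⌋₊ : ℕ) - Real.pi / 2| ≤ lam := by
      rw [abs_le]
      constructor <;> nlinarith
    have h4 := one_sub_sq_le_sin_sq h3
    have h5 := (abs_le.1 (hf ⌊Real.pi / 2 / lam⌋₊)).1
    nlinarith [mul_self_le_mul_self hlam0.le hlam1]

include hτ0 hτ

omit hd0 hd1 hlam1 hf in
theorem time_bounds : (Real.pi / 2) * (1 - d ^ 2) ≤ lam * τ ∧
    lam * τ ≤ (Real.pi / 2) * (1 + d ^ 2) := by
  have hp : 0 < Real.pi / 2 := by positivity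
  have h := abs_le.1 hτ
  have h1 : lam * τ = (Real.pi / 2) * (lam * τ / (Real.pi / 2)) := by field_simp
  constructor
  · rw [h1]
    gcongr
    linarith
  · rw [h1]
    gcongr
    linarith

/-- Comparison with a near-maximal time forces sin²(λT) ≥ 1 - 3d². As sin² is quadratic at its peak,
this locates λT only within 4d: a tolerance d² in value costs order d in time. -/
theorem maximal_time_estimate {T : ℕ} (hT : lam * T ≤ Real.pi)
    (hmax : ∀ t : ℕ, lam * t ≤ Real.pi → f t ≤ f T) :
    |T / τ - 1| ≤ 8 * d ∧ |f T - 1| ≤ 8 * d := by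
  obtain ⟨t, ht1, ht2⟩ := exists_nearly_maximal_time hlam0 hlam1 hf
  obtain ⟨hb1, hb2⟩ := time_bounds hlam0 hτ0 hτ
  have h1 := hmax t ht1
  have h2 := abs_le.1 (hf T)
  have h3 := Real.sin_sq_le_one (lam * T)
  have hd2 : d ^ 2 ≤ d / 8 := by nlinarith
  have h4 := abs_sub_half_pi_le (σ := 3 * d ^ 2) (d := 4 * d) (by positivity) hT (by positivity)
    (by nlinarith) (by linarith : 1 - 3 * d ^ 2 ≤ Real.sin (lam * T) ^ 2)
  have hp := Real.pi_gt_three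
  have hp4 := Real.pi_le_four
  constructor
  · have h5 := abs_le.1 h4
    have h6 : (T : ℝ) / τ - 1 = (lam * T - lam * τ) / (lam * τ) := by field_simp
    have h7 : 1 ≤ lam * τ := by nlinarith
    rw [h6, abs_div, abs_of_pos (by positivity : 0 < lam * τ), div_le_iff₀ (by positivity)]
    have h8 : |lam * T - lam * τ| ≤ 5 * d := by
      rw [abs_le]
      constructor <;> nlinarith
    nlinarith
  · rw [abs_le]
    constructor <;> nlinarith

/-- T may lie in any period: either λT is already beyond π/2, or it lies on the first rising branch
and the localisation at the peak applies. -/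
theorem le_of_nearly_maximal {T : ℕ} (hmax : ∀ t : ℕ, (1 - d ^ 2) * f t ≤ f T) :
    (1 - 8 * d) * τ ≤ T := by
  obtain ⟨t, ht1, ht2⟩ := exists_nearly_maximal_time hlam0 hlam1 hf
  obtain ⟨hb1, hb2⟩ := time_bounds hlam0 hτ0 hτ
  have h1 := hmax t
  have h2 := abs_le.1 (hf T)
  have hp := Real.pi_gt_three
  have hp4 := Real.pi_le_four
  have hd2 : d ^ 2 ≤ d / 8 := by nlinarith
  have h3 : 1 - 3 * d ^ 2 ≤ f T := by
    have : (1 - d ^ 2) * (1 - 2 * d ^ 2) ≤ (1 - d ^ 2) * f t :=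
      mul_le_mul_of_nonneg_left ht2 (by nlinarith)
    nlinarith [sq_nonneg (d ^ 2)]
  have h4 : Real.pi / 2 - 4 * d ≤ lam * T := by
    rcases le_total (lam * T) (Real.pi / 2) with h | h
    · have := abs_sub_half_pi_le (σ := 4 * d ^ 2) (d := 4 * d) (by positivity) (by linarith)
        (by positivity) (by nlinarith) (by linarith : 1 - 4 * d ^ 2 ≤ Real.sin (lam * T) ^ 2)
      linarith [(abs_le.1 this).1]
    · linarith
  have h5 : (1 - 8 * d) * (lam * τ) ≤ lam * T := by
    have : (1 - 8 * d) * (lam * τ) ≤ (1 - 8 * d) * ((Real.pi / 2) * (1 + d ^ 2)) :=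
      mul_le_mul_of_nonneg_left hb2 (by linarith)
    nlinarith [mul_pos hd0 hd0]
  have h6 : lam * ((1 - 8 * d) * τ) ≤ lam * T := by linarith
  exact le_of_mul_le_mul_left h6 hlam0

theorem floor_time_estimate : |f ⌊τ⌋₊ - 1| ≤ 8 * d := by
  obtain ⟨hb1, hb2⟩ := time_bounds hlam0 hτ0 hτ
  have h1 := Nat.floor_le hτ0.le
  have h2 := Nat.lt_floor_add_one τ
  have hp4 := Real.pi_le_four
  have hp := Real.pi_pos
  have hd2 : d ^ 2 ≤ d / 8 := by nlinarith
  have h3 : |lam * (⌊τ⌋₊ : ℕ) - Real.pi / 2| ≤ 3 * d ^ 2 := by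
    have e1 := mul_le_mul_of_nonneg_left h1 hlam0.le
    have e2 := mul_le_mul_of_nonneg_left h2.le hlam0.le
    rw [abs_le]
    constructor <;> nlinarith
  have h4 := one_sub_sq_le_sin_sq h3
  have h5 := abs_le.1 (hf ⌊τ⌋₊)
  have h6 := Real.sin_sq_le_one (lam * (⌊τ⌋₊ : ℕ))
  have h7 : (3 * d ^ 2) ^ 2 ≤ d := by nlinarith [sq_nonneg d]
  rw [abs_le]
  constructor <;> linarith

end SineSquaredMaximum
-- Size of the error term and scaling of the root.
section Asymptotics

/-- Continuity at (1, 0, 0) of the expressions holding the final errors: y is the root divided by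
its asymptotic value, x the root itself, and 2 + e the derivative sum at the root times x². -/
theorem exists_nhds_bounds {ε : ℝ} (hε : 0 < ε) : ∃ η : ℝ, 0 < η ∧ ∀ y x e : ℝ,
    |y - 1| < η → |x| < η → |e| < η →
      |Real.sqrt y - 1| < ε ∧ |Real.sqrt y / (1 - x / 4) - 1| < ε ∧
        |Real.sqrt y / ((1 - x / 2) * (1 + e / 2)) - 1| < ε ∧ |Real.pi * Real.sqrt (x / 2)| < ε := by
  have key (F : ℝ × ℝ × ℝ → ℝ) (c : ℝ) (hF : ContinuousAt F (1, 0, 0)) (hc : F (1, 0, 0) = c) :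
      ∃ η : ℝ, 0 < η ∧ ∀ y x e : ℝ, |y - 1| < η → |x| < η → |e| < η → |F (y, x, e) - c| < ε := by
    obtain ⟨η, hη, h⟩ := Metric.continuousAt_iff.1 hF ε hε
    refine ⟨η, hη, fun y x e hy hx he => ?_⟩
    have := @h (y, x, e) (by
      simp only [Prod.dist_eq, Real.dist_eq, sub_zero]
      exact max_lt hy (max_lt hx he))
    rwa [hc, Real.dist_eq] at this
  obtain ⟨η₁, h₁, H₁⟩ := key (fun p => Real.sqrt p.1) 1 (by fun_prop) (by simp)
  obtain ⟨η₂, h₂, H₂⟩ := key (fun p => Real.sqrt p.1 / (1 - p.2.1 / 4)) 1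
    (ContinuousAt.div (by fun_prop) (by fun_prop) (by norm_num)) (by simp)
  obtain ⟨η₃, h₃, H₃⟩ := key (fun p => Real.sqrt p.1 / ((1 - p.2.1 / 2) * (1 + p.2.2 / 2))) 1
    (ContinuousAt.div (by fun_prop) (by fun_prop) (by norm_num)) (by simp)
  obtain ⟨η₄, h₄, H₄⟩ := key (fun p => Real.pi * Real.sqrt (p.2.1 / 2)) 0 (by fun_prop) (by simp)
  refine ⟨min (min η₁ η₂) (min η₃ η₄), lt_min (lt_min h₁ h₂) (lt_min h₃ h₄),
    fun y x e hy hx he => ?_⟩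
  simp only [lt_min_iff] at hy hx he
  refine ⟨H₁ y x e hy.1.1 hx.1.1 he.1.1, H₂ y x e hy.1.2 hx.1.2 he.1.2,
    H₃ y x e hy.2.1 hx.2.1 he.2.1, ?_⟩
  have := H₄ y x e hy.2.2 hx.2.2 he.2.2
  rwa [sub_zero] at this

/-- Half of the phase `arccos (1 - x)` compared with its sine. -/
theorem half_arccos_bounds {x : ℝ} (hx0 : 0 < x) (hx1 : x ≤ 1) :
    Real.sqrt (x / 2) ≤ Real.arccos (1 - x) / 2 ∧
      Real.arccos (1 - x) / 2 ≤ Real.sqrt (x / 2) / (1 - x / 4) ∧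
      Real.arccos (1 - x) ≤ Real.pi * Real.sqrt (x / 2) := by
  have hs := sin_half_arccos (by linarith : -1 ≤ 1 - x) (by linarith : 1 - x ≤ 1)
  rw [sub_sub_cancel] at hs
  have h0 : 0 < Real.arccos (1 - x) := Real.arccos_pos.2 (by linarith)
  have hpi := Real.arccos_le_pi (1 - x)
  set v := Real.arccos (1 - x) / 2 with hv
  have hv0 : 0 < v := by positivity
  have h1 := Real.sin_le hv0.le
  have h2 := Real.mul_le_sin hv0.le (by linarith)
  have h3 := Real.sin_gt_sub_cube hv0
  rw [hs] at h1 h2 h3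
  have hsq : Real.sqrt (x / 2) ^ 2 = x / 2 := Real.sq_sqrt (by positivity)
  set s := Real.sqrt (x / 2) with hsdef
  have hp := Real.pi_pos
  have h4 : 2 * v ≤ Real.pi * s := by
    have : 2 / Real.pi * v * Real.pi = 2 * v := by field_simp
    rw [← this, mul_comm Real.pi]
    gcongr
  refine ⟨h1, ?_, by linarith⟩
  rw [le_div_iff₀ (by linarith)]
  have h5 : v ^ 2 ≤ 6 * (x / 4) := by
    have h6 : (2 * v) ^ 2 ≤ (Real.pi * s) ^ 2 := by gcongr
    have h7 : Real.pi ^ 2 ≤ 12 := by nlinarith [Real.pi_lt_d2]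
    have h8 : Real.pi ^ 2 * (x / 2) ≤ 12 * (x / 2) := by gcongr
    rw [mul_pow, mul_pow, hsq] at h6
    linarith
  nlinarith

variable {n : ℕ} [NeZero n] {h : ℕ}

/-- The prefactor is the reciprocal of the leading amplitude ½√(π/ln N). Both error terms are O(1/ln
N), so the relative error is O(1/√(ln N)). -/
theorem error_term_le (hn : n = 2 * h) (hbig : 256 ≤ n) :
    2 * Real.sqrt (Real.log (gridSize n) / Real.pi) *
      (1 / (2 * levelTransform n (1 + 1 / n)) + Real.sqrt (2 * n) / n) ≤
        44 / Real.sqrt (Real.log (gridSize n)) := by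
  have hn0 : (0 : ℝ) < n := by exact_mod_cast NeZero.pos n
  have hl : Real.log (gridSize n) = 2 * Real.log n := by
    rw [gridSize, Real.log_pow]
    norm_num
  have hlog0 : 0 < Real.log n := Real.log_pos (by exact_mod_cast (by omega : 1 < n))
  have hL := log_le_levelTransform hn hbig
  set ℓ := Real.log (gridSize n) with hℓ
  have hℓ0 : 0 < ℓ := by rw [hl]; positivity
  have h1 : 1 / (2 * levelTransform n (1 + 1 / n)) ≤ 16 / ℓ := by
    rw [div_le_div_iff₀ (by linarith) hℓ0]
    linarith
  have h2 : Real.sqrt (2 * n) / n ≤ 6 / ℓ := by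
    have h3 : Real.log n ≤ 2 * Real.sqrt n := by
      have h4 := Real.log_le_sub_one_of_pos (Real.sqrt_pos.2 hn0)
      rw [Real.log_sqrt hn0.le] at h4
      linarith
    have h5 : ℓ ≤ 4 * Real.sqrt n := by linarith
    have h6 : Real.sqrt (2 * n) = Real.sqrt 2 * Real.sqrt n := Real.sqrt_mul zero_le_two _
    have h7 : Real.sqrt 2 ≤ 3 / 2 := by
      rw [Real.sqrt_le_left (by norm_num)]
      norm_num
    have h8 : Real.sqrt n * Real.sqrt n = n := Real.mul_self_sqrt hn0.le
    rw [div_le_div_iff₀ hn0 hℓ0, h6]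
    calc Real.sqrt 2 * Real.sqrt n * ℓ ≤ 3 / 2 * Real.sqrt n * (4 * Real.sqrt n) := by gcongr
      _ = 6 * (Real.sqrt n * Real.sqrt n) := by ring
      _ = 6 * n := by rw [h8]
  have h3 : Real.sqrt (ℓ / Real.pi) ≤ Real.sqrt ℓ :=
    Real.sqrt_le_sqrt (div_le_self hℓ0.le (by linarith [Real.pi_gt_three]))
  have hsp : 0 < Real.sqrt ℓ := Real.sqrt_pos.2 hℓ0
  have hs : Real.sqrt ℓ * Real.sqrt ℓ = ℓ := Real.mul_self_sqrt hℓ0.le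
  calc 2 * Real.sqrt (ℓ / Real.pi) *
      (1 / (2 * levelTransform n (1 + 1 / n)) + Real.sqrt (2 * n) / n)
      ≤ 2 * Real.sqrt ℓ * (16 / ℓ + 6 / ℓ) := by
        have : 0 ≤ 1 / (2 * levelTransform n (1 + 1 / n)) := one_div_nonneg.2 (by linarith)
        gcongr
    _ = 2 * Real.sqrt ℓ * (22 / (Real.sqrt ℓ * Real.sqrt ℓ)) := by rw [hs]; ring
    _ = 44 / Real.sqrt ℓ := by field_simp; norm_num

/-- The position of the root, scaled by its asymptotic value. -/
theorem exists_scaled_root (hn : n = 2 * h) (hℓ : 100 ≤ Real.log (gridSize n)) :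
    ∃ y : ℝ, 0 < y ∧ |y - 1| ≤ 40 / Real.log (gridSize n) ∧
      2 * Real.pi * y / (gridSize n * Real.log (gridSize n)) <
        8 / gridSize n * (1 / Real.log (gridSize n) * 2) ∧
      ∑ p : Vertex n, 1 / (1 - 2 * Real.pi * y / (gridSize n * Real.log (gridSize n)) - level p) =
        0 := by
  have hh : 2 ≤ h := by
    by_contra! hc
    have h1 : n ≤ 2 := by omega
    have h2 : (n : ℝ) ≤ 2 := by exact_mod_cast h1
    have h3 := Real.log_le_sub_one_of_pos (gridSize_pos (n := n))
    rw [gridSize] at h3 hℓ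
    nlinarith [Nat.cast_nonneg (α := ℝ) n]
  have hN := gridSize_pos (n := n)
  set N := gridSize n
  set ℓ := Real.log N with hℓdef
  have hℓ0 : 0 < ℓ := by linarith
  have hp := Real.pi_gt_three
  have hp4 := Real.pi_lt_d2
  have hp0 := Real.pi_pos
  have hS := abs_le.1 (abs_deflatedSum_sub_le hn)
  set S := deflatedSum (level : Vertex n → ℝ)
  -- The ratio of S to (N/π) ln N. In the scaled variable the endpoints of the root interval become
  -- yq ≤ 1 ≤ y(q + 1/ℓ).
  set q := S * Real.pi / (N * ℓ) with hq
  have hNq : N / Real.pi * ℓ * q = S := by rw [hq]; field_simp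
  have hq1 : |q - 1| ≤ 16 / ℓ := by
    have e : q - 1 = (S - N / Real.pi * ℓ) * Real.pi / (N * ℓ) := by
      rw [hq]
      field_simp
    have h1 : |S - N / Real.pi * ℓ| ≤ 5 * N := abs_le.2 hS
    rw [e, abs_div, abs_mul, abs_of_pos hp0, abs_of_pos (by positivity : 0 < N * ℓ),
      div_le_div_iff₀ (by positivity) hℓ0]
    calc |S - N / Real.pi * ℓ| * Real.pi * ℓ ≤ 5 * N * 3.2 * ℓ := by gcongr; linarith
      _ = 16 * (N * ℓ) := by ring
  have hℓ16 : 16 / ℓ ≤ 16 / 100 := by gcongr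
  have hq2 := abs_le.1 hq1
  have hSbig : 2 / (8 / N) < S := by
    have e : 2 / (8 / N) = N / 4 := by field_simp; norm_num
    rw [e, ← hNq]
    have : 1 / 4 < 1 / Real.pi * ℓ * q := by
      have h1 : 1 / 4 ≤ 1 / Real.pi := one_div_le_one_div_of_le hp0 (by linarith)
      have h2 : 1 / 4 * 100 * (1 / 2) ≤ 1 / Real.pi * ℓ * q := by gcongr; linarith
      linarith
    calc N / 4 = N * (1 / 4) := by ring
      _ < N * (1 / Real.pi * ℓ * q) := by gcongr
      _ = N / Real.pi * ℓ * q := by ring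
  obtain ⟨x, hx1, hx2, hx3⟩ := exists_stieltjes_root (by positivity : 0 < 8 / N)
    (level_gap hn hh) (sum_level_eq_one hn) hSbig
  have hS0 : 0 < S := lt_trans (by positivity) hSbig
  have hx0 : 0 < x := lt_of_lt_of_le (by positivity) hx1
  set y := x * (N * ℓ) / (2 * Real.pi) with hy
  have hxy : 2 * Real.pi * y / (N * ℓ) = x := by rw [hy]; field_simp
  have hy0 : 0 < y := by positivity
  have hyq1 : y * q ≤ 1 := by
    rw [le_div_iff₀ hS0] at hx2
    have : y * q = x * S / 2 := by rw [hy, hq]; field_simp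
    rw [this]
    linarith
  have hyq2 : 1 ≤ y * (q + 1 / ℓ) := by
    have e : 2 / (8 / N) = N / 4 := by field_simp; norm_num
    rw [e, div_le_iff₀ (by positivity)] at hx1
    have : y * (q + 1 / ℓ) = x * (S + N / Real.pi) / 2 := by
      rw [hy, hq]
      field_simp
    rw [this]
    have h1 : N / 4 ≤ N / Real.pi := by gcongr; linarith
    have : x * (S + N / 4) ≤ x * (S + N / Real.pi) := by gcongr
    linarith
  have hy2 : y ≤ 5 / 4 := by nlinarith
  have hinv : 0 < 1 / ℓ := by positivity
  have e16 : 16 / ℓ = 16 * (1 / ℓ) := by ring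
  have e40 : 40 / ℓ = 40 * (1 / ℓ) := by ring
  rw [e16] at hq2
  refine ⟨y, hy0, ?_, ?_, ?_⟩
  · rw [e40, abs_le]
    constructor <;> nlinarith
  · rw [hxy]
    have e : x = 2 * Real.pi * y / (N * ℓ) := hxy.symm
    have e2 : 8 / N * (1 / ℓ * 2) = 16 / (N * ℓ) := by field_simp; norm_num
    rw [e, e2]
    gcongr
    nlinarith
  · rw [hxy]
    exact hx3

end Asymptotics
-- Uniform asymptotics of the eigenphase and of the success probability.
section Search

variable {n : ℕ} [NeZero n] {h : ℕ}

/-- In units of the leading amplitude there are three errors of at most δ: the remaining spectral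
mass, the coefficient of the sine, and the replacement of t + 1/2 by t, which shifts the phase by
λ/2. Passing to squares costs a factor of at most 5, hence 15δ. -/
theorem search_asymptotics_of_bounds (hn : n = 2 * h) (hbig : 256 ≤ n) {δ η : ℝ} (hδ1 : δ ≤ 1)
    (hη : ∀ y x e : ℝ, |y - 1| < η → |x| < η → |e| < η →
      |Real.sqrt y - 1| < δ ∧ |Real.sqrt y / (1 - x / 4) - 1| < δ ∧
        |Real.sqrt y / ((1 - x / 2) * (1 + e / 2)) - 1| < δ ∧ |Real.pi * Real.sqrt (x / 2)| < δ)
    (hℓ : 100 ≤ Real.log (gridSize n)) (hℓη : 44 / Real.sqrt (Real.log (gridSize n)) < η)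
    (hℓδ : 44 / Real.sqrt (Real.log (gridSize n)) ≤ δ) {m₀ m₁ : Vertex n} (h₀ : EvenVertex m₀)
    (h₁ : ¬ EvenVertex m₁) :
    ∃ lam : ℝ, 0 < lam ∧ lam ≤ δ ∧ IsLeast {θ | θ ∈ eigenphases {m₀, m₁} ∧ 0 < θ} lam ∧
      IsGreatest {θ | θ ∈ eigenphases {m₀, m₁} ∧ θ < 0} (-lam) ∧
      |lam / (2 * Real.sqrt (Real.pi / (gridSize n * Real.log (gridSize n)))) - 1| ≤ δ ∧
      ∀ t : ℕ, |successProb {m₀, m₁} t / (Real.pi / (2 * Real.log (gridSize n))) -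
        Real.sin (lam * t) ^ 2| ≤ 15 * δ := by
  have hh : 2 ≤ h := by omega
  have hpi := Real.pi_pos
  obtain ⟨y, hy0, hy, hxg, hroot⟩ := exists_scaled_root hn hℓ
  have herr := error_term_le hn hbig
  have hN := gridSize_pos (n := n)
  have hn1 : (256 : ℝ) ≤ n := by exact_mod_cast hbig
  have hn0 : (0 : ℝ) < n := by linarith
  have hN1 : 8 / gridSize n ≤ 1 := by
    have := eight_div_gridSize_le hn hh
    linarith
  have hg0 : 0 < 8 / gridSize n := by positivity
  have hNn : gridSize n = (n : ℝ) ^ 2 := rfl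
  set ℓ := Real.log (gridSize n) with hℓdef
  have hℓ0 : 0 < ℓ := by linarith
  have hw0 : 0 < Real.sqrt ℓ := Real.sqrt_pos.2 hℓ0
  have hw : 40 / ℓ ≤ 44 / Real.sqrt ℓ := by
    rw [div_le_div_iff₀ hℓ0 hw0]
    have h1 := Real.sq_sqrt hℓ0.le
    have h2 : 10 ≤ Real.sqrt ℓ := Real.le_sqrt_of_sq_le (by linarith)
    nlinarith
  have hinv : 1 / ℓ ≤ 1 / 100 := one_div_le_one_div_of_le (by norm_num) hℓ
  have hinv0 : 0 < 1 / ℓ := by positivity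
  have h40 : 40 / ℓ = 40 * (1 / ℓ) := by ring
  have hxdef : ∃ x, x = 2 * Real.pi * y / (gridSize n * ℓ) := ⟨_, rfl⟩
  obtain ⟨x, hx⟩ := hxdef
  rw [← hx] at hxg hroot
  have hx0 : 0 < x := by rw [hx]; positivity
  have hxg' : x < 8 / gridSize n := by nlinarith
  have hx2 : x ≤ 2 * (1 / ℓ) := by nlinarith
  have hx1 : x ≤ 1 := by linarith
  obtain ⟨hS1, hS2⟩ := stieltjes_deriv_bounds (level_gap hn hh) (sum_level_eq_one hn) hx0 hxg' hroot
  obtain ⟨hleast, hgreatest⟩ := isLeast_eigenphases hn hh h₀ h₁ hx0 hxg' hroot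
  obtain ⟨κ, hκ, hamp⟩ := amplitude_estimate hn hh m₀ hx0 hxg' hroot
  set S := ∑ p : Vertex n, 1 / (1 - x - level p) ^ 2
  have hedef : ∃ e, e = x ^ 2 * S - 2 := ⟨_, rfl⟩
  obtain ⟨e, he⟩ := hedef
  have he0 : 0 ≤ e := by linarith
  have he1 : e ≤ 8 * (1 / ℓ) := by
    have : 2 * x / (8 / gridSize n - x) ≤ 8 * (1 / ℓ) := by
      rw [div_le_iff₀ (by linarith)]
      nlinarith
    linarith
  obtain ⟨hb1, hb2, hb3, hb4⟩ := hη y x e (by linarith)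
    (by rw [abs_of_pos hx0]; linarith) (by rw [abs_of_nonneg he0]; linarith)
  obtain ⟨hl1, hl2, hl3⟩ := half_arccos_bounds hx0 hx1
  have hlam0 : 0 < Real.arccos (1 - x) := Real.arccos_pos.2 (by linarith)
  set lam := Real.arccos (1 - x)
  have hs0 : 0 < Real.sqrt (x / 2) := Real.sqrt_pos.2 (by positivity)
  have hs2 : Real.sqrt (x / 2) ^ 2 = x / 2 := Real.sq_sqrt (by positivity)
  have hr0 : 0 < Real.sqrt (ℓ / Real.pi) := Real.sqrt_pos.2 (by positivity)
  have hr2 : Real.sqrt (ℓ / Real.pi) ^ 2 = ℓ / Real.pi := Real.sq_sqrt (by positivity)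
  set s := Real.sqrt (x / 2)
  set r := Real.sqrt (ℓ / Real.pi)
  have hsqrt : Real.sqrt y = s * n * r := by
    rw [← Real.sqrt_sq (by positivity : 0 ≤ s * n * r)]
    congr 1
    rw [mul_pow, mul_pow, hs2, hr2, hx, hNn]
    field_simp
  have hscale : Real.sqrt (Real.pi / (gridSize n * ℓ)) = 1 / (n * r) := by
    rw [← Real.sqrt_sq (by positivity : 0 ≤ 1 / (n * r))]
    congr 1
    rw [div_pow, mul_pow, hr2, hNn]
    field_simp
  have hlamδ : lam ≤ δ := by
    have := abs_lt.1 hb4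
    linarith
  refine ⟨lam, hlam0, hlamδ, hleast, hgreatest, ?_, fun t => ?_⟩
  · have e1 : lam / (2 * Real.sqrt (Real.pi / (gridSize n * ℓ))) = lam / 2 * (n * r) := by
      rw [hscale]
      field_simp
    have h1 : Real.sqrt y ≤ lam / 2 * (n * r) := by
      rw [hsqrt, mul_assoc]
      exact mul_le_mul_of_nonneg_right hl1 (by positivity)
    have h2 : lam / 2 * (n * r) ≤ Real.sqrt y / (1 - x / 4) := by
      rw [hsqrt, mul_assoc, mul_div_right_comm]
      exact mul_le_mul_of_nonneg_right hl2 (by positivity)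
    rw [e1, abs_le]
    have h3 := abs_lt.1 hb1
    have h4 := abs_lt.1 hb2
    constructor <;> linarith
  · obtain ⟨a, ha, hbound⟩ := hamp t
    have hp : successProb {m₀, m₁} t / (Real.pi / (2 * ℓ)) = (2 * r * a) ^ 2 := by
      obtain ⟨-, -, -, hdec⟩ := decoupling ⟨h, by omega⟩ m₀ m₁ h₀ h₁
      obtain ⟨-, -, e1, e2⟩ := hdec t
      rw [e1, ← e2, successProb_singleton, ha, Complex.norm_real, Real.norm_eq_abs, sq_abs, mul_pow,
        mul_pow, hr2]
      field_simp
      ring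
    -- The mass formula reads κ(2 - x)(2 + e) = Nx, so the normalised coefficient is √y up to
    -- factors tending to 1.
    have hB : 2 * r * (κ / (n * s)) = Real.sqrt y / ((1 - x / 2) * (1 + e / 2)) := by
      have e1 : κ * ((2 - x) * (2 + e)) = n ^ 2 * (2 * s ^ 2) := by
        rw [he, hs2, ← hNn, ← hκ]
        ring
      have e2 : 0 < 1 - x / 2 := by linarith
      have e3 : 0 < 1 + e / 2 := by linarith
      rw [hsqrt, eq_div_iff (by positivity), ← mul_div_assoc, div_mul_eq_mul_div,
        div_eq_iff (by positivity)]
      linear_combination r / 2 * e1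
    have h1 : |2 * r * a - 2 * r * (κ / (n * s)) * Real.sin ((t + 1 / 2) * lam)| ≤ δ := by
      rw [mul_assoc (2 * r), ← mul_sub, abs_mul, abs_of_pos (by positivity : 0 < 2 * r)]
      exact (mul_le_mul_of_nonneg_left hbound (by positivity)).trans (herr.trans hℓδ)
    have h2 : |2 * r * (κ / (n * s)) * Real.sin ((t + 1 / 2) * lam) -
        Real.sin ((t + 1 / 2) * lam)| ≤ δ := by
      rw [hB, ← sub_one_mul, abs_mul]
      exact (mul_le_of_le_one_right (abs_nonneg _) (Real.abs_sin_le_one _)).trans hb3.le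
    have h3 : |Real.sin ((t + 1 / 2) * lam) - Real.sin (lam * t)| ≤ δ := by
      refine (Real.abs_sin_sub_sin_le _ _).trans ?_
      rw [show (t + 1 / 2) * lam - lam * t = lam / 2 by ring, abs_of_pos (by positivity)]
      linarith
    have h4 : |2 * r * a - Real.sin (lam * t)| ≤ 3 * δ := by
      rw [abs_le] at *
      constructor <;> linarith
    have h5 : |2 * r * a + Real.sin (lam * t)| ≤ 5 := by
      have := abs_le.1 (Real.abs_sin_le_one (lam * t))
      rw [abs_le] at *
      constructor <;> linarith
    rw [hp, sq_sub_sq, abs_mul, mul_comm]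
    refine (mul_le_mul h4 h5 (abs_nonneg _) (by linarith)).trans (by linarith)

omit [NeZero n] in
theorem exists_search_asymptotics {ε : ℝ} (hε : 0 < ε) : ∃ n₀ : ℕ, 2 ≤ n₀ ∧
    ∀ (n : ℕ) [NeZero n], n₀ ≤ n → Even n →
    ∀ m₀ m₁ : Vertex n, EvenVertex m₀ → ¬ EvenVertex m₁ →
    ∃ lam : ℝ, 0 < lam ∧ lam ≤ ε ∧ IsLeast {θ | θ ∈ eigenphases {m₀, m₁} ∧ 0 < θ} lam ∧
      IsGreatest {θ | θ ∈ eigenphases {m₀, m₁} ∧ θ < 0} (-lam) ∧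
      |lam / (2 * Real.sqrt (Real.pi / (gridSize n * Real.log (gridSize n)))) - 1| ≤ ε ∧
      ∀ t : ℕ, |successProb {m₀, m₁} t / (Real.pi / (2 * Real.log (gridSize n))) -
        Real.sin (lam * t) ^ 2| ≤ ε := by
  set δ := min 1 (ε / 15)
  have hδ0 : 0 < δ := lt_min one_pos (by positivity)
  have hδ1 : δ ≤ 1 := min_le_left _ _
  have hδε : δ ≤ ε / 15 := min_le_right _ _
  obtain ⟨η, hη0, hη⟩ := exists_nhds_bounds hδ0
  have hlim : Filter.Tendsto (fun n : ℕ => Real.log (gridSize n)) Filter.atTop Filter.atTop :=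
    Real.tendsto_log_atTop.comp
      ((Filter.tendsto_pow_atTop two_ne_zero).comp tendsto_natCast_atTop_atTop)
  have hlim2 : Filter.Tendsto (fun n : ℕ => 44 / Real.sqrt (Real.log (gridSize n))) Filter.atTop
      (nhds 0) := (Real.tendsto_sqrt_atTop.comp hlim).const_div_atTop 44
  obtain ⟨n₀, hn₀⟩ := Filter.eventually_atTop.1
    (((hlim.eventually_ge_atTop 100).and (hlim2.eventually_lt_const hη0)).and
      (hlim2.eventually_lt_const hδ0))
  refine ⟨max n₀ 256, by omega, fun n _ hn heven m₀ m₁ h₀ h₁ => ?_⟩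
  obtain ⟨⟨hb1, hb2⟩, hb3⟩ := hn₀ n ((le_max_left _ _).trans hn)
  obtain ⟨h, hh⟩ := heven
  obtain ⟨lam, c1, c2, c3, c4, c5, c6⟩ := search_asymptotics_of_bounds (by omega : n = 2 * h)
    ((le_max_right _ _).trans hn) hδ1 hη hb1 hb2 hb3.le h₀ h₁
  exact ⟨lam, c1, by linarith, c3, c4, by linarith, fun t => (c6 t).trans (by linarith)⟩

end Search
end QWSearch

theorem mainTheorem2 :
    -- exact decoupling into two single-target searches, for every even side `n`
    (∀ (n : ℕ) [NeZero n], Even n → ∀ m₀ m₁ : Vertex n,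
      EvenVertex m₀ → ¬ EvenVertex m₁ →
        (evenSpace n)ᗮ = oddSpace n ∧
        (∀ ψ ∈ evenSpace n,
          searchStep {m₀, m₁} ψ ∈ evenSpace n ∧
          searchStep {m₀, m₁} ψ = searchStep {m₀} ψ) ∧
        (∀ ψ ∈ oddSpace n,
          searchStep {m₀, m₁} ψ ∈ oddSpace n ∧
          searchStep {m₀, m₁} ψ = searchStep {m₁} ψ) ∧
        (∀ t : ℕ,
          inner ℂ (diagKet m₀) (stateAt {m₀, m₁} t) =
            inner ℂ (diagKet m₀) (stateAt {m₀} t) ∧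
          inner ℂ (diagKet m₁) (stateAt {m₀, m₁} t) =
            inner ℂ (diagKet m₁) (stateAt {m₁} t) ∧
          successProb {m₀, m₁} t =
            successProb {m₀} t + successProb {m₁} t ∧
          successProb {m₀} t = successProb {m₁} t)) ∧
    -- asymptotics as `N = n² → ∞`, uniformly in the positions of the marked vertices
    (∀ ε : ℝ, 0 < ε → ∃ η : ℝ, 0 < η ∧ ∃ n₀ : ℕ, ∀ (n : ℕ) [NeZero n], n₀ ≤ n → Even n →
      ∀ m₀ m₁ : Vertex n, EvenVertex m₀ → ¬ EvenVertex m₁ →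
      ∃ lamPos lamNeg : ℝ,
        -- the two eigenphases nearest zero
        IsLeast {θ | θ ∈ eigenphases {m₀, m₁} ∧ 0 < θ} lamPos ∧
        IsGreatest {θ | θ ∈ eigenphases {m₀, m₁} ∧ θ < 0} lamNeg ∧
        lamNeg = -lamPos ∧
        |lamPos / (2 * √(Real.pi / (gridSize n * Real.log (gridSize n)))) - 1|
          ≤ ε ∧
        -- the success probability at every time
        (∀ t : ℕ,
          |successProb {m₀, m₁} t / (Real.pi / (2 * Real.log (gridSize n))) -
            Real.sin (lamPos * t) ^ 2| ≤ ε) ∧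
        -- a time maximizing `p` over the first period of `sin² (lamPos * t)`
        (∀ T : ℕ, (T : ℝ) ≤ Real.pi / lamPos →
          (∀ t : ℕ, (t : ℝ) ≤ Real.pi / lamPos →
            successProb {m₀, m₁} t ≤ successProb {m₀, m₁} T) →
          |T / (√(Real.pi * gridSize n * Real.log (gridSize n)) / 4) - 1| ≤ ε ∧
          |successProb {m₀, m₁} T / (Real.pi / (2 * Real.log (gridSize n))) - 1|
            ≤ ε) ∧
        -- no earlier time does nearly as well as the best time
        (∀ T : ℕ,
          (∀ t : ℕ, (1 - η) * successProb {m₀, m₁} t ≤ successProb {m₀, m₁} T) →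
          (1 - ε) * (√(Real.pi * gridSize n * Real.log (gridSize n)) / 4) ≤ T) ∧
        -- the explicit number of steps used by the algorithm
        |successProb {m₀, m₁}
            ⌊√(Real.pi * gridSize n * Real.log (gridSize n)) / 4⌋₊ /
          (Real.pi / (2 * Real.log (gridSize n))) - 1| ≤ ε) := by
  refine ⟨fun n _ hn m₀ m₁ h₀ h₁ => decoupling hn m₀ m₁ h₀ h₁, fun ε hε => ?_⟩
  -- Accuracy d² in the probability yields accuracy 8d in time, so the asymptotics are used with d²,
  -- which also serves as η.
  obtain ⟨d, hd⟩ : ∃ d, d = min ε 1 / 8 := ⟨_, rfl⟩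
  have hd0 : 0 < d := by rw [hd]; have := lt_min hε one_pos; positivity
  have hd1 : d ≤ 1 / 8 := by rw [hd]; linarith [min_le_right ε 1]
  have hdε : 8 * d ≤ ε := by rw [hd]; linarith [min_le_left ε 1]
  have hd2 : d ^ 2 ≤ ε := by nlinarith
  obtain ⟨n₀, hn₀, H⟩ := exists_search_asymptotics (pow_pos hd0 2)
  refine ⟨d ^ 2, by positivity, n₀, fun n _ hn heven m₀ m₁ h₀ h₁ => ?_⟩
  obtain ⟨lam, hlam0, hlam1, hleast, hgreatest, hratio, hf⟩ := H n hn heven m₀ m₁ h₀ h₁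
  have hpi := Real.pi_pos
  have hN : 0 < gridSize n := gridSize_pos
  have hℓ : 0 < Real.log (gridSize n) := by
    refine Real.log_pos ?_
    have : (2 : ℝ) ≤ n := by exact_mod_cast hn₀.trans hn
    rw [gridSize]
    nlinarith
  set ℓ := Real.log (gridSize n)
  have hP : 0 < Real.pi / (2 * ℓ) := by positivity
  have hτ0 : 0 < √(Real.pi * gridSize n * ℓ) / 4 := by positivity
  -- The phase at the proposed time, divided by π/2, is exactly the ratio of λ to its asymptotic
  -- value, because the two square roots multiply to π.
  have hτ : |lam * (√(Real.pi * gridSize n * ℓ) / 4) / (Real.pi / 2) - 1| ≤ d ^ 2 := by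
    have e : √(Real.pi / (gridSize n * ℓ)) * √(Real.pi * gridSize n * ℓ) = Real.pi := by
      rw [← Real.sqrt_mul (by positivity), ← Real.sqrt_sq hpi.le]
      congr 1
      rw [Real.sqrt_sq hpi.le]
      field_simp
    have hs : 0 < √(Real.pi / (gridSize n * ℓ)) := by positivity
    have e2 : lam * (√(Real.pi * gridSize n * ℓ) / 4) / (Real.pi / 2) =
        lam / (2 * √(Real.pi / (gridSize n * ℓ))) := by
      rw [div_eq_div_iff (by positivity) (by positivity)]
      linear_combination lam / 2 * e
    rwa [e2]
  have hperiod (t : ℕ) : (t : ℝ) ≤ Real.pi / lam ↔ lam * t ≤ Real.pi := le_div_iff₀' hlam0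
  refine ⟨lam, -lam, hleast, hgreatest, rfl, hratio.trans hd2, fun t => (hf t).trans hd2,
    fun T hT hmax => ?_, fun T hmax => ?_, ?_⟩
  · obtain ⟨h1, h2⟩ := maximal_time_estimate hd0 hd1 hlam0 hlam1 hτ0 hτ hf ((hperiod T).1 hT)
      fun t ht => div_le_div_of_nonneg_right (hmax t ((hperiod t).2 ht)) hP.le
    exact ⟨h1.trans hdε, h2.trans hdε⟩
  · refine le_trans (mul_le_mul_of_nonneg_right (by linarith) hτ0.le)
      (le_of_nearly_maximal hd0 hd1 hlam0 hlam1 hτ0 hτ hf fun t => ?_)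
    rw [← mul_div_assoc]
    exact div_le_div_of_nonneg_right (hmax t) hP.le
  · exact (floor_time_estimate hd0 hd1 hlam0 hlam1 hτ0 hτ hf).trans hdε
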